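/- Let $\mathfrak A$ be an infinite alphabet. A word is an element of the free monoid $\mathfrak A^*$; a subword is a contiguous factor. A letter is linear in a word $\mathbf u$ if it occurs in $\mathbf u$ exactly once, and non-linear if it occurs more than once. A block of $\mathbf u$ is a maximal subword of $\mathbf u$ containing no linear letter of $\mathbf u$, and $\mathbf u$ is block-2-simple if each block of $\mathbf u$ involves at most two distinct letters. A word $\mathbf u$ is an isoterm for a monoid $S$ if $S$ satisfies no identity $\mathbf u\approx\mathbf v$ with $\mathbf v\neq\mathbf u$. For sets of words $W,W'$ write $W\preceq W'$ if for every monoid $S$: whenever each word of $W$ is an isoterm for $S$, each word of $W'$ is an isoterm for $S$; for a word $\mathbf n$ write $W\preceq\mathbf n$ for $W\preceq\{\mathbf n\}$. Let $S(W)$ be the Rees quotient of $\mathfrak A^*$ over the ideal of all words that are not subwords of words in $W$. The set $W$ is non-finitely based (NFB) if there is no finite set of semigroup identities of $S(W)$ from which all semigroup identities of $S(W)$ can be deduced. Let $A_4$ be the set of all words with at most one non-linear letter, in which some letter occurs exactly $4$ times and at most $5$ letters are linear. Let $x,y,t_1,t_2\in\mathfrak A$ be distinct letters, and let $(I,N)$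 be one of the following four pairs: 1. $I=\{yxxt_1y,\; yt_1xxy\}$, $\quad N=\{xt_1xyt_2y\}\cup\{xy^mx \mid m>1\}$; 2. $I=\{xt_1xyt_2y,\; xyt_1xy,\; xyt_1yx\}$, $\quad N=A_4\cup\{xyxy\}$; 3. $I=\{xt_1xyt_2y,\; xyyx\}$, $\quad N=A_4\cup\{xxyy\}$; 4. $I=\{xt_1xyt_2y,\; xyt_1xy,\; xyt_1yx\}$, $\quad N=\{xyxyx\}\cup\{xy^mx \mid m>1\}$. If $W$ is a set of block-2-simple words such that $W\preceq I$ but $W\not\preceq\mathbf n$ for every $\mathbf n\in N$, then $W$ is NFB. -/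

import Mathlib

universe u v

namespace WordBasis

/-! Words over an alphabet `α` are the elements of the free monoid `FreeMonoid α`. -/

/-- The word spelled by a list of letters. -/
abbrev word {α : Type u} (l : List α) : FreeMonoid α := FreeMonoid.ofList l

/-- The number of occurrences of the letter `a` in the word `w`. -/
def occ {α : Type u} [DecidableEq α] (a : α) (w : FreeMonoid α) : ℕ :=
  (FreeMonoid.toList w).count a

/-- `a` is linear in `w`: it occurs exactly once. -/
def IsLinear {α : Type u} [DecidableEq α] (a : α) (w : FreeMonoid α) : Prop := occ a w = 1

/-- `a` is non-linear in `w`: it occurs more than once. -/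
def IsNonlinear {α : Type u} [DecidableEq α] (a : α) (w : FreeMonoid α) : Prop := 1 < occ a w

/-- `b` is a block of `w`: a maximal subword of `w` (contiguous, at some position `w = p * b * s`)
that contains no linear variable of `w`.  Maximality: the letter just before it and the letter
just after it, if there are any, are linear in `w`. -/
def IsBlock {α : Type u} [DecidableEq α] (b w : FreeMonoid α) : Prop :=
  ∃ p s : FreeMonoid α, w = p * b * s ∧
    (∀ a ∈ FreeMonoid.toList b, ¬ IsLinear a w) ∧
    (∀ a ∈ (FreeMonoid.toList p).getLast?, IsLinear a w) ∧
    (∀ a ∈ (FreeMonoid.toList s).head?, IsLinear a w)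

/-- `w` is block-`n`-simple: each block of `w` depends on at most `n` variables. -/
def BlockSimple {α : Type u} [DecidableEq α] (n : ℕ) (w : FreeMonoid α) : Prop :=
  ∀ b : FreeMonoid α, IsBlock b w → (FreeMonoid.toList b).toFinset.card ≤ n

/-- The closure of a set of words under taking (contiguous) subwords. -/
def subwords {α : Type u} (W : Set (FreeMonoid α)) : Set (FreeMonoid α) :=
  {u | ∃ w ∈ W, ∃ p s : FreeMonoid α, w = p * u * s}

theorem subwords_of_mul {α : Type u} {W : Set (FreeMonoid α)} {u v : FreeMonoid α}
    (h : u * v ∈ subwords W) : u ∈ subwords W ∧ v ∈ subwords W := by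
  obtain ⟨w, hw, p, s, rfl⟩ := h
  exact ⟨⟨_, hw, p, v * s, by simp only [mul_assoc]⟩, ⟨_, hw, p * u, s, by simp only [mul_assoc]⟩⟩

/-- The Rees congruence of the ideal of all words that are not subwords of words in `W`: two words
are congruent if they are equal or both lie in the ideal. -/
def reesCon {α : Type u} (W : Set (FreeMonoid α)) : Con (FreeMonoid α) where
  r u v := u = v ∨ (u ∉ subwords W ∧ v ∉ subwords W)
  iseqv :=
    { refl := fun _ => Or.inl rfl
      symm := by
        rintro u v (h | ⟨h1, h2⟩)
        · exact Or.inl h.symm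
        · exact Or.inr ⟨h2, h1⟩
      trans := by
        rintro u v w (rfl | ⟨h1, h2⟩) (rfl | ⟨h3, h4⟩)
        · exact Or.inl rfl
        · exact Or.inr ⟨h3, h4⟩
        · exact Or.inr ⟨h1, h2⟩
        · exact Or.inr ⟨h1, h4⟩ }
  mul' := by
    rintro u v u' v' (rfl | ⟨h1, h2⟩) (rfl | ⟨h3, h4⟩)
    · exact Or.inl rfl
    · exact Or.inr ⟨fun h => h3 (subwords_of_mul h).2, fun h => h4 (subwords_of_mul h).2⟩
    · exact Or.inr ⟨fun h => h1 (subwords_of_mul h).1, fun h => h2 (subwords_of_mul h).1⟩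
    · exact Or.inr ⟨fun h => h1 (subwords_of_mul h).1, fun h => h2 (subwords_of_mul h).1⟩

/-- The monoid `S(W)`: the Rees quotient of the free monoid over the ideal of all words that are
not subwords of words in `W`. -/
abbrev SMonoid {α : Type u} (W : Set (FreeMonoid α)) : Type u := (reesCon W).Quotient

/-- The monoid `S` satisfies the identity `u ≈ v`. -/
def MonoidSat {α : Type u} (S : Type v) [Monoid S] (u v : FreeMonoid α) : Prop :=
  ∀ φ : FreeMonoid α →* S, φ u = φ v

/-- The word `u` is an isoterm for the monoid `S`: `S` satisfies no non-trivial identity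
`u ≈ v`. -/
def Isoterm {α : Type u} (S : Type v) [Monoid S] (u : FreeMonoid α) : Prop :=
  ∀ v : FreeMonoid α, MonoidSat S u v → u = v

/-- The quasi-order `W ⪯ W'` on sets of words: for every monoid `S`, if each word in `W` is an
isoterm for `S`, then each word in `W'` is an isoterm for `S`. -/
def Prec {α : Type u} (W W' : Set (FreeMonoid α)) : Prop :=
  ∀ (S : Type u) [Monoid S], (∀ w ∈ W, Isoterm S w) → ∀ w ∈ W', Isoterm S w

/-- The semigroup `S` satisfies the semigroup identity `u ≈ v`. -/
def SemigroupSat {α : Type u} (S : Type v) [Semigroup S] (u v : FreeSemigroup α) : Prop :=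
  ∀ φ : FreeSemigroup α →ₙ* S, φ u = φ v

/-- The identity `u ≈ v` may be deduced from the set of identities `E` (equational deduction for
semigroups). -/
inductive Deducible {α : Type u} (E : Set (FreeSemigroup α × FreeSemigroup α)) :
    FreeSemigroup α → FreeSemigroup α → Prop
  | of {u v : FreeSemigroup α} : (u, v) ∈ E → Deducible E u v
  | refl (u : FreeSemigroup α) : Deducible E u u
  | symm {u v : FreeSemigroup α} : Deducible E u v → Deducible E v u
  | trans {u v w : FreeSemigroup α} : Deducible E u v → Deducible E v w → Deducible E u w
  | mul {u v u' v' : FreeSemigroup α} :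
      Deducible E u v → Deducible E u' v' → Deducible E (u * u') (v * v')
  | subst {u v : FreeSemigroup α} (θ : FreeSemigroup α →ₙ* FreeSemigroup α) :
      Deducible E u v → Deducible E (θ u) (θ v)

/-- The semigroup `S` is finitely based: all of its identities (over the alphabet `α` of
variables) may be deduced from some finite set of its identities. -/
def FinitelyBased (α : Type u) (S : Type v) [Semigroup S] : Prop :=
  ∃ E : Set (FreeSemigroup α × FreeSemigroup α), E.Finite ∧
    (∀ e ∈ E, SemigroupSat S e.1 e.2) ∧
    ∀ u v : FreeSemigroup α, SemigroupSat S u v → Deducible E u v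

/-- A set of words `W` is non-finitely based if the monoid `S(W)` is not finitely based. -/
def NFB {α : Type u} (W : Set (FreeMonoid α)) : Prop := ¬ FinitelyBased α (SMonoid W)

/-- The set `A_n` of all almost-linear words (at most one non-linear variable) in which some
variable occurs exactly `n` times and which have at most `n + 1` linear variables. -/
def almostLinearWords (α : Type u) [DecidableEq α] (n : ℕ) : Set (FreeMonoid α) :=
  {w | (∀ a b : α, IsNonlinear a w → IsNonlinear b w → a = b) ∧
    (∃ a : α, occ a w = n) ∧ {a : α | IsLinear a w}.ncard ≤ n + 1}

/-- The set of words `x y ^ m x` with `m > 1`. -/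
def powerWords {α : Type u} (x y : α) : Set (FreeMonoid α) :=
  {w | ∃ m : ℕ, 1 < m ∧ w = FreeMonoid.of x * FreeMonoid.of y ^ m * FreeMonoid.of x}

/-- The four rows `(I, N)` of the table, written in the letters `x`, `y`, `t₁`, `t₂`; several
occurrences of the letter `t` in a word of the table stand for distinct linear variables. -/
inductive TableRow {α : Type u} [DecidableEq α] (x y t₁ t₂ : α) :
    Set (FreeMonoid α) → Set (FreeMonoid α) → Prop
  | row1 : TableRow x y t₁ t₂
      {word [y, x, x, t₁, y], word [y, t₁, x, x, y]}
      ({word [x, t₁, x, y, t₂, y]} ∪ powerWords x y)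
  | row2 : TableRow x y t₁ t₂
      {word [x, t₁, x, y, t₂, y], word [x, y, t₁, x, y], word [x, y, t₁, y, x]}
      (almostLinearWords α 4 ∪ {word [x, y, x, y]})
  | row3 : TableRow x y t₁ t₂
      {word [x, t₁, x, y, t₂, y], word [x, y, y, x]}
      (almostLinearWords α 4 ∪ {word [x, x, y, y]})
  | row4 : TableRow x y t₁ t₂
      {word [x, t₁, x, y, t₂, y], word [x, y, t₁, x, y], word [x, y, t₁, y, x]}
      ({word [x, y, x, y, x]} ∪ powerWords x y)

end WordBasis

/-! Finite basis fails as soon as, for every K, the monoid S(W) satisfies an identity U ≈ V with U ≠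
V such that every identity s ≈ t of S(W) with at most K letters in s, and with U a nonerasing image
of s, is trivial (`not_finitelyBased_of`). Identities in few letters then never move U.

The rigidity of U comes from I. Each letter of U occurs twice and no factor of length two repeats.
Hence a letter occurring twice in s is sent to a single letter, and any segment of s whose image is
longer than 2K contains a linear letter of s. The word U is built so that, for adjacent letters p, q
of s, the relevant gaps are long. Deleting from s all letters but p, q and suitable linear letters
then leaves a word whose identities are controlled by I, and this fixes the order of p and q. A word
is determined by its letter counts and the order of its adjacent occurrences (`eq_of_before`), so t
= s.

The identity U ≈ V comes from N. Only substitutions that send U or V to a subword of W matter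
(`lsat_of_flatMap_eq`). In such an image every letter occurs at least twice, so there are at most
two letters (`IsSub.card_le`). A word n with W ⋠ n is not an isoterm for S(W)
(`not_iso_of_not_prec`), so it is not a subword of W either. In row 1 the image must be a power of
one letter. In row 4 the images of the two halves of U must coincide (`eq_of_halves`). In rows 2 and
3 no letter occurs four times (`IsSub.count_le_three`), so at most two letters of U have a nonempty
image; excluding abab or aabb leaves only pairs on which U and V agree.

In rows 1, 2 and 4, U = AB where B permutes A by k ↦ rk + c modulo r² − 1, and V is BA (rows 1, 4)
or the reverse of U (row 2). In row 3, U is a product of two long palindromes on disjoint alphabets,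
and V is the product in the other order. -/

namespace WordBasis

/-- The monoid `S` satisfies the identity `u ≈ v` between words written as lists. -/
def LSat {α : Type u} (S : Type v) [Monoid S] (u v : List α) : Prop :=
  MonoidSat S (word u) (word v)

/-- The word spelled by a list is an isoterm for `S`. -/
def Iso {α : Type u} (S : Type v) [Monoid S] (u : List α) : Prop :=
  ∀ v : List α, LSat S u v → u = v

/-! ### Identities, isoterms and renaming of letters -/

section Sat

variable {α : Type u} {S : Type v} [Monoid S]

theorem LSat.symm {u v : List α} (h : LSat S u v) : LSat S v u := fun φ => (h φ).symm

theorem LSat.append {u v u' v' : List α} (h : LSat S u v) (h' : LSat S u' v') :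
    LSat S (u ++ u') (v ++ v') := fun φ => by
  have h1 := h φ
  have h2 := h' φ
  simp only [word, FreeMonoid.ofList_append, map_mul] at *
  rw [h1, h2]

theorem LSat.refl (u : List α) : LSat S u u := fun _ => rfl

theorem lift_word (f : α → List α) (s : List α) :
    FreeMonoid.lift (fun a => word (f a)) (word s) = word (s.flatMap f) := by
  induction s with
  | nil => rfl
  | cons a s ih =>
    simp only [word, FreeMonoid.ofList_cons, map_mul, List.flatMap_cons,
      FreeMonoid.ofList_append, FreeMonoid.lift_eval_of] at *
    rw [ih]

theorem LSat.flatMap {u v : List α} (h : LSat S u v) (f : α → List α) :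
    LSat S (u.flatMap f) (v.flatMap f) := fun φ => by
  have := h (φ.comp (FreeMonoid.lift fun a => word (f a)))
  simpa only [MonoidHom.comp_apply, lift_word] using this

theorem LSat.map {u v : List α} (h : LSat S u v) (f : α → α) :
    LSat S (u.map f) (v.map f) := by
  have := h.flatMap (fun a => [f a])
  simpa only [← List.map_eq_flatMap] using this

theorem filter_eq_flatMap (P : α → Bool) (l : List α) :
    l.filter P = l.flatMap fun a => if P a then [a] else [] := by
  induction l with
  | nil => rfl
  | cons a l ih => by_cases h : P a <;> simp [h, ih]

theorem LSat.filter {u v : List α} (h : LSat S u v) (P : α → Bool) :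
    LSat S (u.filter P) (v.filter P) := by
  rw [filter_eq_flatMap, filter_eq_flatMap]
  exact h.flatMap _

theorem Iso.factor {X w Z : List α} (h : Iso S (X ++ w ++ Z)) : Iso S w := fun v hv => by
  have := h _ (((LSat.refl X).append hv).append (LSat.refl Z))
  simpa using this

theorem Iso.map_perm {w : List α} (h : Iso S w) (e : Equiv.Perm α) : Iso S (w.map e) :=
  fun v hv => by
    have h1 := h _ (by simpa using hv.map e.symm)
    rw [h1]
    simp

theorem exists_perm_of_nodup {l l' : List α} (hl : l.Nodup) (hl' : l'.Nodup)
    (hlen : l.length = l'.length) : ∃ e : Equiv.Perm α, l.map e = l' := by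
  have := Equiv.Perm.isMultiplyPretransitive α l.length
  obtain ⟨e, he⟩ := this.exists_smul_eq (x := ⟨l.get, List.nodup_iff_injective_get.1 hl⟩)
    (y := ⟨fun i => l'.get (i.cast hlen), fun i j h => by
      simpa using List.nodup_iff_injective_get.1 hl' h⟩)
  refine ⟨e, List.ext_get (by simpa using hlen) fun i h1 h2 => ?_⟩
  have := congrArg (fun F : Fin l.length ↪ α => F ⟨i, by simpa using h1⟩) he
  simpa using this

/-- Isoterms may be renamed. -/
theorem Iso.rename {β : Type*} {w : List β} {g g' : β → α} {l : List β} (hw : ∀ b ∈ w, b ∈ l)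
    (hl : (l.map g).Nodup) (hl' : (l.map g').Nodup) (h : Iso S (w.map g)) :
    Iso S (w.map g') := by
  -- The renaming is extended to a permutation of the whole alphabet, because the other side of an
  -- identity may contain further letters and the renaming has to be undone there.
  obtain ⟨e, he⟩ := exists_perm_of_nodup hl hl' (by simp)
  have := h.map_perm e
  rw [List.map_map] at this
  rw [List.map_map] at he
  convert this using 1
  refine List.map_congr_left fun b hb => ?_
  exact (List.map_inj_left.1 he b (hw b hb)).symm

theorem Iso.rename₄ {x y z t a b c d : α} (w : List (Fin 4)) (hl : [x, y, z, t].Nodup)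
    (hl' : [a, b, c, d].Nodup) (h : Iso S (w.map ![x, y, z, t])) :
    Iso S (w.map ![a, b, c, d]) :=
  h.rename (l := [0, 1, 2, 3]) (fun b _ => by fin_cases b <;> simp) (by simpa using hl)
    (by simpa using hl')

end Sat

/-! ### Recovering a word from the order of its adjacent occurrences -/

section Order

variable {α : Type u} [DecidableEq α]

/-- In `v`, the `l`-th occurrence of `d` (counted from `0`) comes after more than `k`
occurrences of `c`. -/
def Before (c d : α) (k l : ℕ) (v : List α) : Prop :=
  ∀ V₁ V₂ : List α, v = V₁ ++ d :: V₂ → V₁.count d = l → k < V₁.count c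

/-- Compare first letters. If `t` starts with a letter `e` that does not start `s`, the first `e` in
`s` has a predecessor `p ≠ e`, so some `p` must precede the first `e` in `t`, which is impossible.
Then strip the common first letter and induct. -/
theorem eq_of_before {s t : List α} (hcount : ∀ x, t.count x = s.count x)
    (h : ∀ X₀ p q X₁, s = X₀ ++ p :: q :: X₁ → p ≠ q →
      Before p q (X₀.count p) (X₀.count q) t) : t = s := by
  induction s generalizing t with
  | nil =>
    cases t with
    | nil => rfl
    | cons a t => simpa using hcount a
  | cons c s ih =>
    cases t with
    | nil => simpa using hcount c
    | cons e t =>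
      have hec : e = c := by
        by_contra hne
        have he : e ∈ c :: s := by
          rw [← List.count_pos_iff, ← hcount]; simp
        obtain ⟨X, Y, hX, heX⟩ := List.eq_append_cons_of_mem he
        rcases List.eq_nil_or_concat X with rfl | ⟨X', p, rfl⟩
        · simp at hX
          exact hne hX.1.symm
        · have hpe : p ≠ e := by
            rintro rfl
            simp at heX
          have := h X' p e Y (by simpa using hX) hpe [] t rfl (by
            rw [List.count_nil, List.count_eq_zero_of_not_mem]
            intro h'
            exact heX (by simp [h']))
          simp at this
      subst hec
      congr 1
      refine ih (fun x => ?_) fun X₀ p q X₁ hs hpq V₁ V₂ hV hc => ?_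
      · have := hcount x
        rwa [List.count_cons, List.count_cons, Nat.add_right_cancel_iff] at this
      · have := h (e :: X₀) p q X₁ (by simp [hs]) hpq (e :: V₁) V₂ (by simp [hV])
          (by simp [List.count_cons, hc])
        simpa [List.count_cons] using this

/-- The restriction of a word to the letters listed in `P`. -/
def res (P l : List α) : List α := l.filter (· ∈ P)

theorem res_append (P l l' : List α) : res P (l ++ l') = res P l ++ res P l' := by simp [res]

theorem res_cons_of_mem {P l : List α} {a : α} (h : a ∈ P) : res P (a :: l) = a :: res P l := by
  simp [res, h]

theorem res_cons_of_not_mem {P l : List α} {a : α} (h : a ∉ P) : res P (a :: l) = res P l := by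
  simp [res, h]

theorem res_eq_nil {P l : List α} (h : ∀ a ∈ P, a ∉ l) : res P l = [] := by
  simp only [res, List.filter_eq_nil_iff, decide_eq_true_eq]
  exact fun a ha haP => h a haP ha

theorem count_res {P : List α} {a : α} (h : a ∈ P) (l : List α) :
    (res P l).count a = l.count a := by
  rw [res, List.count_filter]
  simpa using h

theorem mem_of_mem_res {P l : List α} {a : α} (h : a ∈ res P l) : a ∈ P := by
  simpa using (List.mem_filter.1 h).2

theorem LSat.res {S : Type v} [Monoid S] {u v : List α} (h : LSat S u v) (P : List α) :
    LSat S (res P u) (res P v) := h.filter _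

theorem Before.of_res {P : List α} {c d : α} (hc : c ∈ P) (hd : d ∈ P) {k l : ℕ} {v : List α}
    (h : Before c d k l (res P v)) : Before c d k l v := fun V₁ V₂ hV hcount => by
  have := h (res P V₁) (res P V₂) (by rw [hV, res_append, res_cons_of_mem hd])
    (by rwa [count_res hd])
  rwa [count_res hc] at this

theorem eq_of_append_cons_eq {X Y X' Y' : List α} {d : α} (h : X ++ d :: Y = X' ++ d :: Y')
    (hc : X.count d = X'.count d) : X = X' := by
  induction X generalizing X' with
  | nil =>
    cases X' with
    | nil => rfl
    | cons a X' =>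
      simp at h
      simp [h.1] at hc
  | cons a X ih =>
    cases X' with
    | nil =>
      simp at h
      simp [h.1] at hc
    | cons b X' =>
      simp only [List.cons_append, List.cons.injEq] at h
      obtain ⟨rfl, h⟩ := h
      rw [ih h (by simpa [List.count_cons] using hc)]

theorem before_of_eq {c d : α} (X₀ X₁ : List α) :
    Before c d (X₀.count c) (X₀.count d) (X₀ ++ c :: d :: X₁) ∨ c = d := by
  by_cases hcd : c = d
  · exact Or.inr hcd
  refine Or.inl fun V₁ V₂ hV hcount => ?_
  have := eq_of_append_cons_eq (X := X₀ ++ [c]) (Y := X₁) (by simpa using hV)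
    (by simp [hcd, hcount])
  simp [← this]

theorem before_of_res_eq {P s t X₀ X₁ : List α} {p q : α} (hpq : p ≠ q) (hp : p ∈ P) (hq : q ∈ P)
    (hs : s = X₀ ++ p :: q :: X₁) (h : res P s = res P t) :
    Before p q (X₀.count p) (X₀.count q) t := by
  refine Before.of_res hp hq ?_
  rw [← h, hs, res_append, res_cons_of_mem hp, res_cons_of_mem hq, ← count_res hp X₀,
    ← count_res hq X₀]
  exact (before_of_eq _ _).resolve_right hpq

end Order

/-! ### Words in few letters that cover a long word -/

section Cover

variable {α : Type u} [DecidableEq α]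

theorem exists_split_of_count_eq_one {p : α} {l : List α} (h : l.count p = 1) :
    ∃ Y Z, l = Y ++ p :: Z ∧ p ∉ Y ∧ p ∉ Z := by
  obtain ⟨Y, Z, rfl, hY⟩ := List.eq_append_cons_of_mem
    (List.count_pos_iff.1 (by rw [h]; exact one_pos) : p ∈ l)
  refine ⟨Y, Z, rfl, hY, fun hZ => ?_⟩
  have := List.count_pos_iff.2 hZ
  simp at h
  omega

theorem exists_split_of_count_eq_two {p : α} {l : List α} (h : l.count p = 2) :
    ∃ X Y Z, l = X ++ p :: (Y ++ p :: Z) ∧ p ∉ X ∧ p ∉ Y ∧ p ∉ Z := by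
  obtain ⟨X, l', rfl, hX⟩ := List.eq_append_cons_of_mem
    (List.count_pos_iff.1 (by rw [h]; exact two_pos) : p ∈ l)
  have h0 := List.count_eq_zero_of_not_mem hX
  obtain ⟨Y, Z, rfl, hY, hZ⟩ := exists_split_of_count_eq_one (p := p) (l := l')
    (by simp [h0] at h; omega)
  exact ⟨X, Y, Z, rfl, hX, hY, hZ⟩

theorem not_mem_of_count_append_cons {t : α} {A B : List α} (h : (A ++ t :: B).count t = 1) :
    t ∉ A ∧ t ∉ B := by
  simp at h
  constructor <;> intro hm <;> have := List.count_pos_iff.2 hm <;> omega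

theorem res_singleton (x : α) (s : List α) : res [x] s = List.replicate (s.count x) x := by
  rw [List.eq_replicate_iff]
  refine ⟨?_, fun b hb => by simpa using mem_of_mem_res hb⟩
  rw [List.count, List.countP_eq_length_filter]
  congr 1
  refine List.filter_congr fun a _ => ?_
  simp [Bool.beq_eq_decide_eq]

theorem count_mul_count_le (f : α → List α) (x a : α) (s : List α) :
    s.count x * (f x).count a ≤ (s.flatMap f).count a := by
  induction s with
  | nil => simp
  | cons b s ih =>
    rw [List.flatMap_cons, List.count_append, List.count_cons]
    split_ifs with h
    · simp only [beq_iff_eq] at h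
      subst h
      linarith
    · linarith

/-- The word `U`, each of whose letters occurs at most twice and none of whose subwords of length
two occurs twice, is the image of the word `s` in at most `K` letters under the nonerasing
substitution `f`. -/
structure Cover (U s : List α) (f : α → List α) (K : ℕ) : Prop where
  eq : s.flatMap f = U
  ne : ∀ x ∈ s, f x ≠ []
  card : s.toFinset.card ≤ K
  two : ∀ a, U.count a ≤ 2
  norep : ∀ X₀ X₁ X₂ c d, U ≠ X₀ ++ c :: d :: (X₁ ++ c :: d :: X₂)

namespace Cover

variable {U s : List α} {f : α → List α} {K : ℕ}

theorem count_le_two (h : Cover U s f K) (x : α) : s.count x ≤ 2 := by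
  by_cases hx : x ∈ s
  · obtain ⟨a, l, hl⟩ := List.exists_cons_of_ne_nil (h.ne x hx)
    have h1 := count_mul_count_le f x a s
    rw [h.eq] at h1
    have h2 := h.two a
    have h3 : 1 ≤ (f x).count a := by simp [hl]
    nlinarith
  · simp [List.count_eq_zero_of_not_mem hx]

/-- Two leading letters of the image of `x` would form a factor of length two appearing twice in
`U`. -/
theorem exists_eq_singleton (h : Cover U s f K) {x : α} (hx : s.count x = 2) :
    ∃ c, f x = [c] := by
  obtain ⟨X, Y, Z, hs, -⟩ := exists_split_of_count_eq_two hx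
  obtain ⟨c, l, hl⟩ := List.exists_cons_of_ne_nil (h.ne x (by simp [hs]))
  cases l with
  | nil => exact ⟨c, hl⟩
  | cons d l =>
    refine absurd h.eq.symm ?_
    have := h.norep (X.flatMap f) (l ++ Y.flatMap f) (l ++ Z.flatMap f) c d
    simpa [hs, hl] using this

theorem count_cases (h : Cover U s f K) {x : α} (hx : x ∈ s) :
    s.count x = 1 ∨ s.count x = 2 := by
  have := h.count_le_two x
  have := List.count_pos_iff.2 hx
  omega

/-- A long segment contains the image of a linear letter. -/
theorem exists_linear (h : Cover U s f K) {Y₀ Y₁ Y₂ : List α} (hs : s = Y₀ ++ (Y₁ ++ Y₂))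
    (hlen : 2 * K < (Y₁.flatMap f).length) : ∃ t ∈ Y₁, s.count t = 1 := by
  -- Without linear letters every image has length one, so the image of `Y₁` is as long as `Y₁`,
  -- which has at most `K` letters, each used at most twice.
  by_contra! hcon
  have hmem : ∀ x ∈ Y₁, x ∈ s := fun x hx => by simp [hs, hx]
  have h1 : ∀ x ∈ Y₁, (f x).length = 1 := fun x hx => by
    obtain ⟨c, hc⟩ := h.exists_eq_singleton
      ((h.count_cases (hmem x hx)).resolve_left (hcon x hx))
    simp [hc]
  have h2 : (Y₁.flatMap f).length = Y₁.length := by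
    rw [List.length_flatMap, List.map_congr_left h1]
    simp
  have h3 : Y₁.length ≤ Y₁.toFinset.card * 2 := by
    rw [← List.sum_toFinset_count_eq_length]
    refine Finset.sum_le_card_nsmul _ _ _ fun x _ => ?_
    refine le_trans ?_ (h.count_le_two x)
    simp [hs]
    omega
  have h4 : Y₁.toFinset.card ≤ s.toFinset.card :=
    Finset.card_le_card fun x hx => by simpa using hmem x (by simpa using hx)
  have := h.card
  omega

theorem exists_linear_split (h : Cover U s f K) {p q : α} (Y₀ Y₁ Y₂ : List α)
    (hs : s = Y₀ ++ (Y₁ ++ Y₂)) (hlen : 2 * K < (Y₁.flatMap f).length) (hp : p ∉ Y₁)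
    (hq : q ∉ Y₁) :
    ∃ t A B, Y₁ = A ++ t :: B ∧ t ∉ Y₀ ∧ t ∉ A ∧ t ∉ B ∧ t ∉ Y₂ ∧ t ≠ p ∧ t ≠ q := by
  obtain ⟨t, ht, ht1⟩ := h.exists_linear hs hlen
  obtain ⟨A, B, rfl⟩ := List.append_of_mem ht
  have h1 := not_mem_of_count_append_cons (A := Y₀ ++ A) (B := B ++ Y₂) (t := t)
    (by rw [← ht1, hs]; simp)
  simp only [List.mem_append, List.mem_cons, not_or] at h1 hp hq
  exact ⟨t, A, B, rfl, h1.1.1, h1.1.2, h1.2.1, h1.2.2, fun e => hp.2.1 e.symm,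
    fun e => hq.2.1 e.symm⟩

end Cover

theorem iso_res_of_linear {S : Type v} [Monoid S] {s X₀ X₁ : List α} {p q : α}
    (hpair : Iso S [p, q]) (hs : s = X₀ ++ p :: q :: X₁)
    (hp : s.count p = 1) (hq : s.count q = 1) : Iso S (res [p, q] s) := by
  have h1 := hs ▸ hp
  have h2 : (X₀ ++ [p] ++ q :: X₁).count q = 1 := by rw [← hq, hs]; simp
  have h1 := not_mem_of_count_append_cons h1
  have h2 := not_mem_of_count_append_cons h2
  simp only [List.mem_append, List.mem_cons, not_or] at h1 h2
  have e1 : res [p, q] X₀ = [] := res_eq_nil (by simp [*])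
  have e2 : res [p, q] X₁ = [] := res_eq_nil (by simp [*])
  simpa [hs, res_append, res_cons_of_mem, e1, e2] using hpair

/-- The relative positions of the other occurrences of two letters that occur twice each and are
adjacent somewhere. -/
theorem adjacent_cases {s X₀ X₁ : List α} {p q : α} (hs : s = X₀ ++ p :: q :: X₁) (hpq : p ≠ q)
    (hp : s.count p = 2) (hq : s.count q = 2) :
    (p ∉ X₀ ∧ q ∉ X₀ ∧ ∃ Y₁ Y₂ Y₃, X₁ = Y₁ ++ p :: (Y₂ ++ q :: Y₃) ∧
      p ∉ Y₁ ∧ q ∉ Y₁ ∧ p ∉ Y₂ ∧ q ∉ Y₂ ∧ p ∉ Y₃ ∧ q ∉ Y₃) ∨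
    (p ∉ X₀ ∧ q ∉ X₀ ∧ ∃ Y₁ Y₂ Y₃, X₁ = Y₁ ++ q :: (Y₂ ++ p :: Y₃) ∧
      p ∉ Y₁ ∧ q ∉ Y₁ ∧ p ∉ Y₂ ∧ q ∉ Y₂ ∧ p ∉ Y₃ ∧ q ∉ Y₃) ∨
    (p ∉ X₁ ∧ q ∉ X₁ ∧ ∃ Y₁ Y₂ Y₃, X₀ = Y₁ ++ p :: (Y₂ ++ q :: Y₃) ∧
      p ∉ Y₁ ∧ q ∉ Y₁ ∧ p ∉ Y₂ ∧ q ∉ Y₂ ∧ p ∉ Y₃ ∧ q ∉ Y₃) ∨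
    (p ∉ X₁ ∧ q ∉ X₁ ∧ ∃ Y₁ Y₂ Y₃, X₀ = Y₁ ++ q :: (Y₂ ++ p :: Y₃) ∧
      p ∉ Y₁ ∧ q ∉ Y₁ ∧ p ∉ Y₂ ∧ q ∉ Y₂ ∧ p ∉ Y₃ ∧ q ∉ Y₃) ∨
    (∃ Y₁ Y₂ Y₃ Y₄, X₀ = Y₁ ++ p :: Y₂ ∧ X₁ = Y₃ ++ q :: Y₄ ∧
      p ∉ Y₁ ∧ q ∉ Y₁ ∧ p ∉ Y₂ ∧ q ∉ Y₂ ∧ p ∉ Y₃ ∧ q ∉ Y₃ ∧ p ∉ Y₄ ∧ q ∉ Y₄) ∨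
    (∃ Y₁ Y₂ Y₃ Y₄, X₀ = Y₁ ++ q :: Y₂ ∧ X₁ = Y₃ ++ p :: Y₄ ∧
      p ∉ Y₁ ∧ q ∉ Y₁ ∧ p ∉ Y₂ ∧ q ∉ Y₂ ∧ p ∉ Y₃ ∧ q ∉ Y₃ ∧ p ∉ Y₄ ∧ q ∉ Y₄) := by
  have key : ∀ {a b : α} {l : List α}, a ≠ b → l.count a = 1 → l.count b = 1 →
      (∃ Y₁ Y₂ Y₃, l = Y₁ ++ a :: (Y₂ ++ b :: Y₃) ∧
        a ∉ Y₁ ∧ b ∉ Y₁ ∧ a ∉ Y₂ ∧ b ∉ Y₂ ∧ a ∉ Y₃ ∧ b ∉ Y₃) ∨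
      (∃ Y₁ Y₂ Y₃, l = Y₁ ++ b :: (Y₂ ++ a :: Y₃) ∧
        a ∉ Y₁ ∧ b ∉ Y₁ ∧ a ∉ Y₂ ∧ b ∉ Y₂ ∧ a ∉ Y₃ ∧ b ∉ Y₃) := by
    intro a b l hab ha hb
    obtain ⟨Y, Z, rfl, haY, haZ⟩ := exists_split_of_count_eq_one ha
    by_cases hbY : b ∈ Y
    · have hbY' := List.count_pos_iff.2 hbY
      have h1 : Y.count b = 1 := by
        simp [hab] at hb; omega
      have h2 : b ∉ Z := fun h => by
        have := List.count_pos_iff.2 h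
        simp [hab] at hb; omega
      obtain ⟨Y₁, Y₂, rfl, h3, h4⟩ := exists_split_of_count_eq_one h1
      simp only [List.mem_append, List.mem_cons, not_or] at haY
      exact Or.inr ⟨Y₁, Y₂, Z, by simp, by tauto⟩
    · have h1 : Z.count b = 1 := by
        simp [hab, List.count_eq_zero_of_not_mem hbY] at hb; omega
      obtain ⟨Y₁, Y₂, rfl, h3, h4⟩ := exists_split_of_count_eq_one h1
      simp only [List.mem_append, List.mem_cons, not_or] at haZ
      exact Or.inl ⟨Y, Y₁, Y₂, rfl, by tauto⟩
  have hp' : X₀.count p + X₁.count p = 1 := by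
    simp [hs, hpq.symm] at hp; omega
  have hq' : X₀.count q + X₁.count q = 1 := by
    simp [hs, hpq] at hq; omega
  rcases Nat.eq_zero_or_pos (X₀.count p) with h0 | h0 <;>
    rcases Nat.eq_zero_or_pos (X₀.count q) with h1 | h1
  · have h2 := List.count_eq_zero.1 h0
    have h3 := List.count_eq_zero.1 h1
    rcases key hpq (by omega : X₁.count p = 1) (by omega) with h | h
    · exact Or.inl ⟨h2, h3, h⟩
    · exact Or.inr (Or.inl ⟨h2, h3, h⟩)
  · have h2 := List.count_eq_zero.1 h0
    have h3 := List.count_eq_zero.1 (by omega : X₁.count q = 0)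
    obtain ⟨Y₁, Y₂, rfl, h4, h5⟩ := exists_split_of_count_eq_one (by omega : X₀.count q = 1)
    obtain ⟨Y₃, Y₄, rfl, h6, h7⟩ := exists_split_of_count_eq_one (by omega : X₁.count p = 1)
    simp only [List.mem_append, List.mem_cons, not_or] at h2 h3
    exact Or.inr (Or.inr (Or.inr (Or.inr (Or.inr ⟨Y₁, Y₂, Y₃, Y₄, rfl, rfl, by tauto⟩))))
  · have h2 := List.count_eq_zero.1 h1
    have h3 := List.count_eq_zero.1 (by omega : X₁.count p = 0)
    obtain ⟨Y₁, Y₂, rfl, h4, h5⟩ := exists_split_of_count_eq_one (by omega : X₀.count p = 1)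
    obtain ⟨Y₃, Y₄, rfl, h6, h7⟩ := exists_split_of_count_eq_one (by omega : X₁.count q = 1)
    simp only [List.mem_append, List.mem_cons, not_or] at h2 h3
    exact Or.inr (Or.inr (Or.inr (Or.inr (Or.inl ⟨Y₁, Y₂, Y₃, Y₄, rfl, rfl, by tauto⟩))))
  · have h2 := List.count_eq_zero.1 (by omega : X₁.count p = 0)
    have h3 := List.count_eq_zero.1 (by omega : X₁.count q = 0)
    rcases key hpq (by omega : X₀.count p = 1) (by omega) with h | h
    · exact Or.inr (Or.inr (Or.inl ⟨h2, h3, h⟩))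
    · exact Or.inr (Or.inr (Or.inr (Or.inl ⟨h2, h3, h⟩)))

/-- If either occurrence is missing, the corresponding `Before` holds vacuously; otherwise two
distinct positions are compared. -/
theorem before_or {c d : α} (hcd : c ≠ d) (k l : ℕ) (v : List α) :
    Before c d k l v ∨ Before d c l k v := by
  by_contra! hcon
  simp only [Before, not_forall, not_lt] at hcon
  obtain ⟨⟨V₁, V₂, rfl, h1, h2⟩, W₁, W₂, h, h3, h4⟩ := hcon
  rcases List.append_eq_append_iff.1 h with ⟨Z, rfl, hZ⟩ | ⟨Z, rfl, hZ⟩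
  · cases Z with
    | nil => simp at hZ; exact hcd hZ.1.symm
    | cons z Z =>
      simp only [List.cons_append, List.cons.injEq] at hZ
      simp [← hZ.1] at h4
      omega
  · cases Z with
    | nil => simp at hZ; exact hcd hZ.1
    | cons z Z =>
      simp only [List.cons_append, List.cons.injEq] at hZ
      simp [← hZ.1] at h2
      omega

theorem count_eq_of_iso_res {S : Type v} [Monoid S] {s t P : List α} {x : α} (h : LSat S s t)
    (hx : x ∈ P) (hiso : Iso S (res P s)) : t.count x = s.count x := by
  rw [← count_res hx t, ← hiso _ (h.res P), count_res hx]

theorem count_eq_of_count_le_one {S : Type v} [Monoid S] {s t : List α} {x : α} (h : LSat S s t)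
    (hx : Iso S [x]) (hs : s.count x ≤ 1) : t.count x = s.count x := by
  interval_cases hc : s.count x
  · have h1 := h.res [x]
    rw [res_singleton, res_singleton, hc] at h1
    have h2 := hx _ ((LSat.refl [x]).append h1)
    simpa using h2.symm
  · rw [← hc]
    exact count_eq_of_iso_res h (P := [x]) (by simp) (by rw [res_singleton, hc]; exact hx)

/-- The working form of `eq_of_before`: counts and orders of adjacent letters are all tested on
restrictions to a few letters, where isoterms apply. -/
theorem Iso.eq_of_res {S : Type v} [Monoid S] {s t : List α} (h : LSat S s t)
    (h1 : ∀ x : α, Iso S [x])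
    (hcount : ∀ x, s.count x ≤ 1 ∨ ∃ P, x ∈ P ∧ Iso S (res P s))
    (hadj : ∀ X₀ p q X₁, s = X₀ ++ p :: q :: X₁ → p ≠ q →
      ∃ P, p ∈ P ∧ q ∈ P ∧ (Iso S (res P s) ∨
        Before p q (X₀.count p) (X₀.count q) (res P t))) : t = s := by
  refine eq_of_before (fun x => ?_) fun X₀ p q X₁ hs hpq => ?_
  · rcases hcount x with hx | ⟨P, hP, hiso⟩
    · exact count_eq_of_count_le_one h (h1 x) hx
    · exact count_eq_of_iso_res h hP hiso
  · obtain ⟨P, hp, hq, hiso | hB⟩ := hadj X₀ p q X₁ hs hpq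
    · exact before_of_res_eq hpq hp hq hs (hiso _ (h.res P))
    · exact hB.of_res hp hq

end Cover

/-! ### Rigidity when equal letters are far apart (rows 2 and 4) -/

section Separated

variable {α : Type u} [DecidableEq α] {S : Type v} [Monoid S]

/-- The isoterms that protect a word in which equal letters are far apart. -/
structure SeparatedIso (α : Type u) (S : Type v) [Monoid S] : Prop where
  one : ∀ a : α, Iso S [a]
  pair : ∀ a b : α, a ≠ b → Iso S [a, b]
  sep : ∀ a t : α, a ≠ t → Iso S [a, t, a]
  right : ∀ a b t : α, [a, b, t].Nodup → Iso S [a, t, a, b]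
  left : ∀ a b t : α, [a, b, t].Nodup → Iso S [b, a, t, a]
  same : ∀ a b t : α, [a, b, t].Nodup → Iso S [a, b, t, a, b]
  rev : ∀ a b t : α, [a, b, t].Nodup → Iso S [a, b, t, b, a]
  middle : ∀ a b t t' : α, [a, b, t, t'].Nodup → Iso S [a, t, a, b, t', b]
  middle' : ∀ a b t t' : α, [a, b, t, t'].Nodup → Iso S [a, t, b, a, t', b]

/-- Between two occurrences of the same letter of `s` there is always a linear letter. Two adjacent
letters, with the linear letters found in the gaps, therefore restrict to one of the listed
isoterms. -/
theorem SeparatedIso.eq (hS : SeparatedIso α S) {U s t : List α} {f : α → List α} {K : ℕ}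
    (h : Cover U s f K)
    (hfar : ∀ X₀ X₁ X₂ c, U = X₀ ++ c :: (X₁ ++ c :: X₂) → 2 * K + 2 ≤ X₁.length)
    (hst : LSat S s t) : t = s := by
  have hgap : ∀ X Y Z p, s.count p = 2 → s = X ++ p :: (Y ++ p :: Z) →
      2 * K + 2 ≤ (Y.flatMap f).length := by
    intro X Y Z p hp hs
    obtain ⟨c, hc⟩ := h.exists_eq_singleton hp
    exact hfar (X.flatMap f) _ (Z.flatMap f) c (by rw [← h.eq, hs]; simp [hc])
  -- A letter occurring twice against a linear letter `q`. A linear `t` lies between the two `p`;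
  -- the restriction is `pqp` if `q` is between them, and otherwise `qptp` or `ptpq`.
  have hmix : ∀ p q, p ≠ q → q ∈ s → s.count p = 2 → s.count q = 1 →
      ∃ P, p ∈ P ∧ q ∈ P ∧ Iso S (res P s) := by
    intro p q hpq _ hp hq
    obtain ⟨X, Y, Z, hs, hX, hY, hZ⟩ := exists_split_of_count_eq_two hp
    obtain ⟨t, ht, ht1⟩ := h.exists_linear (Y₀ := X ++ [p]) (Y₁ := Y) (Y₂ := p :: Z) (by simp [hs])
      (by have := hgap X Y Z p hp hs; omega)
    have hpt : p ≠ t := fun h => hY (h ▸ ht)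
    obtain ⟨Y₁, Y₂, rfl⟩ := List.append_of_mem ht
    have htn := ht1
    rw [hs, show X ++ p :: ((Y₁ ++ t :: Y₂) ++ p :: Z) =
      (X ++ p :: Y₁) ++ t :: (Y₂ ++ p :: Z) by simp] at htn
    have htn := not_mem_of_count_append_cons htn
    simp only [List.mem_append, List.mem_cons, not_or] at htn hY
    by_cases hqt : q = t
    · subst hqt
      refine ⟨[p, q], by simp, by simp, ?_⟩
      have e1 : res [p, q] X = [] := res_eq_nil (by simp [*])
      have e2 : res [p, q] Y₁ = [] := res_eq_nil (by simp [*])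
      have e3 : res [p, q] Y₂ = [] := res_eq_nil (by simp [*])
      have e4 : res [p, q] Z = [] := res_eq_nil (by simp [*])
      simpa [hs, res_append, res_cons_of_mem, e1, e2, e3, e4] using hS.sep p q hpq
    · have hq' : q ∈ s := by assumption
      have key : ∀ A B, s = A ++ q :: B → q ∉ A ∧ q ∉ B := fun A B e =>
        not_mem_of_count_append_cons (by rw [← e]; exact hq)
      rw [hs] at hq'
      simp only [List.mem_append, List.mem_cons, hpq.symm, hqt, false_or] at hq'
      rcases hq' with hq' | (hq' | hq') | hq'
      · obtain ⟨A, B, rfl⟩ := List.append_of_mem hq'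
        have hn := key A (B ++ p :: ((Y₁ ++ t :: Y₂) ++ p :: Z)) (by simp [hs])
        simp only [List.mem_append, List.mem_cons, not_or] at hn htn hX
        refine ⟨[p, q, t], by simp, by simp, ?_⟩
        have e1 : res [p, q, t] A = [] := res_eq_nil (by simp [*])
        have e2 : res [p, q, t] B = [] := res_eq_nil (by simp [*])
        have e3 : res [p, q, t] Y₁ = [] := res_eq_nil (by simp [*])
        have e4 : res [p, q, t] Y₂ = [] := res_eq_nil (by simp [*])
        have e5 : res [p, q, t] Z = [] := res_eq_nil (by simp [*])
        simpa [hs, res_append, res_cons_of_mem, e1, e2, e3, e4, e5] using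
          hS.left p q t (by simp [*])
      · obtain ⟨A, B, rfl⟩ := List.append_of_mem hq'
        have hn := key (X ++ p :: A) (B ++ t :: (Y₂ ++ p :: Z)) (by simp [hs])
        simp only [List.mem_append, List.mem_cons, not_or] at hn htn hY
        refine ⟨[p, q], by simp, by simp, ?_⟩
        have e1 : res [p, q] X = [] := res_eq_nil (by simp [*])
        have e2 : res [p, q] A = [] := res_eq_nil (by simp [*])
        have e3 : res [p, q] B = [] := res_eq_nil (by simp [*])
        have e4 : res [p, q] Y₂ = [] := res_eq_nil (by simp [*])
        have e5 : res [p, q] Z = [] := res_eq_nil (by simp [*])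
        have e6 : t ∉ [p, q] := by simp [Ne.symm hpt, Ne.symm hqt]
        simpa [hs, res_append, res_cons_of_mem, res_cons_of_not_mem e6, e1, e2, e3, e4, e5] using
          hS.sep p q hpq
      · obtain ⟨A, B, rfl⟩ := List.append_of_mem hq'
        have hn := key (X ++ p :: (Y₁ ++ t :: A)) (B ++ p :: Z) (by simp [hs])
        simp only [List.mem_append, List.mem_cons, not_or] at hn htn hY
        refine ⟨[p, q], by simp, by simp, ?_⟩
        have e1 : res [p, q] X = [] := res_eq_nil (by simp [*])
        have e2 : res [p, q] A = [] := res_eq_nil (by simp [*])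
        have e3 : res [p, q] B = [] := res_eq_nil (by simp [*])
        have e4 : res [p, q] Y₁ = [] := res_eq_nil (by simp [*])
        have e5 : res [p, q] Z = [] := res_eq_nil (by simp [*])
        have e6 : t ∉ [p, q] := by simp [Ne.symm hpt, Ne.symm hqt]
        simpa [hs, res_append, res_cons_of_mem, res_cons_of_not_mem e6, e1, e2, e3, e4, e5] using
          hS.sep p q hpq
      · obtain ⟨A, B, rfl⟩ := List.append_of_mem hq'
        have hn := key (X ++ p :: ((Y₁ ++ t :: Y₂) ++ p :: A)) B (by simp [hs])
        simp only [List.mem_append, List.mem_cons, not_or] at hn htn hZ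
        refine ⟨[p, q, t], by simp, by simp, ?_⟩
        have e1 : res [p, q, t] A = [] := res_eq_nil (by simp [*])
        have e2 : res [p, q, t] B = [] := res_eq_nil (by simp [*])
        have e3 : res [p, q, t] Y₁ = [] := res_eq_nil (by simp [*])
        have e4 : res [p, q, t] Y₂ = [] := res_eq_nil (by simp [*])
        have e5 : res [p, q, t] X = [] := res_eq_nil (by simp [*])
        simpa [hs, res_append, res_cons_of_mem, e1, e2, e3, e4, e5] using
          hS.right p q t (by simp [*])
  refine Iso.eq_of_res hst hS.one (fun x => ?_) fun X₀ p q X₁ hs hpq => ?_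
  · by_cases hx : s.count x ≤ 1
    · exact Or.inl hx
    have hx2 : s.count x = 2 := by have := h.count_le_two x; omega
    obtain ⟨X, Y, Z, hs, -⟩ := exists_split_of_count_eq_two hx2
    obtain ⟨t, ht, ht1⟩ := h.exists_linear (Y₀ := X ++ [x]) (Y₁ := Y) (Y₂ := x :: Z) (by simp [hs])
      (by have := hgap X Y Z x hx2 hs; omega)
    obtain ⟨P, hP, -, hiso⟩ := hmix x t (by rintro rfl; omega) (by simp [hs, ht]) hx2 ht1
    exact Or.inr ⟨P, hP, hiso⟩
  have hps : p ∈ s := by simp [hs]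
  have hqs : q ∈ s := by simp [hs]
  suffices ∃ P, p ∈ P ∧ q ∈ P ∧ Iso S (res P s) by
    obtain ⟨P, h1, h2, h3⟩ := this
    exact ⟨P, h1, h2, Or.inl h3⟩
  rcases h.count_cases hps with hp | hp <;> rcases h.count_cases hqs with hq | hq
  · exact ⟨[p, q], by simp, by simp, iso_res_of_linear (hS.pair p q hpq) hs hp hq⟩
  · obtain ⟨P, h1, h2, h3⟩ := hmix q p hpq.symm hps hq hp
    exact ⟨P, h2, h1, h3⟩
  · exact hmix p q hpq hqs hp hq
  · have hlin := h.exists_linear_split (p := p) (q := q)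
    have hfp : (f p).length = 1 := by
      obtain ⟨c, hc⟩ := h.exists_eq_singleton hp
      simp [hc]
    have hfq : (f q).length = 1 := by
      obtain ⟨c, hc⟩ := h.exists_eq_singleton hq
      simp [hc]
    rcases adjacent_cases hs hpq hp hq with ⟨hp0, hq0, Y₁, Y₂, Y₃, rfl, hY⟩ |
      ⟨hp0, hq0, Y₁, Y₂, Y₃, rfl, hY⟩ | ⟨hp0, hq0, Y₁, Y₂, Y₃, rfl, hY⟩ |
      ⟨hp0, hq0, Y₁, Y₂, Y₃, rfl, hY⟩ | ⟨Y₁, Y₂, Y₃, Y₄, rfl, rfl, hY⟩ |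
      ⟨Y₁, Y₂, Y₃, Y₄, rfl, rfl, hY⟩
    -- The gap between the two `p` has length at least 2K + 2. Discarding the single letter `f q`
    -- still leaves more than 2K, which is what forces a linear letter.
    · have := hgap X₀ (q :: Y₁) (Y₂ ++ q :: Y₃) p hp (by simp [hs])
      obtain ⟨t, A, B, rfl, ht⟩ := hlin (X₀ ++ [p, q]) Y₁ (p :: (Y₂ ++ q :: Y₃)) (by simp [hs])
        (by simp at this; simp; omega) hY.1 hY.2.1
      refine ⟨[p, q, t], by simp, by simp, ?_⟩
      simp only [List.mem_append, List.mem_cons, not_or] at ht hY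
      have e1 : res [p, q, t] A = [] := res_eq_nil (by simp [*])
      have e2 : res [p, q, t] B = [] := res_eq_nil (by simp [*])
      have e3 : res [p, q, t] X₀ = [] := res_eq_nil (by simp [*])
      have e4 : res [p, q, t] Y₂ = [] := res_eq_nil (by simp [*])
      have e5 : res [p, q, t] Y₃ = [] := res_eq_nil (by simp [*])
      simpa [hs, res_append, res_cons_of_mem, e1, e2, e3, e4, e5] using
        hS.same p q t (by simp [*, Ne.symm])
    · have := hgap (X₀ ++ [p]) Y₁ (Y₂ ++ p :: Y₃) q hq (by simp [hs])
      obtain ⟨t, A, B, rfl, ht⟩ := hlin (X₀ ++ [p, q]) Y₁ (q :: (Y₂ ++ p :: Y₃)) (by simp [hs])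
        (by omega) hY.1 hY.2.1
      refine ⟨[p, q, t], by simp, by simp, ?_⟩
      simp only [List.mem_append, List.mem_cons, not_or] at ht hY
      have e1 : res [p, q, t] A = [] := res_eq_nil (by simp [*])
      have e2 : res [p, q, t] B = [] := res_eq_nil (by simp [*])
      have e3 : res [p, q, t] X₀ = [] := res_eq_nil (by simp [*])
      have e4 : res [p, q, t] Y₂ = [] := res_eq_nil (by simp [*])
      have e5 : res [p, q, t] Y₃ = [] := res_eq_nil (by simp [*])
      simpa [hs, res_append, res_cons_of_mem, e1, e2, e3, e4, e5] using
        hS.rev p q t (by simp [*, Ne.symm])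
    · have := hgap (Y₁ ++ p :: Y₂) (Y₃ ++ [p]) X₁ q hq (by simp [hs])
      obtain ⟨t, A, B, rfl, ht⟩ := hlin (Y₁ ++ p :: (Y₂ ++ [q])) Y₃ (p :: q :: X₁) (by simp [hs])
        (by simp at this ⊢; omega) (by tauto) (by tauto)
      refine ⟨[p, q, t], by simp, by simp, ?_⟩
      simp only [List.mem_append, List.mem_cons, not_or] at ht hY
      have e1 : res [p, q, t] A = [] := res_eq_nil (by simp [*])
      have e2 : res [p, q, t] B = [] := res_eq_nil (by simp [*])
      have e3 : res [p, q, t] X₁ = [] := res_eq_nil (by simp [*])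
      have e4 : res [p, q, t] Y₂ = [] := res_eq_nil (by simp [*])
      have e5 : res [p, q, t] Y₁ = [] := res_eq_nil (by simp [*])
      simpa [hs, res_append, res_cons_of_mem, e1, e2, e3, e4, e5] using
        hS.same p q t (by simp [*, Ne.symm])
    · have := hgap (Y₁ ++ q :: Y₂) Y₃ (q :: X₁) p hp (by simp [hs])
      obtain ⟨t, A, B, rfl, ht⟩ := hlin (Y₁ ++ q :: (Y₂ ++ [p])) Y₃ (p :: q :: X₁) (by simp [hs])
        (by omega) (by tauto) (by tauto)
      refine ⟨[p, q, t], by simp, by simp, ?_⟩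
      simp only [List.mem_append, List.mem_cons, not_or] at ht hY
      have e1 : res [p, q, t] A = [] := res_eq_nil (by simp [*])
      have e2 : res [p, q, t] B = [] := res_eq_nil (by simp [*])
      have e3 : res [p, q, t] X₁ = [] := res_eq_nil (by simp [*])
      have e4 : res [p, q, t] Y₂ = [] := res_eq_nil (by simp [*])
      have e5 : res [p, q, t] Y₁ = [] := res_eq_nil (by simp [*])
      simpa [hs, res_append, res_cons_of_mem, e1, e2, e3, e4, e5] using
        hS.rev q p t (by simp [*, Ne.symm])
    · have h1 := hgap Y₁ Y₂ (q :: (Y₃ ++ q :: Y₄)) p hp (by simp [hs])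
      have h2 := hgap (Y₁ ++ p :: (Y₂ ++ [p])) Y₃ Y₄ q hq (by simp [hs])
      obtain ⟨t, A, B, rfl, ht⟩ := hlin (Y₁ ++ [p]) Y₂ (p :: q :: (Y₃ ++ q :: Y₄)) (by simp [hs])
        (by omega) (by tauto) (by tauto)
      obtain ⟨t', A', B', rfl, ht'⟩ := hlin (Y₁ ++ p :: ((A ++ t :: B) ++ [p, q])) Y₃ (q :: Y₄)
        (by simp [hs]) (by omega) (by tauto) (by tauto)
      refine ⟨[p, q, t, t'], by simp, by simp, ?_⟩
      simp only [List.mem_append, List.mem_cons, not_or] at ht hY ht'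
      have e1 : res [p, q, t, t'] A = [] := res_eq_nil (by simp [*])
      have e2 : res [p, q, t, t'] B = [] := res_eq_nil (by simp [*])
      have e3 : res [p, q, t, t'] A' = [] := res_eq_nil (by simp [*])
      have e4 : res [p, q, t, t'] B' = [] := res_eq_nil (by simp [*])
      have e5 : res [p, q, t, t'] Y₁ = [] := res_eq_nil (by simp [*])
      have e6 : res [p, q, t, t'] Y₄ = [] := res_eq_nil (by simp [*])
      simpa [hs, res_append, res_cons_of_mem, e1, e2, e3, e4, e5, e6] using
        hS.middle p q t t' (by simp [*, Ne.symm])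
    · have h1 := hgap Y₁ (Y₂ ++ [p]) (Y₃ ++ p :: Y₄) q hq (by simp [hs])
      have h2 := hgap (Y₁ ++ q :: Y₂) (q :: Y₃) Y₄ p hp (by simp [hs])
      obtain ⟨t, A, B, rfl, ht⟩ := hlin (Y₁ ++ [q]) Y₂ (p :: q :: (Y₃ ++ p :: Y₄)) (by simp [hs])
        (by simp at h1 ⊢; omega) (by tauto) (by tauto)
      obtain ⟨t', A', B', rfl, ht'⟩ := hlin (Y₁ ++ q :: ((A ++ t :: B) ++ [p, q])) Y₃ (p :: Y₄)
        (by simp [hs]) (by simp at h2 ⊢; omega) (by tauto) (by tauto)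
      refine ⟨[p, q, t, t'], by simp, by simp, ?_⟩
      simp only [List.mem_append, List.mem_cons, not_or] at ht hY ht'
      have e1 : res [p, q, t, t'] A = [] := res_eq_nil (by simp [*])
      have e2 : res [p, q, t, t'] B = [] := res_eq_nil (by simp [*])
      have e3 : res [p, q, t, t'] A' = [] := res_eq_nil (by simp [*])
      have e4 : res [p, q, t, t'] B' = [] := res_eq_nil (by simp [*])
      have e5 : res [p, q, t, t'] Y₁ = [] := res_eq_nil (by simp [*])
      have e6 : res [p, q, t, t'] Y₄ = [] := res_eq_nil (by simp [*])
      simpa [hs, res_append, res_cons_of_mem, e1, e2, e3, e4, e5, e6] using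
        hS.middle' q p t t' (by simp [*, Ne.symm])

end Separated

/-! ### Words with squares: the basic isoterms -/

section Square

variable {α : Type u} [DecidableEq α] {S : Type v} [Monoid S]

/-- Words with one letter occurring twice and all other letters linear are isoterms. -/
structure SquareIso (α : Type u) (S : Type v) [Monoid S] : Prop where
  one : ∀ a : α, Iso S [a]
  pair : ∀ a b : α, a ≠ b → Iso S [a, b]
  two : ∀ a : α, Iso S [a, a]
  right : ∀ a b : α, a ≠ b → Iso S [a, a, b]
  left : ∀ a b : α, a ≠ b → Iso S [b, a, a]
  mid : ∀ a b : α, a ≠ b → Iso S [a, b, a]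

theorem SquareIso.mix (hS : SquareIso α S) {s : List α} {p q : α} (hpq : p ≠ q)
    (hp : s.count p = 2) (hq : s.count q = 1) : Iso S (res [p, q] s) := by
  obtain ⟨X, Y, Z, rfl, hX, hY, hZ⟩ := exists_split_of_count_eq_two hp
  have hq' : q ∈ X ++ p :: (Y ++ p :: Z) := List.count_pos_iff.1 (by omega)
  have key : ∀ A B, X ++ p :: (Y ++ p :: Z) = A ++ q :: B → q ∉ A ∧ q ∉ B := fun A B e =>
    not_mem_of_count_append_cons (by rw [← e]; exact hq)
  simp only [List.mem_append, List.mem_cons, hpq.symm, false_or] at hq'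
  rcases hq' with hq' | hq' | hq'
  · obtain ⟨A, B, rfl⟩ := List.append_of_mem hq'
    have hn := key A (B ++ p :: (Y ++ p :: Z)) (by simp)
    simp only [List.mem_append, List.mem_cons, not_or] at hn hX
    have e1 : res [p, q] A = [] := res_eq_nil (by simp [*])
    have e2 : res [p, q] B = [] := res_eq_nil (by simp [*])
    have e3 : res [p, q] Y = [] := res_eq_nil (by simp [*])
    have e4 : res [p, q] Z = [] := res_eq_nil (by simp [*])
    simpa [res_append, res_cons_of_mem, e1, e2, e3, e4] using hS.left p q hpq
  · obtain ⟨A, B, rfl⟩ := List.append_of_mem hq'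
    have hn := key (X ++ p :: A) (B ++ p :: Z) (by simp)
    simp only [List.mem_append, List.mem_cons, not_or] at hn hY
    have e1 : res [p, q] A = [] := res_eq_nil (by simp [*])
    have e2 : res [p, q] B = [] := res_eq_nil (by simp [*])
    have e3 : res [p, q] X = [] := res_eq_nil (by simp [*])
    have e4 : res [p, q] Z = [] := res_eq_nil (by simp [*])
    simpa [res_append, res_cons_of_mem, e1, e2, e3, e4] using hS.mid p q hpq
  · obtain ⟨A, B, rfl⟩ := List.append_of_mem hq'
    have hn := key (X ++ p :: (Y ++ p :: A)) B (by simp)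
    simp only [List.mem_append, List.mem_cons, not_or] at hn hZ
    have e1 : res [p, q] A = [] := res_eq_nil (by simp [*])
    have e2 : res [p, q] B = [] := res_eq_nil (by simp [*])
    have e3 : res [p, q] X = [] := res_eq_nil (by simp [*])
    have e4 : res [p, q] Y = [] := res_eq_nil (by simp [*])
    simpa [res_append, res_cons_of_mem, e1, e2, e3, e4] using hS.right p q hpq

/-- Adjacent pairs involving a linear letter are already protected by `SquareIso`, so only pairs of
letters occurring twice need an argument. -/
theorem SquareIso.eq_of_nonlinear (hS : SquareIso α S) {s t : List α} (hst : LSat S s t)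
    (hs2 : ∀ x, s.count x ≤ 2)
    (hnn : ∀ X₀ p q X₁, s = X₀ ++ p :: q :: X₁ → p ≠ q → s.count p = 2 → s.count q = 2 →
      ∃ P, p ∈ P ∧ q ∈ P ∧ (Iso S (res P s) ∨
        Before p q (X₀.count p) (X₀.count q) (res P t))) : t = s := by
  refine Iso.eq_of_res hst hS.one (fun x => ?_) fun X₀ p q X₁ hs hpq => ?_
  · by_cases hx : s.count x ≤ 1
    · exact Or.inl hx
    · refine Or.inr ⟨[x], by simp, ?_⟩
      rw [res_singleton, show s.count x = 2 by have := hs2 x; omega]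
      exact hS.two x
  · have hps : 0 < s.count p := by simp [hs]
    have hqs : 0 < s.count q := List.count_pos_iff.2 (by simp [hs])
    have hp2 := hs2 p
    have hq2 := hs2 q
    by_cases hp : s.count p = 2 <;> by_cases hq : s.count q = 2
    · exact hnn X₀ p q X₁ hs hpq hp hq
    · exact ⟨[p, q], by simp, by simp, Or.inl (hS.mix hpq hp (by omega))⟩
    · exact ⟨[q, p], by simp, by simp, Or.inl (hS.mix hpq.symm hq (by omega))⟩
    · exact ⟨[p, q], by simp, by simp, Or.inl (iso_res_of_linear (hS.pair p q hpq) hs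
        (by omega) (by omega))⟩

theorem SquareIso.three (hS : SquareIso α S) {s : List α} (hs2 : ∀ x, s.count x ≤ 2)
    (huniq : ∀ p q, s.count p = 2 → s.count q = 2 → p = q) : Iso S s := fun _ hst =>
  (hS.eq_of_nonlinear hst hs2 fun _ p q _ _ hpq hp hq => absurd (huniq p q hp hq) hpq).symm

/-- An identity of the word `xtxyt'y` or of the word `xtyxt'y` can only swap the middle letters. -/
theorem middle_cases {x y t t' : α} {w v : List α} (hd : [x, y, t, t'].Nodup)
    (h1 : Iso S [x, t, x, t']) (h2 : Iso S [t, y, t', y]) (h : ∀ a : α, Iso S [a])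
    (hw : w = [x, t, x, y, t', y] ∨ w = [x, t, y, x, t', y]) (hwv : LSat S w v) :
    v = [x, t, x, y, t', y] ∨ v = [x, t, y, x, t', y] := by
  simp only [List.nodup_cons, List.mem_cons, List.not_mem_nil, or_false, not_or,
    List.nodup_nil, and_true, not_false_iff] at hd
  obtain ⟨⟨hxy, hxt, hxt'⟩, ⟨hyt, hyt'⟩, -⟩ := hd
  have hyx := Ne.symm hxy
  have htx := Ne.symm hxt
  have htx' := Ne.symm hxt'
  have hty := Ne.symm hyt
  have r1 : res [x, t, t'] w = [x, t, x, t'] := by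
    rcases hw with rfl | rfl <;> simp [res, htx, htx', hyx, hyt, hyt']
  have r2 : res [y, t, t'] w = [t, y, t', y] := by
    rcases hw with rfl | rfl <;> simp [res, hxt, hxt', hxy, hyt, hyt']
  have v1 : res [x, t, t'] v = [x, t, x, t'] :=
    (h1 _ (r1 ▸ hwv.res [x, t, t'])).symm
  have v2 : res [y, t, t'] v = [t, y, t', y] :=
    (h2 _ (r2 ▸ hwv.res [y, t, t'])).symm
  have hcount : ∀ a, v.count a = w.count a := fun a => by
    by_cases h1 : a ∈ [x, t, t']
    · rw [← count_res h1 v, ← count_res h1 w, v1, r1]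
    by_cases h2 : a ∈ [y, t, t']
    · rw [← count_res h2 v, ← count_res h2 w, v2, r2]
    refine count_eq_of_count_le_one hwv (h a) ?_
    rw [List.count_eq_zero_of_not_mem]
    · exact zero_le_one
    · simp only [List.mem_cons, List.not_mem_nil, or_false, not_or] at h1 h2
      rcases hw with rfl | rfl <;> simp [h1, h2]
  have hcount' : ∀ a, v.count a = [x, t, x, y, t', y].count a ∧
      v.count a = [x, t, y, x, t', y].count a := fun a => by
    rw [hcount]
    have := (((List.Perm.swap y x [t', y]).cons t).cons x).count_eq a
    rcases hw with rfl | rfl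
    · exact ⟨rfl, this⟩
    · exact ⟨this.symm, rfl⟩
  have e1 : res [x, t, t'] [x, t, x, y, t', y] = [x, t, x, t'] := by
    simp [res, htx, htx', hyx, hyt, hyt']
  have e2 : res [y, t, t'] [x, t, x, y, t', y] = [t, y, t', y] := by
    simp [res, hxt, hxt', hxy, hyt, hyt']
  have e3 : res [x, t, t'] [x, t, y, x, t', y] = [x, t, x, t'] := by
    simp [res, htx, htx', hyx, hyt, hyt']
  have e4 : res [y, t, t'] [x, t, y, x, t', y] = [t, y, t', y] := by
    simp [res, hxt, hxt', hxy, hyt, hyt']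
  -- The restrictions to `x, t, t'` and to `y, t, t'` are fixed. What remains open is the order of
  -- the second `x` and the first `y`, and each order determines `v`.
  rcases before_or hxy 1 0 v with hB | hB
  · refine Or.inl (eq_of_before (fun a => (hcount' a).1) fun X₀ p q X₁ hs hpq => ?_)
    have A := before_of_res_eq (P := [x, t, t']) hpq (hs := hs) (t := v)
    have B := before_of_res_eq (P := [y, t, t']) hpq (hs := hs) (t := v)
    rw [e1, v1] at A
    rw [e2, v2] at B
    rcases X₀ with _ | ⟨a, _ | ⟨b, _ | ⟨c, _ | ⟨d, _ | ⟨e, _ | ⟨g, X₀⟩⟩⟩⟩⟩⟩ <;>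
      simp only [List.nil_append, List.cons_append, List.cons.injEq,
        reduceCtorEq, and_false] at hs
    · exact A (by simp [← hs]) (by simp [← hs]) rfl
    · exact A (by simp [← hs]) (by simp [← hs]) rfl
    · obtain ⟨rfl, rfl, rfl, rfl, -⟩ := hs
      simpa [List.count_cons, htx, hty, hxy] using hB
    · exact B (by simp [← hs]) (by simp [← hs]) rfl
    · exact B (by simp [← hs]) (by simp [← hs]) rfl
    all_goals simp at hs
  · refine Or.inr (eq_of_before (fun a => (hcount' a).2) fun X₀ p q X₁ hs hpq => ?_)
    have A := before_of_res_eq (P := [x, t, t']) hpq (hs := hs) (t := v)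
    have B := before_of_res_eq (P := [y, t, t']) hpq (hs := hs) (t := v)
    rw [e3, v1] at A
    rw [e4, v2] at B
    rcases X₀ with _ | ⟨a, _ | ⟨b, _ | ⟨c, _ | ⟨d, _ | ⟨e, _ | ⟨g, X₀⟩⟩⟩⟩⟩⟩ <;>
      simp only [List.nil_append, List.cons_append, List.cons.injEq,
        reduceCtorEq, and_false] at hs
    · exact A (by simp [← hs]) (by simp [← hs]) rfl
    · exact B (by simp [← hs]) (by simp [← hs]) rfl
    · obtain ⟨rfl, rfl, rfl, rfl, -⟩ := hs
      simpa [List.count_cons, htx, hty, hxy] using hB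
    · exact A (by simp [← hs]) (by simp [← hs]) rfl
    · exact B (by simp [← hs]) (by simp [← hs]) rfl
    all_goals simp at hs

/-- The only candidate for a nontrivial identity is the swap of the middle letters, and its other
side is an isoterm. -/
theorem Iso.middle_swap {x y t t' : α} (hd : [x, y, t, t'].Nodup)
    (h1 : Iso S [x, t, x, t']) (h2 : Iso S [t, y, t', y]) (h : ∀ a : α, Iso S [a])
    (hiso : Iso S [x, t, x, y, t', y]) : Iso S [x, t, y, x, t', y] := fun v hv => by
  rcases middle_cases hd h1 h2 h (Or.inr rfl) hv with rfl | rfl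
  · exact (hiso _ hv.symm).symm
  · rfl

theorem middle_sat_of_not_iso {x y t t' : α} (hd : [x, y, t, t'].Nodup)
    (h1 : Iso S [x, t, x, t']) (h2 : Iso S [t, y, t', y]) (h : ∀ a : α, Iso S [a])
    (hiso : ¬ Iso S [x, t, x, y, t', y]) : LSat S [x, t, x, y, t', y] [x, t, y, x, t', y] := by
  simp only [Iso, not_forall] at hiso
  obtain ⟨v, hv, hne⟩ := hiso
  rcases middle_cases hd h1 h2 h (Or.inl rfl) hv with rfl | rfl
  · exact absurd rfl hne
  · exact hv

end Square

/-! ### Rigidity from `yxxty`, `ytxxy` (row 1) and from `xyyx` (row 3) -/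

section Square

variable {α : Type u} [DecidableEq α] {S : Type v} [Monoid S]

theorem iso_of_square (hS : SquareIso α S) {a b t : α} (hd : [a, b, t].Nodup) :
    Iso S [a, t, a, b] ∧ Iso S [b, a, t, a] := by
  simp only [List.nodup_cons, List.mem_cons, List.not_mem_nil, or_false, not_or,
    List.nodup_nil, and_true, not_false_iff] at hd
  constructor <;>
  · refine hS.three (fun x => ?_) fun p q hp hq => ?_
    · simp only [List.count_cons, List.count_nil, beq_iff_eq]
      split_ifs <;> first | omega | (exfalso; grind)
    · simp only [List.count_cons, List.count_nil, beq_iff_eq] at hp hq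
      split_ifs at hp hq <;> first | omega | grind

/-- If `yxxty` is an isoterm, then in every identity of `xyxty` the first `x` stays before the
first `y`. -/
theorem before_first (hS : SquareIso α S) {p q t : α} (hd : [p, q, t].Nodup)
    (hiso : Iso S [q, p, p, t, q]) {r : List α} (hr : LSat S [p, q, p, t, q] r) :
    Before p q 0 0 r := by
  simp only [List.nodup_cons, List.mem_cons, List.not_mem_nil, or_false, not_or,
    List.nodup_nil, and_true, not_false_iff] at hd
  obtain ⟨⟨hpq, hpt⟩, hqt⟩ := hd
  have hqp := Ne.symm hpq
  have htp := Ne.symm hpt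
  have htq := Ne.symm hqt
  have v1 : [p, p, t] = res [p, t] r := hS.right p t hpt _ (by
    have := hr.res [p, t]
    rwa [show res [p, t] [p, q, p, t, q] = [p, p, t] by simp [res, hqp, hqt]] at this)
  have v2 : [q, t, q] = res [q, t] r := hS.mid q t hqt _ (by
    have := hr.res [q, t]
    rwa [show res [q, t] [p, q, p, t, q] = [q, t, q] by simp [res, hpq, hpt]] at this)
  -- If the first `q` came first, the fixed restrictions to `p, t` and `q, t` would leave only the
  -- isoterm `qpptq` for `r`.
  refine (before_or hpq 0 0 r).resolve_right fun hB => ?_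
  have hperm : [p, q, p, t, q].Perm [q, p, p, t, q] := List.Perm.swap _ _ _
  have : r = [q, p, p, t, q] := by
    refine eq_of_before (fun a => ?_) fun X₀ a b X₁ hs hab => ?_
    · by_cases h1 : a ∈ [p, t]
      · rw [← count_res h1, ← v1]
        rcases (by simpa using h1 : a = p ∨ a = t) with rfl | rfl <;>
          simp [hqp, hpt, htp, htq, hqt]
      by_cases h2 : a ∈ [q, t]
      · rw [← count_res h2, ← v2]
        rcases (by simpa using h2 : a = q ∨ a = t) with rfl | rfl <;>
          simp [hpq, hpt, htp, htq, hqt]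
      rw [← hperm.count_eq]
      refine count_eq_of_count_le_one hr (hS.one a) ?_
      rw [List.count_eq_zero_of_not_mem]
      · exact zero_le_one
      · simp at h1 h2
        simp [h1, h2]
    · have A := before_of_res_eq (P := [p, t]) hab (hs := hs) (t := r)
      have B := before_of_res_eq (P := [q, t]) hab (hs := hs) (t := r)
      rw [← v1] at A
      rw [← v2] at B
      rcases X₀ with _ | ⟨_, _ | ⟨_, _ | ⟨_, _ | ⟨_, _ | ⟨_, X₀⟩⟩⟩⟩⟩ <;>
        simp only [List.nil_append, List.cons_append, List.cons.injEq,
          reduceCtorEq, and_false] at hs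
      · obtain ⟨rfl, rfl, -⟩ := hs
        simpa using hB
      · exact absurd (hs.2.1.symm.trans hs.2.2.1) hab
      · exact A (by simp [← hs]) (by simp [← hs]) (by simp [res, hqp, hqt])
      · exact B (by simp [← hs]) (by simp [← hs]) (by simp [res, hpq, hpt])
      all_goals simp at hs
  subst this
  have := hiso _ hr.symm
  simp at this
  exact hqp this.1

/-- Mirror image of `before_first`: were the second `q` before the second `p`, the word would have
to be the isoterm `ptqqp`. -/
theorem before_second (hS : SquareIso α S) {p q t : α} (hd : [p, q, t].Nodup)
    (hiso : Iso S [p, t, q, q, p]) {r : List α} (hr : LSat S [p, t, q, p, q] r) :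
    Before p q 1 1 r := by
  simp only [List.nodup_cons, List.mem_cons, List.not_mem_nil, or_false, not_or,
    List.nodup_nil, and_true, not_false_iff] at hd
  obtain ⟨⟨hpq, hpt⟩, hqt⟩ := hd
  have hqp := Ne.symm hpq
  have htp := Ne.symm hpt
  have htq := Ne.symm hqt
  have v1 : [p, t, p] = res [p, t] r := hS.mid p t hpt _ (by
    have := hr.res [p, t]
    rwa [show res [p, t] [p, t, q, p, q] = [p, t, p] by simp [res, hqp, hqt]] at this)
  have v2 : [t, q, q] = res [q, t] r := hS.left q t hqt _ (by
    have := hr.res [q, t]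
    rwa [show res [q, t] [p, t, q, p, q] = [t, q, q] by simp [res, hpq, hpt]] at this)
  refine (before_or hpq 1 1 r).resolve_right fun hB => ?_
  have hperm : [p, t, q, p, q].Perm [p, t, q, q, p] :=
    (((List.Perm.swap _ _ _).cons q).cons t).cons p
  have : r = [p, t, q, q, p] := by
    refine eq_of_before (fun a => ?_) fun X₀ a b X₁ hs hab => ?_
    · by_cases h1 : a ∈ [p, t]
      · rw [← count_res h1, ← v1]
        rcases (by simpa using h1 : a = p ∨ a = t) with rfl | rfl <;>
          simp [hqp, hpt, htp, hqt]
      by_cases h2 : a ∈ [q, t]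
      · rw [← count_res h2, ← v2]
        rcases (by simpa using h2 : a = q ∨ a = t) with rfl | rfl <;>
          simp [hpq, hpt, htq, hqt]
      rw [← hperm.count_eq]
      refine count_eq_of_count_le_one hr (hS.one a) ?_
      rw [List.count_eq_zero_of_not_mem]
      · exact zero_le_one
      · simp at h1 h2
        simp [h1, h2]
    · have A := before_of_res_eq (P := [p, t]) hab (hs := hs) (t := r)
      have B := before_of_res_eq (P := [q, t]) hab (hs := hs) (t := r)
      rw [← v1] at A
      rw [← v2] at B
      rcases X₀ with _ | ⟨_, _ | ⟨_, _ | ⟨_, _ | ⟨_, _ | ⟨_, X₀⟩⟩⟩⟩⟩ <;>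
        simp only [List.nil_append, List.cons_append, List.cons.injEq,
          reduceCtorEq, and_false] at hs
      · exact A (by simp [← hs]) (by simp [← hs]) (by simp [res, hqp, hqt])
      · exact B (by simp [← hs]) (by simp [← hs]) (by simp [res, hpq, hpt])
      · exact absurd (hs.2.2.1.symm.trans hs.2.2.2.1) hab
      · obtain ⟨rfl, rfl, rfl, rfl, rfl, -⟩ := hs
        simpa [List.count_cons, htp, htq, hpq, hqp] using hB
      all_goals simp at hs
  subst this
  have := hiso _ hr.symm
  simp at this
  exact hqp this.1

/-- Otherwise `c` would occur in `U` twice through `p` and once more through `q`. -/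
theorem Cover.ne_of_ne {U s : List α} {f : α → List α} {K : ℕ} (h : Cover U s f K) {p q c d : α}
    (hpq : p ≠ q) (hp : s.count p = 2) (hc : f p = [c]) (hd : f q = [d]) (hq : q ∈ s) :
    c ≠ d := by
  rintro rfl
  obtain ⟨X, Y, Z, hs, -⟩ := exists_split_of_count_eq_two hp
  have h1 := h.two c
  rw [← h.eq, hs] at h1
  simp only [List.flatMap_append, List.flatMap_cons, hc, List.count_append, List.count_cons,
    List.count_nil, beq_self_eq_true, if_true] at h1
  have key : ∀ L : List α, q ∈ L → 0 < (L.flatMap f).count c := fun L hL =>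
    List.count_pos_iff.2 (List.mem_flatMap.2 ⟨q, hL, by simp [hd]⟩)
  rw [hs] at hq
  simp only [List.mem_append, List.mem_cons, hpq.symm, false_or] at hq
  rcases hq with hq | hq | hq <;> have := key _ hq <;> omega

/-- In the word `U` there is a long gap between the other occurrences of two letters that are
adjacent somewhere. -/
structure CrossFar (U : List α) (D : ℕ) : Prop where
  r₁ : ∀ X₀ X₁ X₂ X₃ c d, c ≠ d → U = X₀ ++ c :: d :: (X₁ ++ c :: (X₂ ++ d :: X₃)) → D < X₂.length
  r₂ : ∀ X₀ X₁ X₂ X₃ c d, c ≠ d → U = X₀ ++ c :: d :: (X₁ ++ d :: (X₂ ++ c :: X₃)) → D < X₂.length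
  r₃ : ∀ X₀ X₁ X₂ X₃ c d, c ≠ d → U = X₀ ++ c :: (X₁ ++ d :: (X₂ ++ c :: d :: X₃)) → D < X₁.length
  r₄ : ∀ X₀ X₁ X₂ X₃ c d, c ≠ d → U = X₀ ++ d :: (X₁ ++ c :: (X₂ ++ c :: d :: X₃)) → D < X₁.length
  r₅ : ∀ X₀ X₁ X₂ X₃ c d, c ≠ d → U ≠ X₀ ++ c :: (X₁ ++ c :: d :: (X₂ ++ d :: X₃))
  r₆ : ∀ X₀ X₁ X₂ X₃ c d, c ≠ d → U ≠ X₀ ++ d :: (X₁ ++ c :: d :: (X₂ ++ c :: X₃))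

/-- Around an adjacent pair `pq` the restriction to `p`, `q` and a linear letter of the long gap is
`pqptq`, `pqqtp`, `ptqpq` or `qtppq`. The second and fourth are isoterms by hypothesis. The other
two need not be, but the order of the adjacent pair in question is still preserved, by
`before_first` and `before_second`. -/
theorem SquareIso.eq_of_crossFar (hS : SquareIso α S)
    (hfirst : ∀ a b t : α, [a, b, t].Nodup → Iso S [b, a, a, t, b])
    (hsecond : ∀ a b t : α, [a, b, t].Nodup → Iso S [b, t, a, a, b])
    {U s t : List α} {f : α → List α} {K : ℕ} (h : Cover U s f K) (hU : CrossFar U (2 * K))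
    (hst : LSat S s t) : t = s := by
  refine hS.eq_of_nonlinear hst h.count_le_two fun X₀ p q X₁ hs hpq hp hq => ?_
  obtain ⟨c, hc⟩ := h.exists_eq_singleton hp
  obtain ⟨d, hd⟩ := h.exists_eq_singleton hq
  have hcd := h.ne_of_ne hpq hp hc hd (by simp [hs])
  have hlin := h.exists_linear_split (p := p) (q := q)
  have hUs := h.eq.symm
  rcases adjacent_cases hs hpq hp hq with ⟨hp0, hq0, Y₁, Y₂, Y₃, rfl, hY⟩ |
    ⟨hp0, hq0, Y₁, Y₂, Y₃, rfl, hY⟩ | ⟨hp0, hq0, Y₁, Y₂, Y₃, rfl, hY⟩ |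
    ⟨hp0, hq0, Y₁, Y₂, Y₃, rfl, hY⟩ | ⟨Y₁, Y₂, Y₃, Y₄, rfl, rfl, hY⟩ |
    ⟨Y₁, Y₂, Y₃, Y₄, rfl, rfl, hY⟩
  · obtain ⟨t', A, B, rfl, ht⟩ := hlin (X₀ ++ p :: q :: (Y₁ ++ [p])) Y₂ (q :: Y₃) (by simp [hs])
      (hU.r₁ (X₀.flatMap f) (Y₁.flatMap f) _ (Y₃.flatMap f) c d hcd (by simp [hUs, hs, hc, hd]))
      (by tauto) (by tauto)
    refine ⟨[p, q, t'], by simp, by simp, Or.inr ?_⟩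
    simp only [List.mem_append, List.mem_cons, not_or] at ht hY
    have e1 : res [p, q, t'] A = [] := res_eq_nil (by simp [*])
    have e2 : res [p, q, t'] B = [] := res_eq_nil (by simp [*])
    have e3 : res [p, q, t'] X₀ = [] := res_eq_nil (by simp [*])
    have e4 : res [p, q, t'] Y₁ = [] := res_eq_nil (by simp [*])
    have e5 : res [p, q, t'] Y₃ = [] := res_eq_nil (by simp [*])
    have hdd : [p, q, t'].Nodup := by simp [*, Ne.symm]
    rw [List.count_eq_zero_of_not_mem hp0, List.count_eq_zero_of_not_mem hq0]
    refine before_first hS hdd (hfirst p q t' hdd) ?_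
    simpa [hs, res_append, res_cons_of_mem, e1, e2, e3, e4, e5] using hst.res [p, q, t']
  · obtain ⟨t', A, B, rfl, ht⟩ := hlin (X₀ ++ p :: q :: (Y₁ ++ [q])) Y₂ (p :: Y₃) (by simp [hs])
      (hU.r₂ (X₀.flatMap f) (Y₁.flatMap f) _ (Y₃.flatMap f) c d hcd (by simp [hUs, hs, hc, hd]))
      (by tauto) (by tauto)
    refine ⟨[p, q, t'], by simp, by simp, Or.inl ?_⟩
    simp only [List.mem_append, List.mem_cons, not_or] at ht hY
    have e1 : res [p, q, t'] A = [] := res_eq_nil (by simp [*])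
    have e2 : res [p, q, t'] B = [] := res_eq_nil (by simp [*])
    have e3 : res [p, q, t'] X₀ = [] := res_eq_nil (by simp [*])
    have e4 : res [p, q, t'] Y₁ = [] := res_eq_nil (by simp [*])
    have e5 : res [p, q, t'] Y₃ = [] := res_eq_nil (by simp [*])
    simpa [hs, res_append, res_cons_of_mem, e1, e2, e3, e4, e5] using
      hfirst q p t' (by simp [*, Ne.symm])
  · obtain ⟨t', A, B, rfl, ht⟩ := hlin (Y₁ ++ [p]) Y₂ (q :: (Y₃ ++ p :: q :: X₁)) (by simp [hs])
      (hU.r₃ (Y₁.flatMap f) _ (Y₃.flatMap f) (X₁.flatMap f) c d hcd (by simp [hUs, hs, hc, hd]))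
      (by tauto) (by tauto)
    refine ⟨[p, q, t'], by simp, by simp, Or.inr ?_⟩
    simp only [List.mem_append, List.mem_cons, not_or] at ht hY
    have e1 : res [p, q, t'] A = [] := res_eq_nil (by simp [*])
    have e2 : res [p, q, t'] B = [] := res_eq_nil (by simp [*])
    have e3 : res [p, q, t'] X₁ = [] := res_eq_nil (by simp [*])
    have e4 : res [p, q, t'] Y₁ = [] := res_eq_nil (by simp [*])
    have e5 : res [p, q, t'] Y₃ = [] := res_eq_nil (by simp [*])
    have hdd : [p, q, t'].Nodup := by simp [*, Ne.symm]
    have c1 : (Y₁ ++ p :: (A ++ t' :: B ++ q :: Y₃)).count p = 1 := by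
      simp [List.count_eq_zero_of_not_mem, hY, ht, hpq.symm]
    have c2 : (Y₁ ++ p :: (A ++ t' :: B ++ q :: Y₃)).count q = 1 := by
      simp [List.count_eq_zero_of_not_mem, hY, ht, hpq]
    rw [c1, c2]
    refine before_second hS hdd (hsecond q p t' (by simp [*, Ne.symm])) ?_
    simpa [hs, res_append, res_cons_of_mem, e1, e2, e3, e4, e5] using hst.res [p, q, t']
  · obtain ⟨t', A, B, rfl, ht⟩ := hlin (Y₁ ++ [q]) Y₂ (p :: (Y₃ ++ p :: q :: X₁)) (by simp [hs])
      (hU.r₄ (Y₁.flatMap f) _ (Y₃.flatMap f) (X₁.flatMap f) c d hcd (by simp [hUs, hs, hc, hd]))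
      (by tauto) (by tauto)
    refine ⟨[p, q, t'], by simp, by simp, Or.inl ?_⟩
    simp only [List.mem_append, List.mem_cons, not_or] at ht hY
    have e1 : res [p, q, t'] A = [] := res_eq_nil (by simp [*])
    have e2 : res [p, q, t'] B = [] := res_eq_nil (by simp [*])
    have e3 : res [p, q, t'] X₁ = [] := res_eq_nil (by simp [*])
    have e4 : res [p, q, t'] Y₁ = [] := res_eq_nil (by simp [*])
    have e5 : res [p, q, t'] Y₃ = [] := res_eq_nil (by simp [*])
    simpa [hs, res_append, res_cons_of_mem, e1, e2, e3, e4, e5] using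
      hsecond p q t' (by simp [*, Ne.symm])
  · exact absurd (by simp [hUs, hs, hc, hd]) (hU.r₅ (Y₁.flatMap f) (Y₂.flatMap f) (Y₃.flatMap f)
      (Y₄.flatMap f) c d hcd)
  · exact absurd (by simp [hUs, hs, hc, hd]) (hU.r₆ (Y₁.flatMap f) (Y₂.flatMap f) (Y₃.flatMap f)
      (Y₄.flatMap f) c d hcd)

/-- No two letters cross in `U`, and disjoint pairs that are adjacent are long. -/
structure NestedFar (U : List α) (D : ℕ) : Prop where
  r₁ : ∀ X₀ X₁ X₂ X₃ c d, c ≠ d → U ≠ X₀ ++ c :: d :: (X₁ ++ c :: (X₂ ++ d :: X₃))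
  r₃ : ∀ X₀ X₁ X₂ X₃ c d, c ≠ d → U ≠ X₀ ++ c :: (X₁ ++ d :: (X₂ ++ c :: d :: X₃))
  r₅ : ∀ X₀ X₁ X₂ X₃ c d, c ≠ d → U = X₀ ++ c :: (X₁ ++ c :: d :: (X₂ ++ d :: X₃)) →
    D < X₁.length ∧ D < X₂.length
  r₆ : ∀ X₀ X₁ X₂ X₃ c d, c ≠ d → U ≠ X₀ ++ d :: (X₁ ++ c :: d :: (X₂ ++ c :: X₃))

/-- Adjacent letters are either nested, giving the isoterm `pqqp` or `qppq`, or disjoint with two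
long gaps, giving `ptpqt'q`. -/
theorem SquareIso.eq_of_nestedFar (hS : SquareIso α S)
    (hnest : ∀ a b : α, a ≠ b → Iso S [a, b, b, a])
    (hmid : ∀ a b t t' : α, [a, b, t, t'].Nodup → Iso S [a, t, a, b, t', b])
    {U s t : List α} {f : α → List α} {K : ℕ} (h : Cover U s f K) (hU : NestedFar U (2 * K))
    (hst : LSat S s t) : t = s := by
  refine hS.eq_of_nonlinear hst h.count_le_two fun X₀ p q X₁ hs hpq hp hq => ?_
  suffices ∃ P, p ∈ P ∧ q ∈ P ∧ Iso S (res P s) by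
    obtain ⟨P, h1, h2, h3⟩ := this
    exact ⟨P, h1, h2, Or.inl h3⟩
  obtain ⟨c, hc⟩ := h.exists_eq_singleton hp
  obtain ⟨d, hd⟩ := h.exists_eq_singleton hq
  have hcd := h.ne_of_ne hpq hp hc hd (by simp [hs])
  have hlin := h.exists_linear_split (p := p) (q := q)
  have hUs := h.eq.symm
  rcases adjacent_cases hs hpq hp hq with ⟨hp0, hq0, Y₁, Y₂, Y₃, rfl, hY⟩ |
    ⟨hp0, hq0, Y₁, Y₂, Y₃, rfl, hY⟩ | ⟨hp0, hq0, Y₁, Y₂, Y₃, rfl, hY⟩ |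
    ⟨hp0, hq0, Y₁, Y₂, Y₃, rfl, hY⟩ | ⟨Y₁, Y₂, Y₃, Y₄, rfl, rfl, hY⟩ |
    ⟨Y₁, Y₂, Y₃, Y₄, rfl, rfl, hY⟩
  · exact absurd (by simp [hUs, hs, hc, hd]) (hU.r₁ (X₀.flatMap f) (Y₁.flatMap f) (Y₂.flatMap f)
      (Y₃.flatMap f) c d hcd)
  · refine ⟨[p, q], by simp, by simp, ?_⟩
    have e3 : res [p, q] X₀ = [] := res_eq_nil (by simp [*])
    have e4 : res [p, q] Y₁ = [] := res_eq_nil (by simp [*])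
    have e5 : res [p, q] Y₂ = [] := res_eq_nil (by simp [*])
    have e6 : res [p, q] Y₃ = [] := res_eq_nil (by simp [*])
    simpa [hs, res_append, res_cons_of_mem, e3, e4, e5, e6] using hnest p q hpq
  · exact absurd (by simp [hUs, hs, hc, hd]) (hU.r₃ (Y₁.flatMap f) (Y₂.flatMap f) (Y₃.flatMap f)
      (X₁.flatMap f) c d hcd)
  · refine ⟨[p, q], by simp, by simp, ?_⟩
    have e3 : res [p, q] X₁ = [] := res_eq_nil (by simp [*])
    have e4 : res [p, q] Y₁ = [] := res_eq_nil (by simp [*])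
    have e5 : res [p, q] Y₂ = [] := res_eq_nil (by simp [*])
    have e6 : res [p, q] Y₃ = [] := res_eq_nil (by simp [*])
    simpa [hs, res_append, res_cons_of_mem, e3, e4, e5, e6] using hnest q p hpq.symm
  · obtain ⟨h1, h2⟩ := hU.r₅ (Y₁.flatMap f) (Y₂.flatMap f) (Y₃.flatMap f) (Y₄.flatMap f) c d hcd
      (by simp [hUs, hs, hc, hd])
    obtain ⟨t, A, B, rfl, ht⟩ := hlin (Y₁ ++ [p]) Y₂ (p :: q :: (Y₃ ++ q :: Y₄)) (by simp [hs])
      h1 (by tauto) (by tauto)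
    obtain ⟨t', A', B', rfl, ht'⟩ := hlin (Y₁ ++ p :: ((A ++ t :: B) ++ [p, q])) Y₃ (q :: Y₄)
      (by simp [hs]) h2 (by tauto) (by tauto)
    refine ⟨[p, q, t, t'], by simp, by simp, ?_⟩
    simp only [List.mem_append, List.mem_cons, not_or] at ht hY ht'
    have e1 : res [p, q, t, t'] A = [] := res_eq_nil (by simp [*])
    have e2 : res [p, q, t, t'] B = [] := res_eq_nil (by simp [*])
    have e3 : res [p, q, t, t'] A' = [] := res_eq_nil (by simp [*])
    have e4 : res [p, q, t, t'] B' = [] := res_eq_nil (by simp [*])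
    have e5 : res [p, q, t, t'] Y₁ = [] := res_eq_nil (by simp [*])
    have e6 : res [p, q, t, t'] Y₄ = [] := res_eq_nil (by simp [*])
    simpa [hs, res_append, res_cons_of_mem, e1, e2, e3, e4, e5, e6] using
      hmid p q t t' (by simp [*, Ne.symm])
  · exact absurd (by simp [hUs, hs, hc, hd]) (hU.r₆ (Y₁.flatMap f) (Y₂.flatMap f) (Y₃.flatMap f)
      (Y₄.flatMap f) c d hcd)

end Square

/-! ### Equational deduction and a criterion for having no finite basis -/

section Deduction

variable {α : Type u}

/-- The list of letters of an element of the free semigroup. -/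
def letters (u : FreeSemigroup α) : List α := u.head :: u.tail

theorem letters_mul (u v : FreeSemigroup α) : letters (u * v) = letters u ++ letters v := by
  simp [letters]

theorem letters_map (θ : FreeSemigroup α →ₙ* FreeSemigroup α) (u : FreeSemigroup α) :
    letters (θ u) = (letters u).flatMap fun a => letters (θ (FreeSemigroup.of a)) := by
  induction u using FreeSemigroup.recOnMul with
  | ih1 a => simp [letters]
  | ih2 a y _ ih => rw [map_mul, letters_mul, letters_mul, List.flatMap_append, ← ih]; simp [letters]

theorem SemigroupSat.lsat {S : Type v} [Monoid S] {u v : FreeSemigroup α}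
    (h : SemigroupSat S u v) : LSat S (letters u) (letters v) := fun φ =>
  h { toFun := fun u => φ (word (letters u))
      map_mul' := fun a b => by simp only [letters_mul, word, FreeMonoid.ofList_append, map_mul] }

theorem LSat.semigroupSat {S : Type v} [Monoid S] {u v : FreeSemigroup α}
    (h : LSat S (letters u) (letters v)) : SemigroupSat S u v := fun φ => by
  let ψ : FreeSemigroup α →ₙ* S :=
    { toFun := fun u => FreeMonoid.lift (fun a => φ (FreeSemigroup.of a)) (word (letters u))
      map_mul' := fun a b => by simp only [letters_mul, word, FreeMonoid.ofList_append, map_mul] }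
  have : ψ = φ := FreeSemigroup.hom_ext (by ext a; simp [ψ, letters])
  rw [← this]
  exact h (FreeMonoid.lift fun a => φ (FreeSemigroup.of a))

/-- Being equal to `U` is tested in every context and under every substitution, erasing ones
included. This generality lets the invariant pass through products, which enlarge the context, and
through `subst`, which composes substitutions. -/
theorem Deducible.invariant {E : Set (FreeSemigroup α × FreeSemigroup α)} {U : List α}
    (hE : ∀ e ∈ E, ∀ (f : α → List α) (p q : List α),
      (p ++ (letters e.1).flatMap f ++ q = U ↔ p ++ (letters e.2).flatMap f ++ q = U))
    {u v : FreeSemigroup α} (h : Deducible E u v) : ∀ (f : α → List α) (p q : List α),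
      (p ++ (letters u).flatMap f ++ q = U ↔ p ++ (letters v).flatMap f ++ q = U) := by
  induction h with
  | of h => exact hE _ h
  | refl => exact fun _ _ _ => Iff.rfl
  | symm _ ih => exact fun f p q => (ih f p q).symm
  | trans _ _ ih ih' => exact fun f p q => (ih f p q).trans (ih' f p q)
  | @mul u v u' v' _ _ ih ih' =>
    intro f p q
    have h1 := ih f p ((letters u').flatMap f ++ q)
    have h2 := ih' f (p ++ (letters v).flatMap f) q
    simp only [letters_mul, List.flatMap_append, List.append_assoc] at h1 h2 ⊢
    exact h1.trans h2
  | subst θ _ ih =>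
    intro f p q
    have h1 := ih (fun a => (letters (θ (FreeSemigroup.of a))).flatMap f) p q
    rw [letters_map, letters_map, List.flatMap_assoc, List.flatMap_assoc]
    exact h1

theorem flatMap_filter_ne_nil (f : α → List α) (l : List α) :
    (l.filter fun a => !(f a).isEmpty).flatMap f = l.flatMap f := by
  induction l with
  | nil => rfl
  | cons a l ih =>
    by_cases h : f a = []
    · simp [h, ih]
    · simp [h, ih]

/-- Take K bounding the number of letters in both sides of each identity of a finite basis. No
application of such an identity changes `U`, so `U ≈ V` cannot be deduced. -/
theorem not_finitelyBased_of [DecidableEq α] [Infinite α] {S : Type v} [Monoid S]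
    (h : ∀ K : ℕ, ∃ U V : List α, U ≠ V ∧ U ≠ [] ∧ V ≠ [] ∧ LSat S U V ∧
      ∀ (s t : List α) (f : α → List α), LSat S s t → s.toFinset.card ≤ K →
        (∀ x ∈ s, f x ≠ []) → s.flatMap f = U → t = s) : ¬ FinitelyBased α S := by
  rintro ⟨E, hfin, hsat, hded⟩
  obtain ⟨K, hK⟩ := (hfin.image fun e =>
    max (letters e.1).toFinset.card (letters e.2).toFinset.card).bddAbove
  have hK' : ∀ e ∈ E, (letters e.1).toFinset.card ≤ K ∧ (letters e.2).toFinset.card ≤ K :=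
    fun e he => max_le_iff.1 (hK ⟨e, he, rfl⟩)
  -- Two extra letters are reserved: fresh `z`, `z'` are placed around `s` and sent to the context
  -- `p`, `q`, so that all of `U` is covered.
  obtain ⟨U, V, hUV, hU0, hV0, hsatUV, hcore⟩ := h (K + 2)
  have key : ∀ s t : List α, LSat S s t → s.toFinset.card ≤ K → ∀ (f : α → List α)
      (p q : List α), p ++ s.flatMap f ++ q = U → p ++ t.flatMap f ++ q = U := by
    intro s t hst hs f p q hU
    obtain ⟨z, hz⟩ := Infinite.exists_notMem_finset (s ++ t).toFinset
    obtain ⟨z', hz'⟩ := Infinite.exists_notMem_finset (insert z (s ++ t).toFinset)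
    simp only [List.mem_toFinset, List.mem_append, not_or, Finset.mem_insert] at hz hz'
    let g : α → List α := fun a => if a = z then p else if a = z' then q else f a
    have hg : ∀ l : List α, z ∉ l → z' ∉ l → (z :: (l ++ [z'])).flatMap g =
        p ++ l.flatMap f ++ q := by
      intro l h1 h2
      have : l.flatMap g = l.flatMap f := List.flatMap_congr fun a ha => by
        have h3 : a ≠ z := fun e => h1 (e ▸ ha)
        have h4 : a ≠ z' := fun e => h2 (e ▸ ha)
        simp [g, h3, h4]
      simp only [List.flatMap_cons, List.flatMap_append, this, List.flatMap_nil]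
      simp [g, hz'.1]
    have hsat' : LSat S (z :: (s ++ [z'])) (z :: (t ++ [z'])) :=
      (LSat.refl [z]).append (hst.append (LSat.refl [z']))
    -- Letters with empty image are deleted from both sides of the identity, which makes the
    -- substitution nonerasing.
    have h1 := hcore _ _ g (hsat'.filter fun a => !(g a).isEmpty) (by
      refine (Finset.card_le_card (t := insert z (insert z' s.toFinset)) fun a ha => ?_).trans
        ((Finset.card_insert_le _ _).trans (Nat.succ_le_succ
          ((Finset.card_insert_le _ _).trans (Nat.succ_le_succ hs))))
      simp at ha ⊢
      tauto) (fun x hx => by simpa using (List.mem_filter.1 hx).2)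
      (by rw [flatMap_filter_ne_nil, hg s hz.1 hz'.2.1, hU])
    have h2 := congrArg (List.flatMap g) h1
    rw [flatMap_filter_ne_nil, flatMap_filter_ne_nil, hg s hz.1 hz'.2.1,
      hg t hz.2 hz'.2.2] at h2
    rw [h2, hU]
  obtain ⟨a, U', rfl⟩ := List.exists_cons_of_ne_nil hU0
  obtain ⟨b, V', rfl⟩ := List.exists_cons_of_ne_nil hV0
  have hd := hded ⟨a, U'⟩ ⟨b, V'⟩ (LSat.semigroupSat hsatUV)
  have := (hd.invariant (fun e he f p q => ⟨key _ _ (hsat e he).lsat (hK' e he).1 f p q,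
    key _ _ (hsat e he).lsat.symm (hK' e he).2 f p q⟩) (fun a => [a]) [] []).1
    (by simp [letters])
  exact hUV (by simpa [letters] using this.symm)

end Deduction

/-! ### The long words over the natural numbers -/

section Words

theorem eq_or_add_eq_of_modEq {a b M : ℕ} (ha : a < M) (hb : b < 2 * M) (h : a ≡ b [MOD M]) :
    a = b ∨ a + M = b := by
  rcases lt_or_ge b M with h1 | h1
  · exact Or.inl (h.eq_of_lt_of_lt ha h1)
  · refine Or.inr ?_
    have h2 : a ≡ b - M [MOD M] := by
      refine h.trans ?_
      conv_lhs => rw [← Nat.sub_add_cancel h1]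
      simp [Nat.ModEq]
    have := h2.eq_of_lt_of_lt ha (by omega)
    omega

/-- The permutation `k ↦ r * k + c` modulo `r * r - 1`. -/
def affine (r c k : ℕ) : ℕ := (r * k + c) % (r * r - 1)

section affine

variable {r c : ℕ}

theorem affine_lt (hr : 2 ≤ r) (k : ℕ) : affine r c k < r * r - 1 :=
  Nat.mod_lt _ (by nlinarith [Nat.sub_add_cancel (show 1 ≤ r * r by nlinarith)])

theorem cast_affine (k : ℕ) : (affine r c k : ZMod (r * r - 1)) = r * k + c := by
  simp [affine]

theorem cast_mul_self (hr : 2 ≤ r) : (r * r : ZMod (r * r - 1)) = 1 := by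
  have h : r * r = (r * r - 1) + 1 := by nlinarith [Nat.sub_add_cancel (show 1 ≤ r * r by nlinarith)]
  have := congrArg (Nat.cast : ℕ → ZMod (r * r - 1)) h
  simpa using this

/-- Since r · r ≡ 1 modulo r² − 1, multiplication by r is its own inverse. The permutation and its
inverse thus both move neighbours to cyclic distance r. -/
theorem modEq_of_affine (hr : 2 ≤ r) {k l d : ℕ} (h : affine r c l = affine r c k + d) :
    l ≡ k + r * d [MOD (r * r - 1)] := by
  rw [← ZMod.natCast_eq_natCast_iff]
  have h1 := congrArg (Nat.cast : ℕ → ZMod (r * r - 1)) h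
  push_cast at h1 ⊢
  rw [cast_affine, cast_affine] at h1
  have h2 := cast_mul_self hr
  linear_combination (r : ZMod (r * r - 1)) * h1 + ((k : ZMod (r * r - 1)) - l) * h2

theorem affine_injOn (hr : 2 ≤ r) {k l : ℕ} (hk : k < r * r - 1) (hl : l < r * r - 1)
    (h : affine r c k = affine r c l) : k = l :=
  (by simpa using modEq_of_affine hr (d := 0) (by simpa using h) :
    k ≡ l [MOD (r * r - 1)]).eq_of_lt_of_lt hk hl

theorem affine_far (hr : 2 ≤ r) {k l : ℕ} (hk : k < r * r - 1) (hl : l < r * r - 1)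
    (h : affine r c k + 1 = affine r c l) : l = k + r ∨ l + (r * r - 1) = k + r := by
  have hr' : r < r * r - 1 ∨ r * r - 1 = 3 := by
    rcases hr.eq_or_lt with rfl | h3
    · right; rfl
    · left; have : 3 * r ≤ r * r := by nlinarith
      omega
  refine eq_or_add_eq_of_modEq hl (by
    rcases hr' with h | h
    · omega
    · have : r ≤ 2 := by nlinarith [Nat.sub_add_cancel (show 1 ≤ r * r by nlinarith)]
      omega) ?_
  simpa using modEq_of_affine hr h.symm

theorem affine_succ_far (hr : 3 ≤ r) (k : ℕ) :
    affine r c (k + 1) = affine r c k + r ∨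
      affine r c (k + 1) + (r * r - 1) = affine r c k + r := by
  have h3 : 3 * r ≤ r * r := by nlinarith
  have := affine_lt (c := c) (by omega : 2 ≤ r) k
  refine eq_or_add_eq_of_modEq (affine_lt (by omega) _) (by omega) ?_
  rw [← ZMod.natCast_eq_natCast_iff]
  push_cast
  rw [cast_affine, cast_affine]
  push_cast
  ring

end affine

/-- The word listing the numbers below `M` twice, first in their natural order, then in the
order given by `g`. -/
def doubleWord (M : ℕ) (g : ℕ → ℕ) : List ℕ := List.range M ++ (List.range M).map g

theorem getElem?_of_prefix {β : Type*} {L W : List β} (hL : L = W) (X : List β) {c : β}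
    (h : X ++ [c] <+: W) : L[X.length]? = some c := by
  obtain ⟨Y, rfl⟩ := h
  subst hL
  simp

theorem doubleWord_getElem? {M : ℕ} {g : ℕ → ℕ} {i n : ℕ} (h : (doubleWord M g)[i]? = some n) :
    (i < M ∧ n = i) ∨ (M ≤ i ∧ i < 2 * M ∧ n = g (i - M)) := by
  rw [doubleWord, List.getElem?_append] at h
  split_ifs at h with h1
  · simp at h1
    simp [h1] at h
    exact Or.inl ⟨h1, h.symm⟩
  · simp at h1
    simp only [List.length_range, List.getElem?_map, Option.map_eq_some_iff] at h
    obtain ⟨a, h2, h3⟩ := h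
    have h4 := List.getElem?_eq_some_iff.1 h2
    obtain ⟨h5, h6⟩ := h4
    simp at h5 h6
    exact Or.inr ⟨h1, by omega, by rw [← h3, ← h6]⟩

/-- Each half lists distinct numbers, so two occurrences of a number lie in different halves. -/
theorem doubleWord_pair {M : ℕ} {g : ℕ → ℕ}
    (hg : ∀ k l, k < M → l < M → g k = g l → k = l) {i k n : ℕ}
    (hi : (doubleWord M g)[i]? = some n) (hk : (doubleWord M g)[k]? = some n) (hik : i < k) :
    i < M ∧ n = i ∧ ∃ k', k' < M ∧ k = M + k' ∧ g k' = n := by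
  rcases doubleWord_getElem? hi with h1 | h1 <;> rcases doubleWord_getElem? hk with h2 | h2
  · omega
  · exact ⟨h1.1, h1.2, k - M, by omega, by omega, h2.2.2.symm⟩
  · omega
  · have := hg (i - M) (k - M) (by omega) (by omega) (h1.2.2.symm.trans h2.2.2)
    omega

/-- A repeated pair would consist of consecutive numbers, adjacent in the same order in the second
half, that is, g(k + 1) = g(k) + 1. -/
theorem doubleWord_norep {M : ℕ} {g : ℕ → ℕ}
    (hg : ∀ k l, k < M → l < M → g k = g l → k = l)
    (hstep : ∀ k, k + 1 < M → g (k + 1) ≠ g k + 1) (X₀ X₁ X₂ : List ℕ) (c d : ℕ) :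
    doubleWord M g ≠ X₀ ++ c :: d :: (X₁ ++ c :: d :: X₂) := by
  intro h
  have h1 := getElem?_of_prefix h X₀ (c := c) (by simp)
  have h2 := getElem?_of_prefix h (X₀ ++ [c]) (c := d) (by simp)
  have h3 := getElem?_of_prefix h (X₀ ++ c :: d :: X₁) (c := c) (by simp)
  have h4 := getElem?_of_prefix h (X₀ ++ c :: d :: (X₁ ++ [c])) (c := d) (by simp)
  simp only [List.length_append, List.length_cons, List.length_nil] at h1 h2 h3 h4
  obtain ⟨e1, e2, k, e3, e4, e5⟩ := doubleWord_pair hg h1 h3 (by omega)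
  obtain ⟨f1, f2, l, f3, f4, f5⟩ := doubleWord_pair hg h2 h4 (by omega)
  obtain rfl : l = k + 1 := by omega
  exact hstep k f3 (by omega)

theorem doubleWord_far {M D : ℕ} {g : ℕ → ℕ}
    (hg : ∀ k l, k < M → l < M → g k = g l → k = l)
    (hfar : ∀ k, k < M → D + 1 + g k ≤ M + k) (X₀ X₁ X₂ : List ℕ) (c : ℕ)
    (h : doubleWord M g = X₀ ++ c :: (X₁ ++ c :: X₂)) : D ≤ X₁.length := by
  have h1 := getElem?_of_prefix h X₀ (c := c) (by simp)
  have h2 := getElem?_of_prefix h (X₀ ++ c :: X₁) (c := c) (by simp)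
  simp only [List.length_append, List.length_cons] at h1 h2
  obtain ⟨e1, e2, k, e3, e4, e5⟩ := doubleWord_pair hg h1 h2 (by omega)
  have := hfar k e3
  omega

/-- The hypothesis `hfar` separates in the second half letters adjacent in the first, and `hfar'`
does the converse. With `h0` the two halves meet in a square, so no pair of distinct letters
straddles the border; this excludes `r₆`. -/
theorem doubleWord_crossFar {M D : ℕ} {g : ℕ → ℕ}
    (hg : ∀ k l, k < M → l < M → g k = g l → k = l) (h0 : g 0 + 1 = M)
    (hfar : ∀ k l, k < M → l < M → g k + 1 = g l → k + D + 1 < l ∨ l + D + 1 < k)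
    (hfar' : ∀ k, k + 1 < M → g k + D + 1 < g (k + 1) ∨ g (k + 1) + D + 1 < g k) :
    CrossFar (doubleWord M g) D where
  r₁ X₀ X₁ X₂ X₃ c d hcd h := by
    have h1 := getElem?_of_prefix h X₀ (c := c) (by simp)
    have h2 := getElem?_of_prefix h (X₀ ++ [c]) (c := d) (by simp)
    have h3 := getElem?_of_prefix h (X₀ ++ c :: d :: X₁) (c := c) (by simp)
    have h4 := getElem?_of_prefix h (X₀ ++ c :: d :: (X₁ ++ c :: X₂)) (c := d) (by simp)
    simp only [List.length_append, List.length_cons, List.length_nil] at h1 h2 h3 h4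
    obtain ⟨e1, e2, k, e3, e4, e5⟩ := doubleWord_pair hg h1 h3 (by omega)
    obtain ⟨f1, f2, l, f3, f4, f5⟩ := doubleWord_pair hg h2 h4 (by omega)
    have := hfar k l e3 f3 (by omega)
    omega
  r₂ X₀ X₁ X₂ X₃ c d hcd h := by
    have h1 := getElem?_of_prefix h X₀ (c := c) (by simp)
    have h2 := getElem?_of_prefix h (X₀ ++ [c]) (c := d) (by simp)
    have h3 := getElem?_of_prefix h (X₀ ++ c :: d :: X₁) (c := d) (by simp)
    have h4 := getElem?_of_prefix h (X₀ ++ c :: d :: (X₁ ++ d :: X₂)) (c := c) (by simp)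
    simp only [List.length_append, List.length_cons, List.length_nil] at h1 h2 h3 h4
    obtain ⟨e1, e2, k, e3, e4, e5⟩ := doubleWord_pair hg h1 h4 (by omega)
    obtain ⟨f1, f2, l, f3, f4, f5⟩ := doubleWord_pair hg h2 h3 (by omega)
    have := hfar k l e3 f3 (by omega)
    omega
  r₃ X₀ X₁ X₂ X₃ c d hcd h := by
    have h1 := getElem?_of_prefix h X₀ (c := c) (by simp)
    have h2 := getElem?_of_prefix h (X₀ ++ c :: X₁) (c := d) (by simp)
    have h3 := getElem?_of_prefix h (X₀ ++ c :: (X₁ ++ d :: X₂)) (c := c) (by simp)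
    have h4 := getElem?_of_prefix h (X₀ ++ c :: (X₁ ++ d :: (X₂ ++ [c]))) (c := d) (by simp)
    simp only [List.length_append, List.length_cons, List.length_nil] at h1 h2 h3 h4
    obtain ⟨e1, e2, k, e3, e4, e5⟩ := doubleWord_pair hg h1 h3 (by omega)
    obtain ⟨f1, f2, l, f3, f4, f5⟩ := doubleWord_pair hg h2 h4 (by omega)
    obtain rfl : l = k + 1 := by omega
    have := hfar' k f3
    omega
  r₄ X₀ X₁ X₂ X₃ c d hcd h := by
    have h1 := getElem?_of_prefix h X₀ (c := d) (by simp)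
    have h2 := getElem?_of_prefix h (X₀ ++ d :: X₁) (c := c) (by simp)
    have h3 := getElem?_of_prefix h (X₀ ++ d :: (X₁ ++ c :: X₂)) (c := c) (by simp)
    have h4 := getElem?_of_prefix h (X₀ ++ d :: (X₁ ++ c :: (X₂ ++ [c]))) (c := d) (by simp)
    simp only [List.length_append, List.length_cons, List.length_nil] at h1 h2 h3 h4
    obtain ⟨e1, e2, k, e3, e4, e5⟩ := doubleWord_pair hg h2 h3 (by omega)
    obtain ⟨f1, f2, l, f3, f4, f5⟩ := doubleWord_pair hg h1 h4 (by omega)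
    obtain rfl : l = k + 1 := by omega
    have := hfar' k f3
    omega
  r₅ X₀ X₁ X₂ X₃ c d hcd h := by
    have h1 := getElem?_of_prefix h X₀ (c := c) (by simp)
    have h2 := getElem?_of_prefix h (X₀ ++ c :: X₁) (c := c) (by simp)
    have h3 := getElem?_of_prefix h (X₀ ++ c :: (X₁ ++ [c])) (c := d) (by simp)
    have h4 := getElem?_of_prefix h (X₀ ++ c :: (X₁ ++ c :: d :: X₂)) (c := d) (by simp)
    simp only [List.length_append, List.length_cons, List.length_nil] at h1 h2 h3 h4
    obtain ⟨e1, e2, k, e3, e4, e5⟩ := doubleWord_pair hg h1 h2 (by omega)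
    obtain ⟨f1, f2, l, f3, f4, f5⟩ := doubleWord_pair hg h3 h4 (by omega)
    omega
  r₆ X₀ X₁ X₂ X₃ c d hcd h := by
    have h1 := getElem?_of_prefix h X₀ (c := d) (by simp)
    have h2 := getElem?_of_prefix h (X₀ ++ d :: X₁) (c := c) (by simp)
    have h3 := getElem?_of_prefix h (X₀ ++ d :: (X₁ ++ [c])) (c := d) (by simp)
    have h4 := getElem?_of_prefix h (X₀ ++ d :: (X₁ ++ c :: d :: X₂)) (c := c) (by simp)
    simp only [List.length_append, List.length_cons, List.length_nil] at h1 h2 h3 h4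
    obtain ⟨e1, e2, k, e3, e4, e5⟩ := doubleWord_pair hg h1 h3 (by omega)
    obtain ⟨f1, f2, l, f3, f4, f5⟩ := doubleWord_pair hg h2 h4 (by omega)
    obtain rfl : k = 0 := by omega
    omega

theorem doubleWord_perm {M : ℕ} {g : ℕ → ℕ} (hg : ∀ k l, k < M → l < M → g k = g l → k = l)
    (hlt : ∀ k, k < M → g k < M) : ((List.range M).map g).Perm (List.range M) := by
  refine (List.subperm_of_subset ?_ fun x hx => ?_).perm_of_length_le (by simp)
  · refine List.Nodup.map_on (fun x hx y hy h => hg x y (by simpa using hx) (by simpa using hy) h)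
      List.nodup_range
  · obtain ⟨k, hk, rfl⟩ := List.mem_map.1 hx
    simpa using hlt k (by simpa using hk)

/-- The word `y₁ … yₙ yₙ … y₁ z₁ … zₙ zₙ … z₁`. -/
def nestedWord (n : ℕ) : List ℕ :=
  (List.range n ++ (List.range n).reverse) ++
    ((List.range n).map (· + n) ++ ((List.range n).map (· + n)).reverse)

theorem nestedWord_getElem? {n i m : ℕ} (h : (nestedWord n)[i]? = some m) :
    (i < n ∧ m = i) ∨ (n ≤ i ∧ i < 2 * n ∧ m + i + 1 = 2 * n) ∨
    (2 * n ≤ i ∧ i < 3 * n ∧ m + n = i) ∨ (3 * n ≤ i ∧ i < 4 * n ∧ m + i + 1 = 5 * n) := by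
  obtain ⟨h1, h2⟩ := List.getElem?_eq_some_iff.1 h
  simp [nestedWord] at h1
  simp only [nestedWord, List.getElem_append, List.length_append, List.length_range,
    List.length_reverse, List.length_map] at h2
  split_ifs at h2 <;> simp at h2 <;> omega

/-- Each palindrome is symmetric about its centre, so the positions of equal letters sum to 2n − 1
in the first palindrome and to 6n − 1 in the second. -/
theorem nestedWord_pair {n i k m : ℕ} (hi : (nestedWord n)[i]? = some m)
    (hk : (nestedWord n)[k]? = some m) (hik : i < k) :
    (i < n ∧ i + k + 1 = 2 * n) ∨ (2 * n ≤ i ∧ i < 3 * n ∧ i + k + 1 = 6 * n) := by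
  rcases nestedWord_getElem? hi with h1 | h1 | h1 | h1 <;>
    rcases nestedWord_getElem? hk with h2 | h2 | h2 | h2 <;> omega

theorem nestedWord_norep {n : ℕ} (X₀ X₁ X₂ : List ℕ) (c d : ℕ) :
    nestedWord n ≠ X₀ ++ c :: d :: (X₁ ++ c :: d :: X₂) := by
  intro h
  have h1 := getElem?_of_prefix h X₀ (c := c) (by simp)
  have h2 := getElem?_of_prefix h (X₀ ++ [c]) (c := d) (by simp)
  have h3 := getElem?_of_prefix h (X₀ ++ c :: d :: X₁) (c := c) (by simp)
  have h4 := getElem?_of_prefix h (X₀ ++ c :: d :: (X₁ ++ [c])) (c := d) (by simp)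
  simp only [List.length_append, List.length_cons, List.length_nil] at h1 h2 h3 h4
  rcases nestedWord_pair h1 h3 (by omega) with e | e <;>
    rcases nestedWord_pair h2 h4 (by omega) with f | f <;> omega

/-- Distinct letters of one palindrome are nested, hence never cross. Disjoint adjacent pairs occur
only at the junction, where the outermost letter of each palindrome encloses 2n − 2 letters. -/
theorem nestedWord_nestedFar {n D : ℕ} (hn : D + 2 ≤ n) : NestedFar (nestedWord n) D where
  r₁ X₀ X₁ X₂ X₃ c d hcd h := by
    have h1 := getElem?_of_prefix h X₀ (c := c) (by simp)
    have h2 := getElem?_of_prefix h (X₀ ++ [c]) (c := d) (by simp)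
    have h3 := getElem?_of_prefix h (X₀ ++ c :: d :: X₁) (c := c) (by simp)
    have h4 := getElem?_of_prefix h (X₀ ++ c :: d :: (X₁ ++ c :: X₂)) (c := d) (by simp)
    simp only [List.length_append, List.length_cons, List.length_nil] at h1 h2 h3 h4
    rcases nestedWord_pair h1 h3 (by omega) with e | e <;>
      rcases nestedWord_pair h2 h4 (by omega) with f | f <;> omega
  r₃ X₀ X₁ X₂ X₃ c d hcd h := by
    have h1 := getElem?_of_prefix h X₀ (c := c) (by simp)
    have h2 := getElem?_of_prefix h (X₀ ++ c :: X₁) (c := d) (by simp)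
    have h3 := getElem?_of_prefix h (X₀ ++ c :: (X₁ ++ d :: X₂)) (c := c) (by simp)
    have h4 := getElem?_of_prefix h (X₀ ++ c :: (X₁ ++ d :: (X₂ ++ [c]))) (c := d) (by simp)
    simp only [List.length_append, List.length_cons, List.length_nil] at h1 h2 h3 h4
    rcases nestedWord_pair h1 h3 (by omega) with e | e <;>
      rcases nestedWord_pair h2 h4 (by omega) with f | f <;> omega
  r₅ X₀ X₁ X₂ X₃ c d hcd h := by
    have h1 := getElem?_of_prefix h X₀ (c := c) (by simp)
    have h2 := getElem?_of_prefix h (X₀ ++ c :: X₁) (c := c) (by simp)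
    have h3 := getElem?_of_prefix h (X₀ ++ c :: (X₁ ++ [c])) (c := d) (by simp)
    have h4 := getElem?_of_prefix h (X₀ ++ c :: (X₁ ++ c :: d :: X₂)) (c := d) (by simp)
    simp only [List.length_append, List.length_cons, List.length_nil] at h1 h2 h3 h4
    rcases nestedWord_pair h1 h2 (by omega) with e | e <;>
      rcases nestedWord_pair h3 h4 (by omega) with f | f <;> omega
  r₆ X₀ X₁ X₂ X₃ c d hcd h := by
    have h1 := getElem?_of_prefix h X₀ (c := d) (by simp)
    have h2 := getElem?_of_prefix h (X₀ ++ d :: X₁) (c := c) (by simp)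
    have h3 := getElem?_of_prefix h (X₀ ++ d :: (X₁ ++ [c])) (c := d) (by simp)
    have h4 := getElem?_of_prefix h (X₀ ++ d :: (X₁ ++ c :: d :: X₂)) (c := c) (by simp)
    simp only [List.length_append, List.length_cons, List.length_nil] at h1 h2 h3 h4
    rcases nestedWord_pair h1 h3 (by omega) with e | e <;>
      rcases nestedWord_pair h2 h4 (by omega) with f | f <;> omega

end Words

/-! ### Transport of the conditions on words along an injection of ℕ -/

section Map

variable {α : Type u} {e : ℕ → α}

theorem map_invFun (he : Function.Injective e) {L : List ℕ} {U : List α} (h : L.map e = U) :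
    L = U.map (Function.invFun e) := by
  rw [← h, List.map_map, Function.invFun_comp he, List.map_id]

theorem invFun_ne (he : Function.Injective e) {L : List ℕ} {U : List α} (h : L.map e = U) {c d : α}
    (hc : c ∈ U) (hd : d ∈ U) (hcd : c ≠ d) : Function.invFun e c ≠ Function.invFun e d := by
  subst h
  obtain ⟨n, -, rfl⟩ := List.mem_map.1 hc
  obtain ⟨m, -, rfl⟩ := List.mem_map.1 hd
  rw [Function.leftInverse_invFun he, Function.leftInverse_invFun he]
  exact fun h => hcd (h ▸ rfl)

theorem CrossFar.map (he : Function.Injective e) {L : List ℕ} {D : ℕ} (h : CrossFar L D) :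
    CrossFar (L.map e) D where
  r₁ X₀ X₁ X₂ X₃ c d hcd hU := by
    simpa using h.r₁ _ (X₁.map (Function.invFun e)) (X₂.map (Function.invFun e)) _ _ _
      (invFun_ne he hU (by simp) (by simp) hcd) (by simpa using map_invFun he hU)
  r₂ X₀ X₁ X₂ X₃ c d hcd hU := by
    simpa using h.r₂ _ (X₁.map (Function.invFun e)) (X₂.map (Function.invFun e)) _ _ _
      (invFun_ne he hU (by simp) (by simp) hcd) (by simpa using map_invFun he hU)
  r₃ X₀ X₁ X₂ X₃ c d hcd hU := by
    simpa using h.r₃ _ (X₁.map (Function.invFun e)) (X₂.map (Function.invFun e)) _ _ _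
      (invFun_ne he hU (by simp) (by simp) hcd) (by simpa using map_invFun he hU)
  r₄ X₀ X₁ X₂ X₃ c d hcd hU := by
    simpa using h.r₄ _ (X₁.map (Function.invFun e)) (X₂.map (Function.invFun e)) _ _ _
      (invFun_ne he hU (by simp) (by simp) hcd) (by simpa using map_invFun he hU)
  r₅ X₀ X₁ X₂ X₃ c d hcd hU :=
    h.r₅ (X₀.map (Function.invFun e)) (X₁.map (Function.invFun e)) (X₂.map (Function.invFun e))
      (X₃.map (Function.invFun e)) _ _
      (invFun_ne he hU (by simp) (by simp) hcd) (by simpa using map_invFun he hU)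
  r₆ X₀ X₁ X₂ X₃ c d hcd hU :=
    h.r₆ (X₀.map (Function.invFun e)) (X₁.map (Function.invFun e)) (X₂.map (Function.invFun e))
      (X₃.map (Function.invFun e)) _ _
      (invFun_ne he hU (by simp) (by simp) hcd) (by simpa using map_invFun he hU)

theorem NestedFar.map (he : Function.Injective e) {L : List ℕ} {D : ℕ} (h : NestedFar L D) :
    NestedFar (L.map e) D where
  r₁ X₀ X₁ X₂ X₃ c d hcd hU :=
    h.r₁ (X₀.map (Function.invFun e)) (X₁.map (Function.invFun e)) (X₂.map (Function.invFun e))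
      (X₃.map (Function.invFun e)) _ _
      (invFun_ne he hU (by simp) (by simp) hcd) (by simpa using map_invFun he hU)
  r₃ X₀ X₁ X₂ X₃ c d hcd hU :=
    h.r₃ (X₀.map (Function.invFun e)) (X₁.map (Function.invFun e)) (X₂.map (Function.invFun e))
      (X₃.map (Function.invFun e)) _ _
      (invFun_ne he hU (by simp) (by simp) hcd) (by simpa using map_invFun he hU)
  r₅ X₀ X₁ X₂ X₃ c d hcd hU := by
    simpa using h.r₅ _ (X₁.map (Function.invFun e)) (X₂.map (Function.invFun e)) _ _ _
      (invFun_ne he hU (by simp) (by simp) hcd) (by simpa using map_invFun he hU)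
  r₆ X₀ X₁ X₂ X₃ c d hcd hU :=
    h.r₆ (X₀.map (Function.invFun e)) (X₁.map (Function.invFun e)) (X₂.map (Function.invFun e))
      (X₃.map (Function.invFun e)) _ _
      (invFun_ne he hU (by simp) (by simp) hcd) (by simpa using map_invFun he hU)

theorem norep_map (he : Function.Injective e) {L : List ℕ}
    (h : ∀ X₀ X₁ X₂ c d, L ≠ X₀ ++ c :: d :: (X₁ ++ c :: d :: X₂)) (X₀ X₁ X₂ : List α) (c d : α) :
    L.map e ≠ X₀ ++ c :: d :: (X₁ ++ c :: d :: X₂) := fun hU =>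
  h (X₀.map (Function.invFun e)) (X₁.map (Function.invFun e)) (X₂.map (Function.invFun e)) _ _
    (by simpa using map_invFun he hU)

theorem far_map (he : Function.Injective e) {L : List ℕ} {D : ℕ}
    (h : ∀ X₀ X₁ X₂ c, L = X₀ ++ c :: (X₁ ++ c :: X₂) → D ≤ X₁.length) (X₀ X₁ X₂ : List α) (c : α)
    (hU : L.map e = X₀ ++ c :: (X₁ ++ c :: X₂)) : D ≤ X₁.length := by
  simpa using h _ (X₁.map (Function.invFun e)) _ _ (by simpa using map_invFun he hU)

end Map

/-! ### Identities of S(W) in terms of subwords of W -/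

section Rees

variable {α : Type u} {W : Set (FreeMonoid α)}

/-- The word spelled by a list is a subword of a word in `W`. -/
def IsSub (W : Set (FreeMonoid α)) (l : List α) : Prop := word l ∈ subwords W

theorem IsSub.factor {X Y Z : List α} (h : IsSub W (X ++ Y ++ Z)) : IsSub W Y := by
  simp only [IsSub, word, FreeMonoid.ofList_append] at h
  exact (subwords_of_mul (subwords_of_mul h).1).2

theorem LSat.flatMap_eq {u v : List α} (h : LSat (SMonoid W) u v) (f : α → List α)
    (hu : IsSub W (u.flatMap f)) : v.flatMap f = u.flatMap f := by
  have h1 := h ((reesCon W).mk'.comp (FreeMonoid.lift fun a => word (f a)))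
  simp only [MonoidHom.comp_apply, lift_word] at h1
  rcases (reesCon W).eq.1 h1 with h2 | h2
  · exact (FreeMonoid.ofList.injective h2).symm
  · exact absurd hu h2.1

/-- Every homomorphism into S(W) lifts to a substitution of words, and two words are congruent when
they are equal or both outside the set of subwords. -/
theorem lsat_of_flatMap_eq {u v : List α}
    (h : ∀ f : α → List α, IsSub W (u.flatMap f) → v.flatMap f = u.flatMap f)
    (h' : ∀ f : α → List α, IsSub W (v.flatMap f) → u.flatMap f = v.flatMap f) :
    LSat (SMonoid W) u v := fun φ => by
  have hsurj : ∀ a, ∃ l : List α, (reesCon W).mk' (word l) = φ (FreeMonoid.of a) := fun a => by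
    obtain ⟨m, hm⟩ := (reesCon W).mk'_surjective (φ (FreeMonoid.of a))
    exact ⟨FreeMonoid.toList m, hm⟩
  choose f hf using hsurj
  have hφ : φ = (reesCon W).mk'.comp (FreeMonoid.lift fun a => word (f a)) :=
    FreeMonoid.hom_eq fun a => by
      rw [MonoidHom.comp_apply, FreeMonoid.lift_eval_of, hf]
  rw [hφ]
  simp only [MonoidHom.comp_apply, lift_word]
  refine (reesCon W).eq.2 ?_
  by_cases hu : IsSub W (u.flatMap f)
  · exact Or.inl (by rw [h f hu])
  by_cases hv : IsSub W (v.flatMap f)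
  · exact Or.inl (by rw [h' f hv])
  · exact Or.inr ⟨hu, hv⟩

theorem IsSub.iso {u : List α} (h : IsSub W u) : Iso (SMonoid W) u := fun v hv => by
  have := hv.flatMap_eq (fun a => [a]) (by simpa using h)
  simpa using this.symm

theorem isoterm_of_prec {I : Set (FreeMonoid α)} (h : Prec W I) {l : List α} (hl : word l ∈ I) :
    Iso (SMonoid W) l :=
  h (SMonoid W) (fun w hw => IsSub.iso (u := FreeMonoid.toList w)
    ⟨w, hw, 1, 1, by simp⟩) _ hl

/-- Let `n` be an isoterm for S(W), and let `S` be a monoid for which all words of `W` are isoterms.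
Under any substitution, an identity n ≈ v of `S` either fixes a subword of `W` or relates two words
outside that set. So n ≈ v holds in S(W), and n = v. -/
theorem not_iso_of_not_prec {n : List α} (h : ¬ Prec W {word n}) : ¬ Iso (SMonoid W) n := by
  intro hn
  refine h fun S _ hS w hw => ?_
  rw [Set.mem_singleton_iff] at hw
  subst hw
  have key : ∀ m m' : List α, LSat S m m' → IsSub W m → m' = m := by
    rintro m m' hm ⟨w, hw, p, s, rfl⟩
    have := hS _ hw (p * word m' * s) fun φ => by
      simp only [map_mul]
      rw [hm φ]
    have := mul_left_cancel (mul_right_cancel this)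
    exact (FreeMonoid.ofList.injective this).symm
  intro v hv
  have := hn (FreeMonoid.toList v) (lsat_of_flatMap_eq
    (fun f hf => key _ _ (LSat.flatMap (v := FreeMonoid.toList v) hv f) hf)
    (fun f hf => key _ _ (LSat.flatMap (v := FreeMonoid.toList v) hv f).symm hf))
  rw [this]
  rfl

theorem exists_maximal_prefix {β : Type*} (P : β → Prop) (l : List β) :
    ∃ l₁ l₂, l = l₁ ++ l₂ ∧ (∀ a ∈ l₁, P a) ∧ ∀ a ∈ l₂.head?, ¬ P a := by
  induction l with
  | nil => exact ⟨[], [], by simp⟩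
  | cons b l ih =>
    by_cases hb : P b
    · obtain ⟨l₁, l₂, rfl, h1, h2⟩ := ih
      exact ⟨b :: l₁, l₂, rfl, by simpa [hb] using h1, h2⟩
    · exact ⟨[], b :: l, rfl, by simp, by simpa using hb⟩

/-- A subword without linear letters of a block-`n`-simple word involves at most `n` letters. -/
theorem IsSub.card_le [DecidableEq α] {n : ℕ} (hW : ∀ w ∈ W, BlockSimple n w) {z : List α}
    (hz : IsSub W z) (h2 : ∀ a ∈ z, 2 ≤ z.count a) : z.toFinset.card ≤ n := by
  obtain ⟨w, hw, p, s, hws⟩ := hz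
  have hnl : ∀ a ∈ z, ¬ IsLinear a w := fun a ha hlin => by
    have h1 := h2 a ha
    simp only [IsLinear, occ, hws, FreeMonoid.toList_mul, List.count_append, word,
      FreeMonoid.toList_ofList] at hlin
    omega
  -- `z` is enlarged on both sides by non-linear letters as far as possible; the result is a block
  -- containing `z`.
  obtain ⟨p₁, p₂, hp, hp1, hp2⟩ := exists_maximal_prefix (fun a => ¬ IsLinear a w)
    (FreeMonoid.toList p).reverse
  obtain ⟨s₁, s₂, hs, hs1, hs2⟩ := exists_maximal_prefix (fun a => ¬ IsLinear a w)
    (FreeMonoid.toList s)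
  have hp' : FreeMonoid.toList p = p₂.reverse ++ p₁.reverse := by
    rw [← List.reverse_append, ← hp, List.reverse_reverse]
  have hblock : IsBlock (word (p₁.reverse ++ z ++ s₁)) w := by
    refine ⟨word p₂.reverse, word s₂, ?_, ?_, ?_, ?_⟩
    · apply FreeMonoid.toList.injective
      simp [hws, hp', hs]
    · intro a ha
      simp only [FreeMonoid.toList_ofList, List.mem_append, List.mem_reverse] at ha
      rcases ha with (ha | ha) | ha
      · exact hp1 a ha
      · exact hnl a ha
      · exact hs1 a ha
    · intro a ha
      simpa using hp2 a (by simpa using ha)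
    · intro a ha
      simpa using hs2 a (by simpa using ha)
  refine le_trans (Finset.card_le_card fun a ha => ?_) (hW w hw _ hblock)
  simp only [List.mem_toFinset, FreeMonoid.toList_ofList, List.mem_append] at ha ⊢
  tauto

end Rees

/-! ### Almost linear isoterms and the number of occurrences of a letter -/

section Content

variable {α : Type u} [DecidableEq α] {S : Type v} [Monoid S]

theorem iso_of_content (h1 : ∀ a : α, Iso S [a]) {u : List α}
    (h : ∀ v, LSat S u v → (∀ a ∈ v, a ∈ u) → u = v) : Iso S u := fun v hv =>
  h v hv fun a ha => by
    by_contra hau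
    have h0 := List.count_eq_zero_of_not_mem hau
    have := count_eq_of_count_le_one hv (h1 a) (by omega)
    have := List.count_pos_iff.2 ha
    omega

theorem Iso.of_nodup (h1 : ∀ a : α, Iso S [a]) (h2 : ∀ a b : α, a ≠ b → Iso S [a, b])
    {u : List α} (hu : u.Nodup) : Iso S u := fun v hv => by
  have hle := List.nodup_iff_count_le_one.1 hu
  refine (Iso.eq_of_res hv h1 (fun x => Or.inl (hle x)) fun X₀ p q X₁ hs hpq =>
    ⟨[p, q], by simp, by simp, Or.inl (iso_res_of_linear (h2 p q hpq) hs ?_ ?_)⟩).symm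
  · exact List.count_eq_one_of_mem hu (by simp [hs])
  · exact List.count_eq_one_of_mem hu (by simp [hs])

theorem flatMap_res {P : List α} {f : α → List α} {l : List α}
    (h : ∀ a ∈ l, a ∉ P → f a = []) : (res P l).flatMap f = l.flatMap f := by
  induction l with
  | nil => rfl
  | cons a l ih =>
    have ih := ih fun b hb => h b (List.mem_cons_of_mem _ hb)
    by_cases ha : a ∈ P
    · simp [res_cons_of_mem ha, ih]
    · simp [res_cons_of_not_mem ha, ih, h a (by simp) ha]

/-- Decoding from the left: an image of `x` is recognised by the leading letter `a`, which no image
of a letter of `T` contains; which letter of `T` comes next is known from the common restriction to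
`T`. -/
theorem eq_of_flatMap_eq {x a : α} {T : List α} {f : α → List α} (hx : f x = [a]) (hxT : x ∉ T)
    (hT : ∀ t ∈ T, f t ≠ [] ∧ a ∉ f t) {u v : List α} (hu : ∀ b ∈ u, b = x ∨ b ∈ T)
    (hv : ∀ b ∈ v, b = x ∨ b ∈ T) (hres : res T u = res T v)
    (h : u.flatMap f = v.flatMap f) : u = v := by
  have hne : ∀ b, b = x ∨ b ∈ T → f b ≠ [] := by
    rintro b (rfl | hb)
    · simp [hx]
    · exact (hT b hb).1
  have hhead : ∀ t ∈ T, ∀ l l' : List α, f t ++ l ≠ a :: l' := by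
    intro t ht l l' h
    obtain ⟨h1, h2⟩ := hT t ht
    obtain ⟨b, m, hb⟩ := List.exists_cons_of_ne_nil h1
    rw [hb] at h h2
    simp only [List.cons_append, List.cons.injEq] at h
    exact h2 (by simp [h.1])
  induction u generalizing v with
  | nil =>
    cases v with
    | nil => rfl
    | cons b v =>
      simp only [List.flatMap_nil, List.flatMap_cons] at h
      exact absurd (List.append_eq_nil_iff.1 h.symm).1 (hne b (hv b (by simp)))
  | cons c u ih =>
    cases v with
    | nil =>
      simp only [List.flatMap_nil, List.flatMap_cons] at h
      exact absurd (List.append_eq_nil_iff.1 h).1 (hne c (hu c (by simp)))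
    | cons b v =>
      have hu' : ∀ b ∈ u, b = x ∨ b ∈ T := fun b hb => hu b (by simp [hb])
      have hv' : ∀ b ∈ v, b = x ∨ b ∈ T := fun b hb => hv b (by simp [hb])
      rw [List.flatMap_cons, List.flatMap_cons] at h
      rcases hu c (by simp) with rfl | hc <;> rcases hv b (by simp) with rfl | hb
      · rw [res_cons_of_not_mem hxT, res_cons_of_not_mem hxT] at hres
        rw [ih hu' hv' hres (List.append_cancel_left h)]
      · rw [hx] at h
        exact absurd h.symm (hhead b hb _ _)
      · rw [hx] at h
        exact absurd h (hhead c hc _ _)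
      · rw [res_cons_of_mem hc, res_cons_of_mem hb, List.cons.injEq] at hres
        obtain ⟨rfl, hres⟩ := hres
        rw [ih hu' hv' hres (List.append_cancel_left h)]

theorem count_mul_add_le (f : α → List α) {x y : α} (hxy : x ≠ y) (a : α) (s : List α) :
    s.count x * (f x).count a + s.count y * (f y).count a ≤ (s.flatMap f).count a := by
  induction s with
  | nil => simp
  | cons b s ih =>
    rw [List.flatMap_cons, List.count_append, List.count_cons, List.count_cons]
    by_cases h : b = x
    · subst h
      simp [hxy]
      linarith
    · by_cases h' : b = y
      · subst h'
        simp [h]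
        linarith
      · simp [h, h']
        linarith

theorem two_le_count_flatMap {f : α → List α} {U : List α} (hU : ∀ a ∈ U, 2 ≤ U.count a) :
    ∀ a ∈ U.flatMap f, 2 ≤ (U.flatMap f).count a := by
  intro a ha
  obtain ⟨x, hx, hax⟩ := List.mem_flatMap.1 ha
  have h1 := count_mul_count_le f x a U
  have h2 := hU x hx
  have h3 := List.count_pos_iff.2 hax
  nlinarith

/-- Letters occur at most three times in the subwords of `W` if no word of `A₄` is an isoterm. -/
theorem IsSub.count_le_three {W : Set (FreeMonoid α)} {x t₁ t₂ t₃ : α}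
    (hl : [x, t₁, t₂, t₃].Nodup)
    (h1 : ∀ a : α, Iso (SMonoid W) [a]) (h2 : ∀ a b : α, a ≠ b → Iso (SMonoid W) [a, b])
    (hA : ∀ l : List α, word l ∈ almostLinearWords α 4 → ¬ Iso (SMonoid W) l) {z : List α}
    (hz : IsSub W z) (a : α) : z.count a ≤ 3 := by
  by_contra! hcount
  obtain ⟨X, z₁, rfl, hX⟩ := List.eq_append_cons_of_mem (List.count_pos_iff.1 (by omega) : a ∈ z)
  simp [List.count_eq_zero_of_not_mem hX] at hcount
  obtain ⟨w₁, z₂, rfl, hw1⟩ := List.eq_append_cons_of_mem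
    (List.count_pos_iff.1 (by omega) : a ∈ z₁)
  simp [List.count_eq_zero_of_not_mem hw1] at hcount
  obtain ⟨w₂, z₃, rfl, hw2⟩ := List.eq_append_cons_of_mem
    (List.count_pos_iff.1 (by omega) : a ∈ z₂)
  simp [List.count_eq_zero_of_not_mem hw2] at hcount
  obtain ⟨w₃, z₄, rfl, hw3⟩ := List.eq_append_cons_of_mem hcount
  have hsub : IsSub W (a :: (w₁ ++ a :: (w₂ ++ a :: (w₃ ++ [a])))) :=
    IsSub.factor (X := X) (Z := z₄) (by simpa using hz)
  simp only [List.nodup_cons, List.mem_cons, List.not_mem_nil, or_false, not_or,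
    List.nodup_nil, and_true, not_false_iff] at hl
  obtain ⟨⟨hx1, hx2, hx3⟩, ⟨h12, h13⟩, h23⟩ := hl
  have n1 := Ne.symm hx1
  have n2 := Ne.symm hx2
  have n3 := Ne.symm hx3
  have n12 := Ne.symm h12
  have n13 := Ne.symm h13
  have n23 := Ne.symm h23
  -- A subword a w₁ a w₂ a w₃ a is the image of x t₁ x t₂ x t₃ x. Dropping each tᵢ with wᵢ empty
  -- gives a word `u` of A₄. It is shown to be an isoterm: the order of the linear letters is fixed
  -- by the isoterms of length two, and the positions of `x` are read off from the image.
  let f : α → List α := fun b => if b = x then [a] else if b = t₁ then w₁ else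
    if b = t₂ then w₂ else w₃
  have fx : f x = [a] := by simp [f]
  have f1 : f t₁ = w₁ := by simp [f, n1]
  have f2 : f t₂ = w₂ := by simp [f, n2, n12]
  have f3 : f t₃ = w₃ := by simp [f, n3, n13, n23]
  let T : List α := [t₁, t₂, t₃].filter fun b => !(f b).isEmpty
  let u : List α := ([x, t₁, x, t₂, x, t₃, x]).filter fun b => !(f b).isEmpty
  have huf : u.flatMap f = a :: (w₁ ++ a :: (w₂ ++ a :: (w₃ ++ [a]))) := by
    simp only [u, flatMap_filter_ne_nil]
    simp [fx, f1, f2, f3]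
  have hcx : u.count x = 4 := by
    simp [u, List.count_filter, fx, n1, n2, n3]
  have hc : ∀ b, b ≠ x → u.count b ≤ 1 := fun b hb => by
    refine (List.Sublist.count_le b List.filter_sublist).trans ?_
    have : ([t₁, t₂, t₃]).count b ≤ 1 := List.nodup_iff_count_le_one.1 (by simp [*]) b
    simpa [List.count_cons, Ne.symm hb] using this
  have hxT : x ∉ T := by simp [T, hx1, hx2, hx3]
  have hmem : ∀ b ∈ u, b = x ∨ b ∈ T := by
    intro b hb
    simp only [u, T, List.mem_filter, List.mem_cons, List.not_mem_nil, or_false] at hb ⊢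
    tauto
  have hT : ∀ t ∈ T, f t ≠ [] ∧ a ∉ f t := by
    intro t ht
    obtain ⟨ht, hne⟩ := List.mem_filter.1 ht
    refine ⟨by simpa using hne, ?_⟩
    simp only [List.mem_cons, List.not_mem_nil, or_false] at ht
    rcases ht with rfl | rfl | rfl
    · rwa [f1]
    · rwa [f2]
    · rwa [f3]
  refine hA u ⟨?_, ⟨x, hcx⟩, ?_⟩ ?_
  · have key : ∀ b, IsNonlinear b (word u) → b = x := fun b hb => by
      by_contra hbx
      exact absurd (hc b hbx) (by simpa [IsNonlinear, occ] using hb)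
    intro b c hb hc'
    rw [key b hb, key c hc']
  · refine (Set.ncard_le_ncard (t := (([t₁, t₂, t₃].toFinset : Finset α) : Set α)) ?_
      (Finset.finite_toSet _)).trans ?_
    · intro b hb
      have hb1 : u.count b = 1 := hb
      have hbu := List.count_pos_iff.1 (by omega : 0 < u.count b)
      rcases hmem b hbu with rfl | hbT
      · omega
      · simpa using (List.mem_filter.1 hbT).1
    · rw [Set.ncard_coe_finset]
      exact (List.toFinset_card_le _).trans (by simp)
  · refine iso_of_content h1 fun v hv hvu => ?_
    have hresu : (res T u).Nodup := by
      rw [List.nodup_iff_count_le_one]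
      intro b
      by_cases hb : b ∈ T
      · rw [count_res hb]
        exact hc b fun e => hxT (e ▸ hb)
      · rw [List.count_eq_zero_of_not_mem fun h => hb (mem_of_mem_res h)]
        exact zero_le_one
    exact eq_of_flatMap_eq fx hxT hT hmem (fun b hb => hmem b (hvu b hb))
      (Iso.of_nodup h1 h2 hresu _ (hv.res T)) (hv.flatMap_eq f (by rwa [huf])).symm

end Content

section Replicate

variable {α : Type u}

theorem exists_replicate_append {z : List α} {a b : α} (hz : ∀ c ∈ z, c = a ∨ c = b)
    (hb : b ∈ z) : ∃ i r, z = List.replicate i a ++ b :: r := by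
  obtain ⟨X, Y, rfl, hX⟩ := List.eq_append_cons_of_mem hb
  refine ⟨X.length, Y, ?_⟩
  rw [← List.eq_replicate_of_mem (a := a) fun c hc =>
    (hz c (by simp [hc])).resolve_right fun e => hX (e ▸ hc)]

theorem eq_of_perm_of_forall_eq {z z' : List α} (hp : z.Perm z')
    (h : ∀ a ∈ z, ∀ b ∈ z, a = b) : z = z' := by
  cases z with
  | nil => exact (List.nil_perm.1 hp).symm
  | cons a z =>
    have h1 := List.eq_replicate_of_mem fun b hb => h b hb a (by simp)
    have h2 := List.eq_replicate_of_mem fun b hb => h b (hp.mem_iff.2 hb) a (by simp)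
    rw [h1, h2, hp.length_eq]

end Replicate

/-! ### Why U ≈ V holds: images with at most two letters -/

section Identities

variable {α : Type u} [DecidableEq α]

/-- A letter used twice inside one image, or shared by two images, would occur four times in the
image of `U`. Images are therefore repetition-free and disjoint. With at most two letters in total,
either a single letter of `U` survives, or exactly two do, each sent to one letter, and then `hpair`
decides. -/
theorem flatMap_eq_of_res_pair {U V : List α} {F : List α → Prop}
    (hcard : ∀ z, F z → (∀ a ∈ z, 2 ≤ z.count a) → z.toFinset.card ≤ 2)
    (hle : ∀ z a, F z → z.count a ≤ 3) (hU : ∀ a ∈ U, U.count a = 2) (hUV : U.Perm V)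
    (hpair : ∀ y z, y ≠ z → y ∈ U → z ∈ U → res [y, z] U = res [y, z] V ∨
      ∀ (f : α → List α) (a b : α), a ≠ b → f y = [a] → f z = [b] →
        ¬ F ((res [y, z] U).flatMap f)) {f : α → List α} (hF : F (U.flatMap f)) :
    V.flatMap f = U.flatMap f := by
  by_cases h0 : ∀ x ∈ U, f x = []
  · have h1 : ∀ x ∈ V, f x = [] := fun x hx => h0 x (hUV.mem_iff.2 hx)
    rw [List.flatMap_eq_nil_iff.2 h0, List.flatMap_eq_nil_iff.2 h1]
  push Not at h0
  obtain ⟨y, hy, hfy⟩ := h0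
  by_cases h1 : ∀ z ∈ U, z ≠ y → f z = []
  · rw [← flatMap_res (P := [y]) (fun a ha hn => h1 a ha (by simpa using hn)),
      ← flatMap_res (P := [y]) (l := V)
        (fun a ha hn => h1 a (hUV.mem_iff.2 ha) (by simpa using hn)),
      res_singleton, res_singleton, hUV.count_eq]
  push Not at h1
  obtain ⟨z, hz, hzy, hfz⟩ := h1
  have hone : ∀ x ∈ U, ∀ a ∈ f x, (f x).count a = 1 := fun x hx a ha => by
    have h1 := count_mul_count_le f x a U
    have h2 := hle _ a hF
    have h3 := List.count_pos_iff.2 ha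
    rw [hU x hx] at h1
    omega
  have hdisj : ∀ x ∈ U, ∀ x' ∈ U, x ≠ x' → ∀ a ∈ f x, a ∉ f x' := fun x hx x' hx' hne a ha ha' => by
    have h1 := count_mul_add_le f hne a U
    have h2 := hle _ a hF
    have h3 := List.count_pos_iff.2 ha
    have h4 := List.count_pos_iff.2 ha'
    rw [hU x hx, hU x' hx'] at h1
    omega
  obtain ⟨a, la, hfa⟩ := List.exists_cons_of_ne_nil hfy
  obtain ⟨b, lb, hfb⟩ := List.exists_cons_of_ne_nil hfz
  have hay : a ∈ f y := by simp [hfa]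
  have hbz : b ∈ f z := by simp [hfb]
  have hab : a ≠ b := fun e => hdisj y hy z hz hzy.symm a hay (e ▸ hbz)
  have hletters : ∀ x ∈ U, ∀ c ∈ f x, c = a ∨ c = b := by
    intro x hx c hc
    by_contra! hcon
    have h1 := hcard _ hF (two_le_count_flatMap fun a ha => (hU a ha).ge)
    have h2 : ({a, b, c} : Finset α) ⊆ (U.flatMap f).toFinset := by
      intro d hd
      simp only [Finset.mem_insert, Finset.mem_singleton] at hd
      rw [List.mem_toFinset, List.mem_flatMap]
      rcases hd with rfl | rfl | rfl
      · exact ⟨y, hy, hay⟩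
      · exact ⟨z, hz, hbz⟩
      · exact ⟨x, hx, hc⟩
    have h3 := Finset.card_le_card h2
    rw [Finset.card_eq_three.2 ⟨a, b, c, hab, hcon.1.symm, hcon.2.symm, rfl⟩] at h3
    omega
  have hsingle : ∀ x ∈ U, ∀ c ∈ f x, (∀ d ∈ f x, d = c) → f x = [c] := by
    intro x hx c hc hall
    have h1 := List.eq_replicate_of_mem hall
    have h2 := hone x hx c hc
    rw [h1, List.count_replicate_self] at h2
    rw [h1, h2]
    rfl
  have hya : f y = [a] := hsingle y hy a hay fun d hd => by
    rcases hletters y hy d hd with rfl | rfl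
    · rfl
    · exact absurd hbz (hdisj y hy z hz hzy.symm d hd)
  have hzb : f z = [b] := hsingle z hz b hbz fun d hd => by
    rcases hletters z hz d hd with rfl | rfl
    · exact absurd hay (hdisj z hz y hy hzy d hd)
    · rfl
  have hrest : ∀ x ∈ U, x ∉ [y, z] → f x = [] := by
    intro x hx hn
    simp only [List.mem_cons, List.not_mem_nil, or_false, not_or] at hn
    refine List.eq_nil_iff_forall_not_mem.2 fun c hc => ?_
    rcases hletters x hx c hc with rfl | rfl
    · exact hdisj x hx y hy hn.1 c hc hay
    · exact hdisj x hx z hz hn.2 c hc hbz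
  have hUr := flatMap_res (P := [y, z]) hrest
  have hVr := flatMap_res (P := [y, z]) (l := V) fun x hx => hrest x (hUV.mem_iff.2 hx)
  rcases hpair y z hzy.symm hy hz with h | h
  · rw [← hUr, ← hVr, h]
  · exact absurd (hUr ▸ hF) (h f a b hab hya hzb)

theorem res_pair_of_nodup {A : List α} (hA : A.Nodup) {y z : α} (hyz : y ≠ z) (hy : y ∈ A)
    (hz : z ∈ A) : res [y, z] A = [y, z] ∨ res [y, z] A = [z, y] := by
  have key : ∀ {y z : α} {B : List α}, y ∉ B → z ∉ B → res [y, z] B = [] := fun h1 h2 =>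
    res_eq_nil (by simp [h1, h2])
  obtain ⟨X, Y, rfl⟩ := List.append_of_mem hy
  rw [List.nodup_append, List.nodup_cons] at hA
  obtain ⟨hX, ⟨hyY, hY⟩, hdis⟩ := hA
  have hyX : y ∉ X := fun h => hdis y h y (by simp) rfl
  simp only [List.mem_append, List.mem_cons, hyz.symm, false_or] at hz
  rcases hz with hz | hz
  · have hzY : z ∉ Y := fun h => hdis z hz z (by simp [h]) rfl
    obtain ⟨X₁, X₂, rfl⟩ := List.append_of_mem hz
    rw [List.nodup_append, List.nodup_cons] at hX
    have h1 : z ∉ X₁ := fun h => hX.2.2 z h z (by simp) rfl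
    simp only [List.mem_append, List.mem_cons, not_or] at hyX
    right
    simp [res_append, res_cons_of_mem, key hyX.1 h1, key hyX.2.2 hX.2.1.1, key hyY hzY]
  · have hzX : z ∉ X := fun h => hdis z h z (by simp [hz]) rfl
    obtain ⟨Y₁, Y₂, rfl⟩ := List.append_of_mem hz
    rw [List.nodup_append, List.nodup_cons] at hY
    have h1 : z ∉ Y₁ := fun h => hY.2.2 z h z (by simp) rfl
    simp only [List.mem_append, List.mem_cons, not_or] at hyY
    left
    simp [res_append, res_cons_of_mem, key hyX hzX, key hyY.1 h1, key hyY.2.2 hY.2.1.1]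

theorem res_reverse (P l : List α) : res P l.reverse = (res P l).reverse := by
  simp [res]

/-- On two letters `AB` restricts to `yzyz`, whose image `abab` is excluded, or to a palindrome
`yzzy`, which reversal fixes (up to exchanging y and z). -/
theorem res_pair_reverse {A B : List α} (hA : A.Nodup) (hB : B.Nodup) (hAB : A.Perm B)
    {F : List α → Prop} (hF : ∀ a b : α, a ≠ b → ¬ F [a, b, a, b]) {y z : α} (hyz : y ≠ z)
    (hy : y ∈ A) (hz : z ∈ A) :
    res [y, z] (A ++ B) = res [y, z] (A ++ B).reverse ∨
      ∀ (f : α → List α) (a b : α), a ≠ b → f y = [a] → f z = [b] →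
        ¬ F ((res [y, z] (A ++ B)).flatMap f) := by
  rw [res_reverse, res_append]
  rcases res_pair_of_nodup hA hyz hy hz with h1 | h1 <;>
    rcases res_pair_of_nodup hB hyz (hAB.mem_iff.1 hy) (hAB.mem_iff.1 hz) with h2 | h2 <;>
    rw [h1, h2]
  · right
    intro f a b hab hfy hfz
    simpa [hfy, hfz] using hF a b hab
  · left; rfl
  · left; rfl
  · right
    intro f a b hab hfy hfz
    simpa [hfy, hfz] using hF b a hab.symm

theorem res_palindrome {A : List α} (hA : A.Nodup) {y : α} (hy : y ∈ A) {z : α} (hz : z ∉ A) :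
    res [y, z] (A ++ A.reverse) = [y, y] := by
  have h : res [y, z] A = [y] := by
    have : res [y, z] A = res [y] A := by
      refine List.filter_congr fun a ha => ?_
      have : a ≠ z := fun e => hz (e ▸ ha)
      simp [this]
    rw [this, res_singleton, List.count_eq_one_of_mem hA hy]
    rfl
  rw [res_append, res_reverse, h]
  rfl

theorem res_comm (y z : α) (l : List α) : res [y, z] l = res [z, y] l :=
  List.filter_congr fun a _ => by simp [or_comm]

/-- Two letters of the same palindrome do not notice the exchange; letters of different palindromes
give `yyzz` or `zzyy`, whose images are excluded. -/
theorem res_pair_swap {A B : List α} (hA : A.Nodup) (hB : B.Nodup) (hAB : ∀ a ∈ A, a ∉ B)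
    {F : List α → Prop} (hF : ∀ a b : α, a ≠ b → ¬ F [a, a, b, b]) {y z : α}
    (hy : y ∈ A ∨ y ∈ B) (hz : z ∈ A ∨ z ∈ B) :
    res [y, z] ((A ++ A.reverse) ++ (B ++ B.reverse)) =
        res [y, z] ((B ++ B.reverse) ++ (A ++ A.reverse)) ∨
      ∀ (f : α → List α) (a b : α), a ≠ b → f y = [a] → f z = [b] →
        ¬ F ((res [y, z] ((A ++ A.reverse) ++ (B ++ B.reverse))).flatMap f) := by
  rw [res_append, res_append _ (B ++ B.reverse)]
  rcases hy with hy | hy <;> rcases hz with hz | hz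
  · left
    have : res [y, z] (B ++ B.reverse) = [] := res_eq_nil (by simp [hAB y hy, hAB z hz])
    simp [this]
  · right
    intro f a b hab hfy hfz
    rw [res_palindrome hA hy fun h => hAB z h hz, res_comm, res_palindrome hB hz (hAB y hy)]
    simpa [hfy, hfz] using hF a b hab
  · right
    intro f a b hab hfy hfz
    rw [res_palindrome hB hy (hAB z hz), res_comm, res_palindrome hA hz fun h => hAB y h hy]
    simpa [hfy, hfz] using hF b a hab.symm
  · left
    have : res [y, z] (A ++ A.reverse) = [] :=
      res_eq_nil (by simp [show y ∉ A from fun h => hAB y h hy, show z ∉ A from fun h => hAB z h hz])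
    simp [this]

theorem exists_two_letters {z : List α} (hcard : z.toFinset.card ≤ 2) {a b : α} (ha : a ∈ z)
    (hb : b ∈ z) (hab : a ≠ b) : ∀ c ∈ z, c = a ∨ c = b := by
  intro c hc
  by_contra! hcon
  have h2 : ({a, b, c} : Finset α) ⊆ z.toFinset := by
    intro d hd
    simp only [Finset.mem_insert, Finset.mem_singleton] at hd
    rw [List.mem_toFinset]
    rcases hd with rfl | rfl | rfl <;> assumption
  have h3 := Finset.card_le_card h2
  rw [Finset.card_eq_three.2 ⟨a, b, c, hab, hcon.1.symm, hcon.2.symm, rfl⟩] at h3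
  omega

/-- Suppose two letters occur, the word starts with `c`, and `d` is the other letter. A start
`cc…cd` with a later `d` is excluded by `h₁`. Otherwise the word starts with `cd`: then `cdd…dc` is
excluded by `hpow`, and `cdc` with a later `d` by `h₂`. -/
theorem eq_of_mem_of_swap {F : List α → Prop} (hfac : ∀ X Y Z, F (X ++ Y ++ Z) → F Y)
    (hpow : ∀ (a b : α) (m : ℕ), a ≠ b → 1 < m → ¬ F (a :: (List.replicate m b ++ [a])))
    (h₁ : ∀ (a b : α) (X Y : List α), a ≠ b → ¬ F (a :: (X ++ a :: b :: (Y ++ [b]))))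
    (h₂ : ∀ (a b : α) (X Y : List α), a ≠ b → ¬ F (a :: (X ++ b :: a :: (Y ++ [b]))))
    {z : List α} (hz : F z) (hcard : z.toFinset.card ≤ 2) (hcount : ∀ a ∈ z, 2 ≤ z.count a)
    {a b : α} (ha : a ∈ z) (hb : b ∈ z) : a = b := by
  by_contra hab
  obtain ⟨c, z', rfl⟩ : ∃ c z', z = c :: z' := by
    cases z with
    | nil => simp at ha
    | cons c z' => exact ⟨c, z', rfl⟩
  obtain ⟨d, hd, hcd⟩ : ∃ d ∈ c :: z', d ≠ c := by
    by_cases h : a = c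
    · exact ⟨b, hb, fun e => hab (h.trans e.symm)⟩
    · exact ⟨a, ha, h⟩
  have hlet := exists_two_letters hcard (List.mem_cons_self (a := c) (l := z')) hd hcd.symm
  have hd' : d ∈ z' := by simpa [hcd] using hd
  obtain ⟨i, r, rfl⟩ := exists_replicate_append (fun x hx => hlet x (by simp [hx])) hd'
  have hdc : c ≠ d := hcd.symm
  have h2d := hcount d hd
  have hdr : d ∈ r := by
    simp [List.count_replicate, hdc] at h2d
    exact h2d
  obtain ⟨r₁, r₂, rfl⟩ := List.append_of_mem hdr
  rcases i with _ | i
  · have h2c := hcount c (by simp)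
    have hcr : c ∈ r₁ ++ d :: r₂ := by
      simp [hcd] at h2c ⊢
      by_contra! hcon
      simp [List.count_eq_zero_of_not_mem hcon.1] at h2c
      exact hcon.2.2 h2c
    obtain ⟨j, r', hr'⟩ := exists_replicate_append (a := d) (b := c)
      (fun x hx => (hlet x (by simp at hx ⊢; tauto)).symm) hcr
    rcases j with _ | j
    · simp only [List.replicate_zero, List.nil_append] at hr'
      have hdr' : d ∈ r' := by
        have : d ∈ c :: r' := hr' ▸ hdr
        simpa [hcd] using this
      obtain ⟨Y, Z, rfl⟩ := List.append_of_mem hdr'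
      refine h₂ c d [] Y hdc (hfac [] _ Z ?_)
      rw [hr'] at hz
      simpa using hz
    · refine hpow c d (j + 2) hdc (by omega) (hfac [] _ r' ?_)
      rw [hr'] at hz
      simpa [List.replicate_succ] using hz
  · refine h₁ c d (List.replicate i c) r₁ hdc (hfac [] _ r₂ ?_)
    rw [List.replicate_succ'] at hz
    simpa using hz

/-- If two letters occur, the exclusion of abᵐa with m > 1 makes the letters alternate after the
initial run of `a` for as long as both letters are known to occur later. Since each half contains
both letters, a first half longer than `ab` would produce `ababa` or another excluded factor, so
both halves are `ab`. -/
theorem eq_of_halves {F : List α → Prop} (hfac : ∀ X Y Z, F (X ++ Y ++ Z) → F Y)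
    (hpow : ∀ (a b : α) (m : ℕ), a ≠ b → 1 < m → ¬ F (a :: (List.replicate m b ++ [a])))
    (halt : ∀ a b : α, a ≠ b → ¬ F [a, b, a, b, a]) {z₁ z₂ : List α} (hp : z₁.Perm z₂)
    (hz : F (z₁ ++ z₂)) (hcard : (z₁ ++ z₂).toFinset.card ≤ 2) : z₁ = z₂ := by
  by_cases hall : ∀ a ∈ z₁, ∀ b ∈ z₁, a = b
  · exact eq_of_perm_of_forall_eq hp hall
  push Not at hall
  obtain ⟨x, hx, y, hy, hxy⟩ := hall
  obtain ⟨a, z', rfl⟩ : ∃ c z', z₁ = c :: z' := by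
    cases z₁ with
    | nil => simp at hx
    | cons c z' => exact ⟨c, z', rfl⟩
  obtain ⟨b, hb, hba⟩ : ∃ d ∈ a :: z', d ≠ a := by
    by_cases h : x = a
    · exact ⟨y, hy, fun e => hxy (h.trans e.symm)⟩
    · exact ⟨x, hx, h⟩
  have hab : a ≠ b := hba.symm
  have hlet := exists_two_letters hcard (a := a) (b := b) (by simp) (List.mem_append_left _ hb) hab
  have hlet2 : ∀ c ∈ z₂, c = a ∨ c = b := fun c hc => hlet c (by simp [hc])
  have hlet2' : ∀ c ∈ z₂, c = b ∨ c = a := fun c hc => (hlet2 c hc).symm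
  have ha2 : a ∈ z₂ := hp.mem_iff.1 (by simp)
  have hb2 : b ∈ z₂ := hp.mem_iff.1 hb
  have hb' : b ∈ z' := by simpa [hba] using hb
  obtain ⟨i, r₁, rfl⟩ := exists_replicate_append (fun c hc => hlet c (by simp [hc])) hb'
  have hlet1 : ∀ c ∈ r₁, c = a ∨ c = b := fun c hc => hlet c (by simp [hc])
  -- the letter after the first `b` is `a`
  have step : ∀ r, r = r₁ ++ z₂ → ∃ r', r = a :: r' := by
    intro r hr
    obtain ⟨j, r', h⟩ := exists_replicate_append (a := b) (b := a) (z := r)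
      (fun c hc => by
        rw [hr, List.mem_append] at hc
        exact hc.elim (fun h => (hlet1 c h).symm) (hlet2' c)) (by simp [hr, ha2])
    rcases j with _ | j
    · exact ⟨r', h⟩
    · refine absurd (hfac (List.replicate i a) _ r' ?_) (hpow a b (j + 2) hab (by omega))
      rw [hr] at h
      have : a :: (List.replicate i a ++ b :: r₁) ++ z₂ =
        a :: (List.replicate i a ++ b :: (r₁ ++ z₂)) := by simp
      rw [this, h, ← List.cons_append, ← List.replicate_succ, List.replicate_succ'] at hz
      simpa [List.replicate_succ] using hz
  obtain ⟨r', hr'⟩ := step _ rfl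
  rcases r₁ with _ | ⟨c, r₁'⟩
  · simp only [List.nil_append] at hr'
    -- Here the first half is aⁱ⁺¹b. The second must begin with `ab`, and by counting it is abaⁱ. If
    -- i > 0 the product contains `ababa`.
    subst hr'
    have hb3 : b ∈ r' := by simpa [hba] using hb2
    obtain ⟨p, q, rfl⟩ := exists_replicate_append
      (fun c hc => hlet2 c (by simp [hc])) hb3
    rcases p with _ | p
    · have hcb := hp.count_eq b
      have hca := hp.count_eq a
      simp [List.count_replicate, hab, hba] at hcb hca
      have hq : ∀ c ∈ q, c = a := fun c hc =>
        (hlet2 c (by simp [hc])).resolve_right fun e => List.count_eq_zero.1 hcb (e ▸ hc)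
      have hq' := List.eq_replicate_of_mem hq
      rw [hq', List.count_replicate_self] at hca
      rcases i with _ | i
      · rw [hq', ← hca]
        rfl
      · refine absurd (hfac (List.replicate (i + 1) a) _ (List.replicate i a) ?_) (halt a b hab)
        rw [hq', ← hca] at hz
        have : a :: (List.replicate (i + 1) a ++ [b]) = List.replicate (i + 1) a ++ [a, b] := by
          rw [← List.cons_append, ← List.replicate_succ, List.replicate_succ' (n := i + 1)]
          simp
        rw [this] at hz
        simpa [List.replicate_succ] using hz
    · refine absurd (hfac (a :: List.replicate i a) _ q ?_) (hpow b a (p + 2) hba (by omega))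
      simpa [List.replicate_succ] using hz
  · simp only [List.cons_append, List.cons.injEq] at hr'
    obtain ⟨rfl, rfl⟩ := hr'
    -- the next letter is `b`
    obtain ⟨k, r'', hr''⟩ := exists_replicate_append (a := c) (b := b) (z := r₁' ++ z₂)
      (fun d hd => by
        rw [List.mem_append] at hd
        exact hd.elim (fun h => hlet1 d (by simp [h])) (hlet2 d)) (by simp [hb2])
    have hz' : c :: (List.replicate i c ++ b :: c :: r₁') ++ z₂ =
        c :: (List.replicate i c ++ b :: c :: (r₁' ++ z₂)) := by simp
    rcases k with _ | k
    · simp only [List.replicate_zero, List.nil_append] at hr''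
      have hc'' : c ∈ r'' := by
        have : c ∈ r₁' ++ z₂ := by simp [ha2]
        rw [hr''] at this
        simpa [hab] using this
      obtain ⟨l, r3, rfl⟩ := exists_replicate_append (a := b) (b := c) (z := r'')
        (fun d hd => by
          have : d ∈ r₁' ++ z₂ := by simp [hr'', hd]
          rw [List.mem_append] at this
          exact this.elim (fun h => (hlet1 d (by simp [h])).symm) (hlet2' d)) hc''
      rw [hz', hr''] at hz
      rcases l with _ | l
      · refine absurd (hfac (List.replicate i c) _ r3 ?_) (halt c b hab)
        rw [← List.cons_append, ← List.replicate_succ, List.replicate_succ'] at hz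
        simpa using hz
      · refine absurd (hfac (c :: (List.replicate i c ++ [b])) _ r3 ?_)
          (hpow c b (l + 2) hab (by omega))
        simpa [List.replicate_succ] using hz
    · refine absurd (hfac (c :: List.replicate i c) _ r'' ?_) (hpow b c (k + 2) hba (by omega))
      rw [hz', hr''] at hz
      simpa [List.replicate_succ] using hz

end Identities

/-! ### Renaming words of the table to arbitrary letters -/

section Rename

variable {α : Type u} {S : Type v} [Monoid S]

theorem Iso.rename₁ {x a : α} (w : List (Fin 1)) (h : Iso S (w.map ![x])) :
    Iso S (w.map ![a]) :=
  h.rename (l := [0]) (fun b _ => by fin_cases b; simp) (by simp) (by simp)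

theorem Iso.rename₂ {x y a b : α} (w : List (Fin 2)) (hl : x ≠ y) (hl' : a ≠ b)
    (h : Iso S (w.map ![x, y])) : Iso S (w.map ![a, b]) :=
  h.rename (l := [0, 1]) (fun b _ => by fin_cases b <;> simp) (by simpa using hl)
    (by simpa using hl')

theorem Iso.rename₃ {x y z a b c : α} (w : List (Fin 3)) (hl : [x, y, z].Nodup)
    (hl' : [a, b, c].Nodup) (h : Iso S (w.map ![x, y, z])) : Iso S (w.map ![a, b, c]) :=
  h.rename (l := [0, 1, 2]) (fun b _ => by fin_cases b <;> simp) (by simpa using hl)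
    (by simpa using hl')

theorem squareIso_of_nested {x y t₁ t₂ : α} (hl : [x, y, t₁, t₂].Nodup) (h₁ : Iso S [x, t₁, x, y, t₂, y])
    (h₂ : Iso S [x, y, y, x]) : SquareIso α S := by
  have hxy : x ≠ y := by
    simp at hl; tauto
  have hxt : x ≠ t₁ := by
    simp at hl; tauto
  exact
    { one := fun a => Iso.rename₁ (x := x) [0] (Iso.factor (X := []) (Z := [y, y, x]) h₂)
      pair := fun a b hab => Iso.rename₂ [0, 1] hxy hab
        (Iso.factor (X := []) (Z := [y, x]) h₂)
      two := fun a => Iso.rename₁ (x := y) [0, 0] (Iso.factor (X := [x]) (Z := [x]) h₂)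
      right := fun a b hab => Iso.rename₂ (x := y) (y := x) [0, 0, 1] hxy.symm hab
        (Iso.factor (X := [x]) (Z := []) h₂)
      left := fun a b hab => Iso.rename₂ (x := y) (y := x) [1, 0, 0] hxy.symm hab
        (Iso.factor (X := []) (Z := [x]) h₂)
      mid := fun a b hab => Iso.rename₂ [0, 1, 0] hxt hab
        (Iso.factor (X := []) (Z := [y, t₂, y]) h₁) }

end Rename

/-! ### Existence of the words U over the given alphabet -/

section Existence

variable {α : Type u}

theorem doubleWord_ne_swap {M : ℕ} {g : ℕ → ℕ} (hM : 2 ≤ M)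
    (hstep : ∀ k, k + 1 < M → g (k + 1) ≠ g k + 1) :
    doubleWord M g ≠ (List.range M).map g ++ List.range M := by
  intro h
  have h1 := (List.append_inj h (by simp)).1
  have h2 : ∀ k, k < M → g k = k := fun k hk => by
    have := congrArg (fun l => l[k]?) h1
    simpa [hk, eq_comm] using this
  exact hstep 0 (by omega) (by rw [h2 0 (by omega), h2 1 (by omega)])

theorem doubleWord_ne_reverse {M : ℕ} {g : ℕ → ℕ} (hM : 2 ≤ M) (h0 : g 0 = 0)
    (hg : ∀ k l, k < M → l < M → g k = g l → k = l) :
    doubleWord M g ≠ (doubleWord M g).reverse := by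
  intro h
  have h1 : (doubleWord M g)[2 * M - 1]? = some (g (M - 1)) := by
    rw [doubleWord, List.getElem?_append_right (by simp; omega)]
    simp [show 2 * M - 1 - M = M - 1 by omega, show M - 1 < M by omega]
  rw [h, List.getElem?_reverse (by simp [doubleWord]; omega)] at h1
  simp [doubleWord, show M + M - 1 - (2 * M - 1) = 0 by omega, show 0 < M by omega] at h1
  have := hg (M - 1) 0 (by omega) (by omega) (by rw [← h1, h0])
  omega

/-- The words `AB`, where `B` is a permutation of `A` in which equal letters are far apart. -/
theorem exists_separated_word {e : ℕ → α} (he : Function.Injective e) (K : ℕ) :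
    ∃ A B : List α, A.Nodup ∧ B.Nodup ∧ A.Perm B ∧ A ++ B ≠ [] ∧ A ++ B ≠ B ++ A ∧
      A ++ B ≠ (A ++ B).reverse ∧
      (∀ X₀ X₁ X₂ c d, A ++ B ≠ X₀ ++ c :: d :: (X₁ ++ c :: d :: X₂)) ∧
      (∀ X₀ X₁ X₂ c, A ++ B = X₀ ++ c :: (X₁ ++ c :: X₂) → 2 * K + 2 ≤ X₁.length) := by
  -- Any r comfortably above 2K would do; this value makes the estimates below linear. The offset 0
  -- gives g(0) = 0, so the word starts with a letter it does not end with and is not a palindrome.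
  obtain ⟨r, hr⟩ : ∃ r, r = 2 * K + 5 := ⟨_, rfl⟩
  have hr2 : 2 ≤ r := by omega
  have h3 : 5 * r ≤ r * r := by nlinarith
  have hg : ∀ k l, k < r * r - 1 → l < r * r - 1 → affine r 0 k = affine r 0 l → k = l :=
    fun k l => affine_injOn hr2
  have hstep : ∀ k, k + 1 < r * r - 1 → affine r 0 (k + 1) ≠ affine r 0 k + 1 := fun k _ h => by
    rcases affine_succ_far (r := r) (c := 0) (by omega) k with h' | h' <;> omega
  have hfar : ∀ k, k < r * r - 1 → (2 * K + 2) + 1 + affine r 0 k ≤ (r * r - 1) + k := by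
    intro k hk
    -- For large k the position in the second half alone gives the gap; for small k the value g(k) ≤
    -- rk is still small, so the first occurrence is early.
    rcases le_or_gt (2 * K + 2) k with h | h
    · have := affine_lt (c := 0) hr2 k
      omega
    · have h4 : affine r 0 k ≤ r * k := Nat.mod_le _ _
      have h5 : r * (k + 3) ≤ r * r := Nat.mul_le_mul_left _ (by omega)
      nlinarith [Nat.sub_add_cancel (show 1 ≤ r * r by omega)]
  have hperm := (doubleWord_perm hg fun k _ => affine_lt hr2 k).map e
  have hnod : ((List.range (r * r - 1)).map e).Nodup := List.nodup_range.map he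
  have hU : (doubleWord (r * r - 1) (affine r 0)).map e = (List.range (r * r - 1)).map e ++
      ((List.range (r * r - 1)).map (affine r 0)).map e := by simp [doubleWord]
  have hinj := List.map_injective_iff.2 he
  refine ⟨(List.range (r * r - 1)).map e, ((List.range (r * r - 1)).map (affine r 0)).map e,
    hnod, hperm.nodup_iff.2 hnod, hperm.symm, ?_⟩
  rw [← hU]
  refine ⟨fun h => ?_, fun h => ?_, fun h => ?_, norep_map he (doubleWord_norep hg hstep),
    far_map he (doubleWord_far hg hfar)⟩
  · simp [doubleWord] at h
    omega
  · rw [← List.map_append] at h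
    exact doubleWord_ne_swap (by omega) hstep (hinj h)
  · rw [← List.map_reverse] at h
    exact doubleWord_ne_reverse (by omega) (by simp [affine]) hg (hinj h)

theorem exists_crossFar_word {e : ℕ → α} (he : Function.Injective e) (K : ℕ) :
    ∃ A B : List α, A.Nodup ∧ A.Perm B ∧ A ++ B ≠ [] ∧ A ++ B ≠ B ++ A ∧
      (∀ X₀ X₁ X₂ c d, A ++ B ≠ X₀ ++ c :: d :: (X₁ ++ c :: d :: X₂)) ∧
      CrossFar (A ++ B) (2 * K) := by
  obtain ⟨r, hr⟩ : ∃ r, r = 2 * K + 5 := ⟨_, rfl⟩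
  have hr2 : 2 ≤ r := by omega
  have h3 : 5 * r ≤ r * r := by nlinarith
  -- The offset r² − 2 makes g(0) the last number of the first half, so the halves meet in a square.
  obtain ⟨g, hgdef⟩ : ∃ g, g = affine r (r * r - 2) := ⟨_, rfl⟩
  have hg : ∀ k l, k < r * r - 1 → l < r * r - 1 → g k = g l → k = l := by
    subst hgdef
    exact fun k l => affine_injOn hr2
  have hlt : ∀ k, g k < r * r - 1 := by
    subst hgdef
    exact affine_lt hr2
  have hsucc : ∀ k, g (k + 1) = g k + r ∨ g (k + 1) + (r * r - 1) = g k + r := by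
    subst hgdef
    exact affine_succ_far (by omega)
  have h0 : g 0 + 1 = r * r - 1 := by
    rw [hgdef, affine, Nat.mul_zero, Nat.zero_add, Nat.mod_eq_of_lt (by omega)]
    omega
  have hfar : ∀ k l, k < r * r - 1 → l < r * r - 1 → g k + 1 = g l →
      k + 2 * K + 1 < l ∨ l + 2 * K + 1 < k := by
    intro k l hk hl h
    subst hgdef
    rcases affine_far hr2 hk hl h with h' | h' <;> omega
  have hfar' : ∀ k, k + 1 < r * r - 1 →
      g k + 2 * K + 1 < g (k + 1) ∨ g (k + 1) + 2 * K + 1 < g k := by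
    intro k _
    have := hlt k
    rcases hsucc k with h' | h' <;> omega
  have hstep : ∀ k, k + 1 < r * r - 1 → g (k + 1) ≠ g k + 1 := fun k _ h => by
    rcases hsucc k with h' | h' <;> omega
  have hperm := (doubleWord_perm hg fun k _ => hlt k).map e
  have hnod : ((List.range (r * r - 1)).map e).Nodup := List.nodup_range.map he
  have hU : (doubleWord (r * r - 1) g).map e = (List.range (r * r - 1)).map e ++
      ((List.range (r * r - 1)).map g).map e := by simp [doubleWord]
  have hinj := List.map_injective_iff.2 he
  refine ⟨(List.range (r * r - 1)).map e, ((List.range (r * r - 1)).map g).map e,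
    hnod, hperm.symm, ?_⟩
  rw [← hU]
  refine ⟨fun h => ?_, fun h => ?_, norep_map he (doubleWord_norep hg hstep),
    (doubleWord_crossFar hg h0 hfar hfar').map he⟩
  · simp [doubleWord] at h
    omega
  · rw [← List.map_append] at h
    exact doubleWord_ne_swap (by omega) hstep (hinj h)

theorem powerWord_eq (x y : α) (m : ℕ) :
    FreeMonoid.of x * FreeMonoid.of y ^ m * FreeMonoid.of x =
      word (x :: (List.replicate m y ++ [x])) := by
  have : FreeMonoid.of y ^ m = word (List.replicate m y) := by
    induction m with
    | zero => rfl
    | succ m ih => rw [pow_succ', ih, List.replicate_succ]; rfl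
  rw [this]
  rfl

end Existence

/-! ### The four rows of the table -/

section Rows

variable {α : Type u} [DecidableEq α] {S : Type v} [Monoid S] {x y t₁ t₂ : α}

theorem separatedIso_of (hl : [x, y, t₁, t₂].Nodup) (h₁ : Iso S [x, t₁, x, y, t₂, y])
    (h₂ : Iso S [x, y, t₁, x, y]) (h₃ : Iso S [x, y, t₁, y, x]) : SeparatedIso α S := by
  have hl3 : [x, y, t₁].Nodup := by
    simp at hl ⊢; tauto
  have hxy : x ≠ y := by
    simp at hl; tauto
  have hxt : x ≠ t₁ := by
    simp at hl; tauto
  have one : ∀ a : α, Iso S [a] := fun a =>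
    Iso.rename₁ (x := x) [0] (Iso.factor (X := []) (Z := [t₁, x, y, t₂, y]) h₁)
  have right : ∀ a b t : α, [a, b, t].Nodup → Iso S [a, t, a, b] := fun a b t hd =>
    Iso.rename₃ [0, 2, 0, 1] hl3 hd (Iso.factor (X := []) (Z := [t₂, y]) h₁)
  have left : ∀ a b t : α, [a, b, t].Nodup → Iso S [b, a, t, a] := fun a b t hd =>
    Iso.rename₃ (x := x) (y := y) (z := t₁) (a := b) (b := a) (c := t) [0, 1, 2, 1] hl3
      (by simp at hd ⊢; grind) (Iso.factor (X := []) (Z := [x]) h₃)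
  have middle : ∀ a b t t' : α, [a, b, t, t'].Nodup → Iso S [a, t, a, b, t', b] :=
    fun a b t t' hd => Iso.rename₄ [0, 2, 0, 1, 3, 1] hl hd h₁
  exact
    { one := one
      pair := fun a b hab => Iso.rename₂ [0, 1] hxy hab
        (Iso.factor (X := []) (Z := [t₁, x, y]) h₂)
      sep := fun a t hat => Iso.rename₂ [0, 1, 0] hxt hat
        (Iso.factor (X := []) (Z := [y, t₂, y]) h₁)
      right := right
      left := left
      same := fun a b t hd => Iso.rename₃ [0, 1, 2, 0, 1] hl3 hd h₂
      rev := fun a b t hd => Iso.rename₃ [0, 1, 2, 1, 0] hl3 hd h₃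
      middle := middle
      middle' := fun a b t t' hd => Iso.middle_swap hd
        (right a t' t (by simp at hd ⊢; grind)) (left b t t' (by simp at hd ⊢; grind)) one
        (middle a b t t' hd) }

theorem squareIso_of_first_second [Infinite α] (hl : [x, y, t₁].Nodup)
    (h₁ : Iso S [y, x, x, t₁, y]) (h₂ : Iso S [y, t₁, x, x, y]) : SquareIso α S := by
  have hyx : y ≠ x := by
    simp at hl; grind
  have hxt : x ≠ t₁ := by
    simp at hl; tauto
  have one : ∀ a : α, Iso S [a] := fun a =>
    Iso.rename₁ (x := y) [0] (Iso.factor (X := []) (Z := [x, x, t₁, y]) h₁)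
  exact
    { one := one
      pair := fun a b hab => Iso.rename₂ [0, 1] hyx hab
        (Iso.factor (X := []) (Z := [x, t₁, y]) h₁)
      two := fun a => Iso.rename₁ (x := x) [0, 0] (Iso.factor (X := [y]) (Z := [t₁, y]) h₁)
      right := fun a b hab => Iso.rename₂ [0, 0, 1] hxt hab
        (Iso.factor (X := [y]) (Z := [y]) h₁)
      left := fun a b hab => Iso.rename₂ [1, 0, 0] hxt hab
        (Iso.factor (X := [y]) (Z := [y]) h₂)
      mid := fun a b hab => by
        -- `aba` is not a factor of the given isoterms. Instead b ↦ ccb turns it into the isoterm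
        -- `accba` for a fresh `c`, and deleting `c` from the resulting equality returns to the
        -- original identity.
        obtain ⟨c, hc⟩ := Infinite.exists_notMem_finset ({a, b} : Finset α)
        simp only [Finset.mem_insert, Finset.mem_singleton, not_or] at hc
        have h3 : Iso S [a, c, c, b, a] :=
          Iso.rename₃ (x := x) (y := y) (z := t₁) (a := c) (b := a) (c := b) [1, 0, 0, 2, 1] hl
            (by simp [hc.1, hc.2, hab]) h₁
        refine iso_of_content one fun v hv hmem => ?_
        let f : α → List α := fun d => if d = b then [c, c, b] else [d]
        have e1 : [a, b, a].flatMap f = [a, c, c, b, a] := by simp [f, hab]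
        have e2 := h3 _ (e1 ▸ hv.flatMap f)
        have e3 := congrArg (List.filter fun d => d ≠ c) e2
        have e4 : (v.flatMap f).filter (fun d => d ≠ c) = v := by
          rw [List.filter_flatMap]
          conv_rhs => rw [← List.flatMap_singleton' v]
          refine List.flatMap_congr fun d hd => ?_
          have h4 := hmem d hd
          have hdc : d ≠ c := by
            rintro rfl
            simp [hc.1, hc.2] at h4
          by_cases hdb : d = b
          · subst hdb
            simp [f, hdc]
          · simp [f, hdb, hdc]
        rw [e4] at e3
        rw [← e3]
        simp [Ne.symm hc.1, Ne.symm hc.2] }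

theorem count_of_perm_append_self {R U : List α} (hR : R.Nodup) (h : U.Perm (R ++ R)) :
    (∀ a, U.count a ≤ 2) ∧ ∀ a ∈ U, U.count a = 2 := by
  have h1 : ∀ a, U.count a = R.count a + R.count a := fun a => by
    rw [h.count_eq, List.count_append]
  have h2 := List.nodup_iff_count_le_one.1 hR
  refine ⟨fun a => ?_, fun a ha => ?_⟩
  · have := h1 a
    have := h2 a
    omega
  · have := h1 a
    have := h2 a
    have := List.count_pos_iff.2 ha
    omega

variable {W : Set (FreeMonoid α)}

/-- As `xtxyt'y` is not an isoterm, its middle letters may be swapped in S(W). A subword of `W`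
matching either side would be moved by this identity, so both patterns are excluded; together with
`hpow` this leaves only powers of one letter as images. -/
theorem nfb_of_first_second [Infinite α] (hl : [x, y, t₁, t₂].Nodup)
    (hW : ∀ w ∈ W, BlockSimple 2 w)
    (h₁ : Iso (SMonoid W) [y, x, x, t₁, y]) (h₂ : Iso (SMonoid W) [y, t₁, x, x, y])
    (h₃ : ¬ Iso (SMonoid W) [x, t₁, x, y, t₂, y])
    (h₄ : ∀ m, 1 < m → ¬ Iso (SMonoid W) (x :: (List.replicate m y ++ [x]))) : NFB W := by
  have hl3 : [x, y, t₁].Nodup := by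
    simp at hl ⊢; tauto
  have hxy : x ≠ y := by
    simp at hl; tauto
  have hS := squareIso_of_first_second hl3 h₁ h₂
  have hswap := middle_sat_of_not_iso hl
    (iso_of_square hS (a := x) (b := t₂) (t := t₁) (by simp at hl ⊢; grind)).1
    (iso_of_square hS (a := y) (b := t₁) (t := t₂) (by simp at hl ⊢; grind)).2 hS.one h₃
  have hn1 : t₁ ≠ x ∧ t₁ ≠ y ∧ t₂ ≠ x ∧ t₂ ≠ y ∧ t₂ ≠ t₁ ∧ y ≠ x := by
    simp at hl; grind
  have hsw : ∀ (a b : α) (X Y : List α), a ≠ b →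
      ¬ IsSub W (a :: (X ++ a :: b :: (Y ++ [b]))) ∧
      ¬ IsSub W (a :: (X ++ b :: a :: (Y ++ [b]))) := by
    intro a b X Y hab
    let f : α → List α := fun d => if d = x then [a] else if d = y then [b] else
      if d = t₁ then X else Y
    have e1 : [x, t₁, x, y, t₂, y].flatMap f = a :: (X ++ a :: b :: (Y ++ [b])) := by
      simp [f, hn1]
    have e2 : [x, t₁, y, x, t₂, y].flatMap f = a :: (X ++ b :: a :: (Y ++ [b])) := by
      simp [f, hn1]
    constructor
    · intro h
      have := hswap.flatMap_eq f (by rwa [e1])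
      rw [e1, e2] at this
      simp [hab] at this
    · intro h
      have := hswap.symm.flatMap_eq f (by rwa [e2])
      rw [e1, e2] at this
      simp [hab] at this
  have hpow : ∀ (a b : α) (m : ℕ), a ≠ b → 1 < m →
      ¬ IsSub W (a :: (List.replicate m b ++ [a])) := fun a b m hab hm h => by
    refine h₄ m hm ?_
    have := Iso.rename₂ (x := a) (y := b) (a := x) (b := y) (0 :: (List.replicate m 1 ++ [0]))
      hab hxy (by simpa using h.iso)
    simpa using this
  have heq : ∀ {z : List α}, IsSub W z → (∀ a ∈ z, 2 ≤ z.count a) → ∀ a ∈ z, ∀ b ∈ z, a = b :=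
    fun hz h2 a ha b hb => eq_of_mem_of_swap (F := IsSub W) (fun _ _ _ h => h.factor) hpow
      (fun a b X Y hab => (hsw a b X Y hab).1) (fun a b X Y hab => (hsw a b X Y hab).2) hz
      (hz.card_le hW h2) h2 ha hb
  refine not_finitelyBased_of fun K => ?_
  obtain ⟨A, B, hA, hAB, hne, hUV, hrep, hfar⟩ :=
    exists_crossFar_word (Infinite.natEmbedding α).injective K
  have hc := count_of_perm_append_self hA ((List.Perm.refl A).append hAB.symm)
  have hc' := count_of_perm_append_self hA (hAB.symm.append (List.Perm.refl A))
  have hp : (A ++ B).Perm (B ++ A) := List.perm_append_comm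
  refine ⟨A ++ B, B ++ A, hUV, hne, fun h => hne (List.append_eq_nil_iff.2 (List.append_eq_nil_iff.1 h).symm), ?_, ?_⟩
  · refine lsat_of_flatMap_eq (fun f hf => ?_) fun f hf => ?_
    · exact (eq_of_perm_of_forall_eq (hp.flatMap_right f)
        (heq hf (two_le_count_flatMap fun a ha => (hc.2 a ha).ge))).symm
    · exact (eq_of_perm_of_forall_eq (hp.symm.flatMap_right f)
        (heq hf (two_le_count_flatMap fun a ha => (hc'.2 a ha).ge))).symm
  · intro s t f hst hcard hf hs
    refine hS.eq_of_crossFar (fun a b t hd => ?_) (fun a b t hd => ?_)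
      ⟨hs, hf, hcard, hc.1, hrep⟩ hfar hst
    · exact Iso.rename₃ [1, 0, 0, 2, 1] hl3 hd h₁
    · exact Iso.rename₃ [1, 2, 0, 0, 1] hl3 hd h₂

/-- Here V is the reverse of U: reversal is invisible to any two letters whose restriction is not of
the form `yzyz`. -/
theorem nfb_of_separated_limited [Infinite α] (hl : [x, y, t₁, t₂].Nodup)
    (hW : ∀ w ∈ W, BlockSimple 2 w)
    (h₁ : Iso (SMonoid W) [x, t₁, x, y, t₂, y]) (h₂ : Iso (SMonoid W) [x, y, t₁, x, y])
    (h₃ : Iso (SMonoid W) [x, y, t₁, y, x])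
    (h₄ : ∀ l : List α, word l ∈ almostLinearWords α 4 → ¬ Iso (SMonoid W) l)
    (h₅ : ¬ Iso (SMonoid W) [x, y, x, y]) : NFB W := by
  have hxy : x ≠ y := by
    simp at hl; tauto
  have hS := separatedIso_of hl h₁ h₂ h₃
  have hF : ∀ a b : α, a ≠ b → ¬ IsSub W [a, b, a, b] := fun a b hab h =>
    h₅ (Iso.rename₂ [0, 1, 0, 1] hab hxy h.iso)
  refine not_finitelyBased_of fun K => ?_
  obtain ⟨A, B, hA, hB, hAB, hne, -, hUV, hrep, hfar⟩ :=
    exists_separated_word (Infinite.natEmbedding α).injective K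
  have hc := count_of_perm_append_self hA ((List.Perm.refl A).append hAB.symm)
  have hp : (A ++ B).Perm (A ++ B).reverse := (List.reverse_perm _).symm
  have hmem : ∀ {C D : List α}, C.Perm D → ∀ {a}, a ∈ C ++ D → a ∈ C := fun hCD a ha =>
    (List.mem_append.1 ha).elim id hCD.mem_iff.2
  refine ⟨A ++ B, (A ++ B).reverse, hUV, hne, fun h => hne (List.reverse_eq_nil_iff.1 h), ?_, ?_⟩
  · refine lsat_of_flatMap_eq (fun f hf => ?_) fun f hf => ?_
    · exact flatMap_eq_of_res_pair (F := IsSub W) (fun z hz => hz.card_le hW)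
        (fun z a hz => hz.count_le_three hl hS.one hS.pair h₄ a) hc.2 hp
        (fun y z hyz hy hz => res_pair_reverse hA hB hAB hF hyz (hmem hAB hy) (hmem hAB hz)) hf
    · refine flatMap_eq_of_res_pair (F := IsSub W) (fun z hz => hz.card_le hW)
        (fun z a hz => hz.count_le_three hl hS.one hS.pair h₄ a)
        (fun a ha => by
          rw [List.count_reverse]
          exact hc.2 a (List.mem_reverse.1 ha)) hp.symm (fun y z hyz hy hz => ?_) hf
      have hAB' : B.reverse.Perm A.reverse :=
        (List.reverse_perm B).trans (hAB.symm.trans (List.reverse_perm A).symm)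
      rw [List.reverse_append] at hy hz
      have := res_pair_reverse (List.nodup_reverse.2 hB) (List.nodup_reverse.2 hA) hAB' hF hyz
        (hmem hAB' hy) (hmem hAB' hz)
      simpa using this
  · intro s t f hst hcard hf hs
    exact hS.eq ⟨hs, hf, hcard, hc.1, hrep⟩ hfar hst

/-- Here V = BA. Letters may occur many times in subwords of `W`, so whole images are compared:
those of `A` and `B` are permutations of each other and must coincide. -/
theorem nfb_of_separated_power [Infinite α] (hl : [x, y, t₁, t₂].Nodup)
    (hW : ∀ w ∈ W, BlockSimple 2 w)
    (h₁ : Iso (SMonoid W) [x, t₁, x, y, t₂, y]) (h₂ : Iso (SMonoid W) [x, y, t₁, x, y])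
    (h₃ : Iso (SMonoid W) [x, y, t₁, y, x]) (h₄ : ¬ Iso (SMonoid W) [x, y, x, y, x])
    (h₅ : ∀ m, 1 < m → ¬ Iso (SMonoid W) (x :: (List.replicate m y ++ [x]))) : NFB W := by
  have hxy : x ≠ y := by
    simp at hl; tauto
  have hS := separatedIso_of hl h₁ h₂ h₃
  have halt : ∀ a b : α, a ≠ b → ¬ IsSub W [a, b, a, b, a] := fun a b hab h =>
    h₄ (Iso.rename₂ [0, 1, 0, 1, 0] hab hxy h.iso)
  have hpow : ∀ (a b : α) (m : ℕ), a ≠ b → 1 < m →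
      ¬ IsSub W (a :: (List.replicate m b ++ [a])) := fun a b m hab hm h => by
    refine h₅ m hm ?_
    have := Iso.rename₂ (x := a) (y := b) (a := x) (b := y) (0 :: (List.replicate m 1 ++ [0]))
      hab hxy (by simpa using h.iso)
    simpa using this
  refine not_finitelyBased_of fun K => ?_
  obtain ⟨A, B, hA, hB, hAB, hne, hUV, -, hrep, hfar⟩ :=
    exists_separated_word (Infinite.natEmbedding α).injective K
  have hc := count_of_perm_append_self hA ((List.Perm.refl A).append hAB.symm)
  have key : ∀ {C D : List α} (f : α → List α), C.Perm D → (∀ a ∈ C ++ D, 2 ≤ (C ++ D).count a) →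
      IsSub W ((C ++ D).flatMap f) → (D ++ C).flatMap f = (C ++ D).flatMap f := by
    intro C D f hCD hCD2 hf
    have h2 := hf.card_le hW (two_le_count_flatMap hCD2)
    rw [List.flatMap_append] at hf h2
    rw [List.flatMap_append, List.flatMap_append, eq_of_halves (F := IsSub W)
      (fun _ _ _ h => h.factor) hpow halt (hCD.flatMap_right f) hf h2]
  refine ⟨A ++ B, B ++ A, hUV, hne, fun h => hne (List.append_eq_nil_iff.2 (List.append_eq_nil_iff.1 h).symm), ?_, ?_⟩
  · refine lsat_of_flatMap_eq (fun f hf => ?_) fun f hf => ?_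
    · exact key f hAB (fun a ha => (hc.2 a ha).ge) hf
    · refine key f hAB.symm (fun a ha => ?_) hf
      rw [(List.perm_append_comm (l₁ := B) (l₂ := A)).count_eq]
      exact (hc.2 a (List.perm_append_comm.mem_iff.1 ha)).ge
  · intro s t f hst hcard hf hs
    exact hS.eq ⟨hs, hf, hcard, hc.1, hrep⟩ hfar hst

theorem nfb_of_nested [Infinite α] (hl : [x, y, t₁, t₂].Nodup)
    (hW : ∀ w ∈ W, BlockSimple 2 w)
    (h₁ : Iso (SMonoid W) [x, t₁, x, y, t₂, y]) (h₂ : Iso (SMonoid W) [x, y, y, x])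
    (h₄ : ∀ l : List α, word l ∈ almostLinearWords α 4 → ¬ Iso (SMonoid W) l)
    (h₅ : ¬ Iso (SMonoid W) [x, x, y, y]) : NFB W := by
  have hxy : x ≠ y := by
    simp at hl; tauto
  have hS := squareIso_of_nested hl h₁ h₂
  have hF : ∀ a b : α, a ≠ b → ¬ IsSub W [a, a, b, b] := fun a b hab h =>
    h₅ (Iso.rename₂ [0, 0, 1, 1] hab hxy h.iso)
  refine not_finitelyBased_of fun K => ?_
  obtain ⟨e, he⟩ : ∃ e : ℕ → α, Function.Injective e := ⟨_, (Infinite.natEmbedding α).injective⟩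
  -- `nestedWord_nestedFar` is applied with D = 2K and needs D + 2 ≤ n.
  obtain ⟨n, hn⟩ : ∃ n, n = 2 * K + 2 := ⟨_, rfl⟩
  obtain ⟨A, hAdef⟩ : ∃ A, A = (List.range n).map e := ⟨_, rfl⟩
  obtain ⟨B, hBdef⟩ : ∃ B, B = ((List.range n).map (· + n)).map e := ⟨_, rfl⟩
  have hU : (nestedWord n).map e = (A ++ A.reverse) ++ (B ++ B.reverse) := by
    simp [nestedWord, hAdef, hBdef]
  have hA : A.Nodup := hAdef ▸ List.nodup_range.map he
  have hB : B.Nodup := hBdef ▸ (List.nodup_range.map (add_left_injective n)).map he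
  have hdisj : ∀ a ∈ A, a ∉ B := by
    intro a ha hb
    simp only [hAdef, hBdef, List.mem_map, List.mem_range] at ha hb
    obtain ⟨i, hi, rfl⟩ := ha
    obtain ⟨_, ⟨j, hj, rfl⟩, hij⟩ := hb
    have := he hij
    omega
  have hrep := norep_map he (nestedWord_norep (n := n))
  have hfar := (nestedWord_nestedFar (n := n) (D := 2 * K) (by omega)).map he
  rw [hU] at hfar
  simp only [hU] at hrep
  have h0 : e 0 ∈ A := by
    rw [hAdef]
    exact List.mem_map_of_mem (by simp; omega)
  have hperm : ∀ {C D : List α}, ((C ++ C.reverse) ++ (D ++ D.reverse)).Perm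
      ((C ++ D) ++ (C ++ D)) := fun {C D} => by
    rw [List.perm_iff_count]
    intro a
    simp only [List.count_append, List.count_reverse]
    omega
  have hc := count_of_perm_append_self (hA.append hB fun a ha hb => hdisj a ha hb) hperm
  have hc' := count_of_perm_append_self (hB.append hA fun a hb ha => hdisj a ha hb) hperm
  have hp : ((A ++ A.reverse) ++ (B ++ B.reverse)).Perm
    ((B ++ B.reverse) ++ (A ++ A.reverse)) := List.perm_append_comm
  refine ⟨(A ++ A.reverse) ++ (B ++ B.reverse), (B ++ B.reverse) ++ (A ++ A.reverse), ?_, ?_, ?_,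
    ?_, ?_⟩
  · intro h
    have h1 := (List.append_inj h (by simp [hAdef, hBdef])).1
    have h2 : e 0 ∈ B ++ B.reverse := h1 ▸ List.mem_append_left _ h0
    exact hdisj _ h0 (by simpa using h2)
  · exact List.ne_nil_of_mem (a := e 0) (by simp [h0])
  · exact List.ne_nil_of_mem (a := e 0) (by simp [h0])
  · refine lsat_of_flatMap_eq (fun f hf => ?_) fun f hf => ?_
    · exact flatMap_eq_of_res_pair (F := IsSub W) (fun z hz => hz.card_le hW)
        (fun z a hz => hz.count_le_three hl hS.one hS.pair h₄ a) hc.2 hp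
        (fun y z hyz hy hz => res_pair_swap hA hB hdisj hF (by simpa using hy)
          (by simpa using hz)) hf
    · exact flatMap_eq_of_res_pair (F := IsSub W) (fun z hz => hz.card_le hW)
        (fun z a hz => hz.count_le_three hl hS.one hS.pair h₄ a) hc'.2 hp.symm
        (fun y z hyz hy hz => res_pair_swap hB hA (fun a hb ha => hdisj a ha hb) hF
          (by simpa using hy) (by simpa using hz)) hf
  · intro s t f hst hcard hf hs
    refine hS.eq_of_nestedFar (fun a b hab => ?_) (fun a b t t' hd => ?_)
      ⟨hs, hf, hcard, hc.1, hrep⟩ hfar hst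
    · exact Iso.rename₂ [0, 1, 1, 0] hxy hab h₂
    · exact Iso.rename₄ [0, 2, 0, 1, 3, 1] hl hd h₁

end Rows

end WordBasis

/-! ### Assembling the rows -/

theorem mainTheorem2 {α : Type u} [DecidableEq α] [Infinite α]
    (x y t₁ t₂ : α) (hletters : [x, y, t₁, t₂].Nodup)
    (I N : Set (FreeMonoid α)) (hrow : WordBasis.TableRow x y t₁ t₂ I N)
    (W : Set (FreeMonoid α)) (hW : ∀ w ∈ W, WordBasis.BlockSimple 2 w)
    (hI : WordBasis.Prec W I) (hN : ∀ n ∈ N, ¬ WordBasis.Prec W {n}) :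
    WordBasis.NFB W := by
  have hpow : WordBasis.powerWords x y ⊆ N → ∀ m, 1 < m →
      ¬ WordBasis.Iso (WordBasis.SMonoid W) (x :: (List.replicate m y ++ [x])) :=
    fun hsub m hm => WordBasis.not_iso_of_not_prec
      (WordBasis.powerWord_eq x y m ▸ hN _ (hsub ⟨m, hm, rfl⟩))
  have hnot : ∀ l : List α, WordBasis.word l ∈ N → ¬ WordBasis.Iso (WordBasis.SMonoid W) l :=
    fun l hl => WordBasis.not_iso_of_not_prec (hN _ hl)
  have hiso : ∀ l : List α, WordBasis.word l ∈ I → WordBasis.Iso (WordBasis.SMonoid W) l :=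
    fun l hl => WordBasis.isoterm_of_prec hI hl
  cases hrow with
  | row1 =>
    exact WordBasis.nfb_of_first_second hletters hW (hiso _ (by simp)) (hiso _ (by simp))
      (hnot _ (by simp)) (hpow Set.subset_union_right)
  | row2 =>
    exact WordBasis.nfb_of_separated_limited hletters hW (hiso _ (by simp)) (hiso _ (by simp))
      (hiso _ (by simp)) (fun l hl => hnot l (Or.inl hl)) (hnot _ (by simp))
  | row3 =>
    exact WordBasis.nfb_of_nested hletters hW (hiso _ (by simp)) (hiso _ (by simp))
      (fun l hl => hnot l (Or.inl hl)) (hnot _ (by simp))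
  | row4 =>
    exact WordBasis.nfb_of_separated_power hletters hW (hiso _ (by simp)) (hiso _ (by simp))
      (hiso _ (by simp)) (hnot _ (by simp)) (hpow Set.subset_union_right)
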